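/- **Theorem 5.1 (Existence of Optimal Controls).** Let $n\ge 0$, $f,g:\mathbb R^n\times\mathbb R^n\to\mathbb R^n$ be bounded functions of class $C^1$, $x_0,\xi_0\in\mathbb R^n$, $h>0$, $N\ge 1$ an integer, $T=Nh$, $K>0$, $\mathcal T\subseteq\mathbb R^n$ and $\Psi:\mathbb R^n\to\mathbb R$. An *impulsive control* $(\mu,\{w^r\}_{r\in[0,h]})$ consists of a finite non-negative Borel measure $\mu$ on $[0,T]$ and measurable functions $w^r=(w^r_1,\dots,w^r_N):[0,1]\to[0,\infty)^N$, $r\in[0,h]$, such that 1. for all $r\in[0,h]$: $\sum_{i=1}^N w^r_i(s)=\sum_{i=1}^N\int_0^1 w^r_i(s')\,ds'$ for a.e. $s\in[0,1]$; 2. for all $r\in(0,h)$ and $i=1,\dots,N$: $\int_0^1 w^r_i(s)\,ds=\mu(\{r+(i-1)h\})$; 3. for $i=0,\dots,N$: $\int_0^1[w^h_i(s)+w^0_{i+1}(s)]\,ds=\mu(\{ih\})$, where $w^h_0\equiv 0$ and $w^0_{N+1}\equiv 0$. An *extended process* is a triple $(x,\mu,\{w^r\}_{r\in[0,h]})$ in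 which $(\mu,\{w^r\})$ is an impulsive control and $x:[-h,T]\to\mathbb R^n$ is a function of bounded variation with $x(t)=\xi_0$ for $t\in[-h,0)$ and $x(0)=x_0$ for which there are functions $\zeta^r_i:[0,1]\to\mathbb R^n$ ($r\in[0,h]$, $0\le i\le N$) with the following properties. * $\zeta^r_0(s)=\xi_0$ if $s<1$ or $r<h$, and $\zeta^h_0(1)=x_0$. For $i=1,\dots,N$ and $r\in[0,h]$, $\zeta^r_i$ is absolutely continuous with $\frac{d}{ds}\zeta^r_i(s)=w^r_i(s)\,g(\zeta^r_i(s),\zeta^r_{i-1}(s))$ for a.e. $s\in[0,1]$, $\zeta^r_i(0)=x\big((r+(i-1)h)^-\big)$ if $r>0$, and $\zeta^0_i(0)=\zeta^h_{i-1}(1)$. * $x((i-1)h)=\zeta^0_i(1)$ for $i=2,\dots,N$, and $x(T)=\zeta^h_N(1)$. * For $i=1,\dots,N$ and $t\in((i-1)h,ih)$, $$x(t)=\zeta^0_i(1)+\int_{(i-1)h}^t f(x(t'),x(t'-h))\,dt'+\int_{[(i-1)h,t]}g(x(t'),x(t'-h))\,d\mu^c(t')+\sum_{r\in(0,\,t-(i-1)h]}\Big(\zeta^r_i(1)-x\big((r+(i-1)h)^-\big)\Big),$$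 where $\mu^c$ is the continuous (atomless) component of $\mu$ and the sum converges absolutely. An extended process is *admissible* if $\|\mu\|_{TV}\le K$ and $x(T)\in\mathcal T$. It is *optimal* (for the problem (P) of minimizing $\Psi(x(T))$ over admissible extended processes) if it is admissible and $\Psi(x(T))\le\Psi(\tilde x(T))$ for every admissible extended process $(\tilde x,\tilde\mu,\{\tilde w^r\})$. Suppose that $\mathcal T$ is closed, that $\Psi$ is lower semicontinuous, and that an admissible extended process exists. Then there exists an optimal extended process. -/

import Mathlib

open Set MeasureTheory

namespace DelayImpulsive

/-- The data `f, g, x₀, ξ₀, h, N` of the impulsive control system with time delay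
`dx(t) = f(x(t), x(t-h)) dt + g(x(t), x(t-h)) dμ(t)` on `[0, N h]`, with `x(0) = x₀` and
`x(t) = ξ₀` for `t ∈ [-h, 0[`. -/
structure System (n : ℕ) where
  /-- the drift, a function of the state and of the delayed state -/
  f : EuclideanSpace ℝ (Fin n) × EuclideanSpace ℝ (Fin n) → EuclideanSpace ℝ (Fin n)
  /-- the coefficient of the measure control -/
  g : EuclideanSpace ℝ (Fin n) × EuclideanSpace ℝ (Fin n) → EuclideanSpace ℝ (Fin n)
  /-- the value of the state at time `0` -/
  x₀ : EuclideanSpace ℝ (Fin n)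
  /-- the value of the state before time `0` -/
  ξ₀ : EuclideanSpace ℝ (Fin n)
  /-- the time delay -/
  h : ℝ
  /-- the number of delays in the time horizon -/
  N : ℕ

/-- The end time `T = N h`. -/
def System.T {n : ℕ} (D : System n) : ℝ := D.N * D.h

/-- A triple `(x, μ, {w^r})`. The function `x` matters on `[-h, T]`, and `w r i s` stands for
`w^r_i(s)` and matters for `r ∈ [0, h]`, `1 ≤ i ≤ N`, `s ∈ [0, 1]` only. -/
structure Triple (n : ℕ) where
  /-- the state trajectory -/
  x : ℝ → EuclideanSpace ℝ (Fin n)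
  /-- the measure control -/
  μ : Measure ℝ
  /-- the attached controls -/
  w : ℝ → ℕ → ℝ → ℝ

/-- The continuous (atomless) component `μᶜ` of a finite measure `μ` on the line: `μ` restricted to
the complement of its (countable) set of atoms. -/
noncomputable def contPart (μ : Measure ℝ) : Measure ℝ :=
  μ.restrict {t | μ {t} = 0}

/-- `(μ, {w^r}_{r ∈ [0,h]})` is an impulsive control. A finite non-negative Borel measure on
`[0, N h]` is represented by a finite Borel measure on the line that vanishes off `[0, N h]`. -/
structure IsImpulsiveControl (h : ℝ) (N : ℕ) (μ : Measure ℝ) (w : ℝ → ℕ → ℝ → ℝ) : Prop where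
  finite : IsFiniteMeasure μ
  support : μ (Icc 0 (N * h))ᶜ = 0
  measurable : ∀ r ∈ Icc 0 h, ∀ i ∈ Finset.Icc 1 N,
    AEMeasurable (w r i) (volume.restrict (Icc 0 1))
  nonneg : ∀ r ∈ Icc 0 h, ∀ i ∈ Finset.Icc 1 N, ∀ s ∈ Icc (0 : ℝ) 1, 0 ≤ w r i s
  sum_eq : ∀ r ∈ Icc 0 h, ∀ᵐ s ∂(volume.restrict (Icc (0 : ℝ) 1)),
    ∑ i ∈ Finset.Icc 1 N, w r i s = ∑ i ∈ Finset.Icc 1 N, ∫ s' in (0 : ℝ)..1, w r i s'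
  atom_interior : ∀ r ∈ Ioo 0 h, ∀ i ∈ Finset.Icc 1 N,
    ∫ s in (0 : ℝ)..1, w r i s = μ.real {r + ((i : ℝ) - 1) * h}
  /-- here `w^h_0` and `w^0_{N+1}` are taken to be `0` -/
  atom_node : ∀ i ∈ Finset.Icc 0 N,
    ∫ s in (0 : ℝ)..1, ((if i = 0 then 0 else w h i s) + (if i = N then 0 else w 0 (i + 1) s))
      = μ.real {(i : ℝ) * h}

/-- The functions `ζ^r_i : [0, 1] → ℝⁿ`, written `ζ r i`, for `r ∈ [0, h]` and `0 ≤ i ≤ N`, that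
describe the evolution of the state during its jumps: they solve the coupled differential
equations `dζ^r_i/ds = w^r_i g(ζ^r_i, ζ^r_{i-1})` with the boundary conditions
`ζ^r_i(0) = x⁻(r + (i-1) h)` if `r > 0` and `ζ^0_i(0) = ζ^h_{i-1}(1)`. -/
structure IsJumpFamily {n : ℕ} (D : System n) (p : Triple n)
    (ζ : ℝ → ℕ → ℝ → EuclideanSpace ℝ (Fin n)) : Prop where
  zero_eq : ∀ r ∈ Icc 0 D.h, ∀ s ∈ Icc (0 : ℝ) 1, s < 1 ∨ r < D.h → ζ r 0 s = D.ξ₀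
  zero_end : ζ D.h 0 1 = D.x₀
  absCont : ∀ r ∈ Icc 0 D.h, ∀ i ∈ Finset.Icc 1 D.N, AbsolutelyContinuousOnInterval (ζ r i) 0 1
  ode : ∀ r ∈ Icc 0 D.h, ∀ i ∈ Finset.Icc 1 D.N, ∀ᵐ s ∂(volume.restrict (Icc (0 : ℝ) 1)),
    HasDerivAt (ζ r i) (p.w r i s • D.g (ζ r i s, ζ r (i - 1) s)) s
  init_pos : ∀ r ∈ Ioc 0 D.h, ∀ i ∈ Finset.Icc 1 D.N,
    ζ r i 0 = Function.leftLim p.x (r + ((i : ℝ) - 1) * D.h)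
  init_zero : ∀ i ∈ Finset.Icc 1 D.N, ζ 0 i 0 = ζ D.h (i - 1) 1

/-- `(x, μ, {w^r}_{r ∈ [0,h]})` is an extended process: `(μ, {w^r})` is an impulsive control, `x`
has bounded variation on `[-h, T]`, and, together with the jump functions `ζ^r_i`, it satisfies the
integral form of the state equation on each interval `](i-1)h, ih[` and the conditions at its ends.
(In the sum over the jumps only countably many terms are nonzero.) -/
def IsExtendedProcess {n : ℕ} (D : System n) (p : Triple n) : Prop :=
  IsImpulsiveControl D.h D.N p.μ p.w ∧
  BoundedVariationOn p.x (Icc (-D.h) D.T) ∧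
  (∀ t ∈ Ico (-D.h) 0, p.x t = D.ξ₀) ∧
  p.x 0 = D.x₀ ∧
  ∃ ζ : ℝ → ℕ → ℝ → EuclideanSpace ℝ (Fin n),
    IsJumpFamily D p ζ ∧
    (∀ i ∈ Finset.Icc 2 D.N, p.x (((i : ℝ) - 1) * D.h) = ζ 0 i 1) ∧
    (∀ i ∈ Finset.Icc 1 D.N, ∀ t ∈ Ioo (((i : ℝ) - 1) * D.h) ((i : ℝ) * D.h),
      Summable (fun r : Ioc 0 (t - ((i : ℝ) - 1) * D.h) =>
        ζ r i 1 - Function.leftLim p.x (r + ((i : ℝ) - 1) * D.h)) ∧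
      p.x t = ζ 0 i 1
        + (∫ t' in (((i : ℝ) - 1) * D.h)..t, D.f (p.x t', p.x (t' - D.h)))
        + (∫ t' in Icc (((i : ℝ) - 1) * D.h) t, D.g (p.x t', p.x (t' - D.h)) ∂(contPart p.μ))
        + ∑' r : Ioc 0 (t - ((i : ℝ) - 1) * D.h),
            (ζ r i 1 - Function.leftLim p.x (r + ((i : ℝ) - 1) * D.h))) ∧
    p.x D.T = ζ D.h D.N 1

/-- An extended process is admissible if `‖μ‖_TV ≤ K` and `x(T) ∈ 𝒯`. (The total variation of a
non-negative measure is its total mass.) -/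
def IsAdmissible {n : ℕ} (D : System n) (K : ℝ) (𝒯 : Set (EuclideanSpace ℝ (Fin n)))
    (p : Triple n) : Prop :=
  IsExtendedProcess D p ∧ p.μ univ ≤ ENNReal.ofReal K ∧ p.x D.T ∈ 𝒯

/-- An admissible extended process is optimal if it minimizes `Ψ(x(T))` over all admissible
extended processes. -/
def IsOptimal {n : ℕ} (D : System n) (K : ℝ) (𝒯 : Set (EuclideanSpace ℝ (Fin n)))
    (Ψ : EuclideanSpace ℝ (Fin n) → ℝ) (p : Triple n) : Prop :=
  IsAdmissible D K 𝒯 p ∧ ∀ q : Triple n, IsAdmissible D K 𝒯 q → Ψ (p.x D.T) ≤ Ψ (q.x D.T)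

end DelayImpulsive

namespace DelayImpulsive

open Filter Topology

/-- The fundamental theorem of calculus for an absolutely continuous function with a bounded
a.e. derivative. -/
lemma integral_eq_sub_of_absolutelyContinuous {E : Type*} [NormedAddCommGroup E] [NormedSpace ℝ E]
    [CompleteSpace E] {F φ : ℝ → E} {a b C : ℝ} (hF : AbsolutelyContinuousOnInterval F a b)
    (hφ : IntervalIntegrable φ volume a b) (hC : ∀ᵐ x, x ∈ uIcc a b → ‖φ x‖ ≤ C)
    (hd : ∀ᵐ x, x ∈ uIcc a b → HasDerivAt F (φ x) x) :
    ∫ x in a..b, φ x = F b - F a := by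
  have hI : AbsolutelyContinuousOnInterval (fun x => ∫ t in a..x, φ t) a b := by
    refine LipschitzOnWith.absolutelyContinuousOnInterval (K := C.toNNReal)
      (LipschitzOnWith.of_dist_le_mul fun x hx y hy => ?_)
    have hint : ∀ z ∈ uIcc a b, IntervalIntegrable φ volume a z := fun z hz =>
      hφ.mono_set (uIcc_subset_uIcc left_mem_uIcc hz)
    rw [dist_eq_norm, intervalIntegral.integral_interval_sub_left (hint x hx) (hint y hy),
      Real.dist_eq]
    refine intervalIntegral.norm_integral_le_of_norm_le_const_ae ?_
    filter_upwards [hC] with z hz hzxy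
    exact (hz (uIcc_subset_uIcc hy hx (uIoc_subset_uIcc hzxy))).trans (Real.le_coe_toNNReal C)
  have hac : AbsolutelyContinuousOnInterval (fun x => F x - ∫ t in a..x, φ t) a b :=
    hF.fun_sub hI
  have h0 : ∀ᵐ x, x ∈ uIcc a b → HasDerivAt (fun x => F x - ∫ t in a..x, φ t) 0 x := by
    filter_upwards [hd, hφ.ae_hasDerivAt_integral] with x h1 h2 h3
    simpa using (h1 h3).fun_sub (h2 h3 a (by simp))
  obtain ⟨D, hD⟩ := hac.const_of_ae_hasDerivAt_zero h0
  have h1 := hD a (by simp)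
  have h2 := hD b (by simp)
  simp only [intervalIntegral.integral_same, sub_zero] at h1
  rw [← h1] at h2
  rw [← h2]
  abel

lemma aestronglyMeasurable_of_boundedVariationOn {n : ℕ} {x : ℝ → EuclideanSpace ℝ (Fin n)}
    {s : Set ℝ} (hs : MeasurableSet s) (hx : BoundedVariationOn x s) (μ : Measure ℝ) :
    AEStronglyMeasurable x (μ.restrict s) := by
  refine AEMeasurable.aestronglyMeasurable ?_
  have hcoord : ∀ j, AEMeasurable (fun t => x t j) (μ.restrict s) := by
    intro j
    have hbv : BoundedVariationOn (fun t => x t j) s :=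
      ((EuclideanSpace.proj (𝕜 := ℝ) j : EuclideanSpace ℝ (Fin n) →L[ℝ] ℝ).lipschitz
        ).comp_boundedVariationOn
        hx
    obtain ⟨p, q, hp, hq, hpq⟩ :=
      hbv.locallyBoundedVariationOn.exists_monotoneOn_sub_monotoneOn
    rw [hpq]
    exact (aemeasurable_restrict_of_monotoneOn hs hp).sub
      (aemeasurable_restrict_of_monotoneOn hs hq)
  have h : AEMeasurable (fun t => (WithLp.ofLp (x t))) (μ.restrict s) := aemeasurable_pi_iff.2 hcoord
  exact (WithLp.measurable_toLp 2 (Fin n → ℝ)).comp_aemeasurable h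

lemma boundedVariationOn_of_dominated {E : Type*} [SeminormedAddCommGroup E] {x : ℝ → E}
    {V : ℝ → ℝ} {s : Set ℝ} {C : ℝ} (hV : MonotoneOn V s) (hC : ∀ t ∈ s, |V t| ≤ C)
    (hx : ∀ t ∈ s, ∀ t' ∈ s, t ≤ t' → ‖x t' - x t‖ ≤ V t' - V t) : BoundedVariationOn x s := by
  have hle : eVariationOn x s ≤ ENNReal.ofReal (2 * C) := by
    refine iSup_le fun p => ?_
    obtain ⟨k, u, hu, us⟩ := p
    have h1 : ∀ i ∈ Finset.range k,
        edist (x (u (i + 1))) (x (u i)) ≤ ENNReal.ofReal (V (u (i + 1)) - V (u i)) := by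
      intro i _
      rw [edist_dist, dist_eq_norm]
      exact ENNReal.ofReal_le_ofReal (hx _ (us i) _ (us (i + 1)) (hu (Nat.le_succ i)))
    refine (Finset.sum_le_sum h1).trans ?_
    rw [← ENNReal.ofReal_sum_of_nonneg
      (fun i _ => sub_nonneg.2 (hV (us i) (us (i + 1)) (hu (Nat.le_succ i)))),
      Finset.sum_range_sub (fun i => V (u i))]
    refine ENNReal.ofReal_le_ofReal ?_
    have h2 := abs_le.1 (hC _ (us k))
    have h3 := abs_le.1 (hC _ (us 0))
    linarith
  exact ne_top_of_le_ne_top ENNReal.ofReal_ne_top hle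

lemma countable_atoms (μ : Measure ℝ) [IsFiniteMeasure μ] : {t | μ {t} = 0}ᶜ.Countable := by
  refine (Measure.countable_meas_level_set_pos (μ := μ) (g := id) measurable_id).mono ?_
  intro t ht
  simpa [pos_iff_ne_zero] using ht

lemma measurableSet_null_singleton (μ : Measure ℝ) [IsFiniteMeasure μ] :
    MeasurableSet {t | μ {t} = 0} :=
  (countable_atoms μ).measurableSet.of_compl

lemma contPart_singleton (μ : Measure ℝ) [IsFiniteMeasure μ] (t : ℝ) : contPart μ {t} = 0 := by
  rw [contPart, Measure.restrict_apply (measurableSet_singleton t)]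
  by_cases ht : μ {t} = 0
  · exact measure_mono_null inter_subset_left ht
  · rw [singleton_inter_eq_empty.2 (by simpa using ht), measure_empty]

instance (μ : Measure ℝ) [IsFiniteMeasure μ] : IsFiniteMeasure (contPart μ) := by
  unfold contPart; infer_instance

lemma tendsto_real_Iic_left (m : Measure ℝ) [IsFiniteMeasure m] (r : ℝ) :
    Tendsto (fun t => m.real (Iic t)) (𝓝[<] r) (𝓝 (m.real (Iio r))) := by
  have hmono : Monotone (fun t => m.real (Iic t)) :=
    fun a b hab => measureReal_mono (Iic_subset_Iic.2 hab)
  have h1 := hmono.tendsto_nhdsLT r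
  obtain ⟨u, hu, hur, hut⟩ := exists_seq_strictMono_tendsto' (show r - 1 < r by linarith)
  have hU : ⋃ k, Iic (u k) = Iio r := by
    ext t
    simp only [mem_iUnion, mem_Iic, mem_Iio]
    refine ⟨fun ⟨k, hk⟩ => hk.trans_lt (hur k).2, fun ht => ?_⟩
    exact ((hut.eventually (lt_mem_nhds ht)).exists).imp fun k hk => hk.le
  have h2 : Tendsto (fun k => m.real (Iic (u k))) atTop (𝓝 (m.real (Iio r))) := by
    rw [← hU]
    exact (ENNReal.tendsto_toReal (measure_ne_top _ _)).comp
      (tendsto_measure_iUnion_atTop (fun a b hab => Iic_subset_Iic.2 (hu.monotone hab)))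
  have h3 : Tendsto u atTop (𝓝[<] r) :=
    tendsto_nhdsWithin_iff.2 ⟨hut, Eventually.of_forall fun k => (hur k).2⟩
  rwa [tendsto_nhds_unique (h1.comp h3) h2] at h1

lemma tendsto_real_Iio_right (m : Measure ℝ) [IsFiniteMeasure m] (r : ℝ) :
    Tendsto (fun t => m.real (Iio t)) (𝓝[>] r) (𝓝 (m.real (Iic r))) := by
  have hmono : Monotone (fun t => m.real (Iio t)) :=
    fun a b hab => measureReal_mono (Iio_subset_Iio hab)
  have h1 := hmono.tendsto_nhdsGT r
  obtain ⟨u, hu, hur, hut⟩ := exists_seq_strictAnti_tendsto' (show r < r + 1 by linarith)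
  have hU : ⋂ k, Iio (u k) = Iic r := by
    ext t
    simp only [mem_iInter, mem_Iic, mem_Iio]
    refine ⟨fun h => ge_of_tendsto' hut fun k => (h k).le, fun ht k => ht.trans_lt (hur k).1⟩
  have h2 : Tendsto (fun k => m.real (Iio (u k))) atTop (𝓝 (m.real (Iic r))) := by
    rw [← hU]
    exact (ENNReal.tendsto_toReal (measure_ne_top _ _)).comp
      (tendsto_measure_iInter_atTop (fun k => measurableSet_Iio.nullMeasurableSet)
        (fun a b hab => Iio_subset_Iio (hu.antitone hab)) ⟨0, measure_ne_top _ _⟩)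
  have h3 : Tendsto u atTop (𝓝[>] r) :=
    tendsto_nhdsWithin_iff.2 ⟨hut, Eventually.of_forall fun k => (hur k).1⟩
  rwa [tendsto_nhds_unique (h1.comp h3) h2] at h1

/-- Existence of quantiles for a finite measure carried by an interval. -/
lemma exists_quantile (m : Measure ℝ) [IsFiniteMeasure m] {h : ℝ} (hh : 0 ≤ h)
    (hm : m (Icc 0 h)ᶜ = 0) {u : ℝ} (hu : u ∈ Icc 0 (m.real univ)) :
    ∃ r ∈ Icc 0 h, m.real (Iio r) ≤ u ∧ u ≤ m.real (Iic r) := by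
  have h0 : m.real (Iio 0) = 0 := by
    rw [measureReal_def, measure_mono_null _ hm, ENNReal.toReal_zero]
    intro t ht ht'
    exact absurd ht'.1 (not_le.2 ht)
  have h1 : m.real (Iic h) = m.real univ := by
    rw [measureReal_def, measureReal_def, measure_eq_measure_of_null_sdiff (subset_univ _)]
    refine measure_mono_null ?_ hm
    intro t ht ht'
    exact ht.2 ht'.2
  set S := {t | t ∈ Icc 0 h ∧ m.real (Iio t) ≤ u} with hS
  have hS0 : (0 : ℝ) ∈ S := ⟨⟨le_rfl, hh⟩, h0.trans_le hu.1⟩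
  have hSb : BddAbove S := ⟨h, fun t ht => ht.1.2⟩
  have hr0 : 0 ≤ sSup S := le_csSup hSb hS0
  have hrh : sSup S ≤ h := csSup_le ⟨0, hS0⟩ fun t ht => ht.1.2
  refine ⟨sSup S, ⟨hr0, hrh⟩, ?_, ?_⟩
  · refine le_of_tendsto (tendsto_real_Iic_left m (sSup S)) ?_
    filter_upwards [self_mem_nhdsWithin] with t ht
    obtain ⟨t', ht', htt'⟩ := exists_lt_of_lt_csSup ⟨0, hS0⟩ ht
    exact (measureReal_mono (Iic_subset_Iio.2 htt')).trans ht'.2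
  · rcases hrh.eq_or_lt with heq | hlt
    · rw [heq, h1]; exact hu.2
    · refine ge_of_tendsto (tendsto_real_Iio_right m (sSup S)) ?_
      filter_upwards [Ioo_mem_nhdsGT hlt] with t ht
      by_contra hcon
      exact absurd (le_csSup hSb (show t ∈ S from
        ⟨⟨hr0.trans ht.1.le, ht.2.le⟩, (not_le.1 hcon).le⟩)) (not_le.2 ht.1)

/-- The integral over the preimage of a set splits into the part over the points of null fibre and
the sum over the fibres. -/
lemma setIntegral_preimage_eq_add_tsum {E : Type*} [NormedAddCommGroup E] [NormedSpace ℝ E]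
    [CompleteSpace E] (m : Measure ℝ) [IsFiniteMeasure m] {θ : ℝ → ℝ} (hθ : Measurable θ)
    {B : Set ℝ} (hB : MeasurableSet B) {φ : ℝ → E} (hφ : IntegrableOn φ (θ ⁻¹' B) m) :
    Summable (fun r : B => ∫ s in θ ⁻¹' {(r : ℝ)}, φ s ∂m) ∧
      ∫ s in θ ⁻¹' B, φ s ∂m = (∫ s in θ ⁻¹' (B ∩ {r | m.map θ {r} = 0}), φ s ∂m)
        + ∑' r : B, ∫ s in θ ⁻¹' {(r : ℝ)}, φ s ∂m := by
  set S := {r | m.map θ {r} = 0} with hS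
  have hSm : MeasurableSet S := measurableSet_null_singleton _
  have hCc : (B ∩ Sᶜ).Countable := (countable_atoms (m.map θ)).mono inter_subset_right
  have : Countable ↥(B ∩ Sᶜ) := hCc.to_subtype
  have hU : ⋃ r : ↥(B ∩ Sᶜ), θ ⁻¹' {(r : ℝ)} = θ ⁻¹' (B ∩ Sᶜ) := by
    ext s
    simp
  have hs : HasSum (fun r : ↥(B ∩ Sᶜ) => ∫ s in θ ⁻¹' {(r : ℝ)}, φ s ∂m)
      (∫ s in θ ⁻¹' (B ∩ Sᶜ), φ s ∂m) := by
    rw [← hU]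
    refine hasSum_integral_iUnion (fun r => hθ (measurableSet_singleton _)) ?_ ?_
    · intro a b hab
      exact Disjoint.preimage θ (disjoint_singleton.2 fun h => hab (Subtype.ext h))
    · rw [hU]
      exact hφ.mono_set (preimage_mono inter_subset_left)
  have hzero : ∀ r ∈ S, ∫ s in θ ⁻¹' {r}, φ s ∂m = 0 := by
    intro r hr
    refine setIntegral_measure_zero _ ?_
    rwa [hS, mem_ofPred_eq, Measure.map_apply hθ (measurableSet_singleton _)] at hr
  have hs' : HasSum (fun r : B => ∫ s in θ ⁻¹' {(r : ℝ)}, φ s ∂m)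
      (∫ s in θ ⁻¹' (B ∩ Sᶜ), φ s ∂m) := by
    refine (Function.Injective.hasSum_iff (g := fun r : ↥(B ∩ Sᶜ) => (⟨r, r.2.1⟩ : B)) ?_ ?_).1 hs
    · intro a b hab
      exact Subtype.ext (congrArg (fun r : B => (r : ℝ)) hab)
    · intro r hr
      by_cases h : (r : ℝ) ∈ S
      · exact hzero _ h
      · exact absurd ⟨⟨r, r.2, h⟩, rfl⟩ hr
  refine ⟨hs'.summable, ?_⟩
  rw [hs'.tsum_eq, ← setIntegral_union]
  · rw [← preimage_union, ← inter_union_distrib_left, union_compl_self, inter_univ]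
  · exact Disjoint.preimage θ (disjoint_compl_right.mono inter_subset_right inter_subset_right)
  · exact hθ (hB.inter hSm.compl)
  · exact hφ.mono_set (preimage_mono inter_subset_left)
  · exact hφ.mono_set (preimage_mono inter_subset_left)

variable {n : ℕ}

/-- A process folded onto `[0, h]`: `m i` is the measure control of the `i`-th delay interval
`[(i-1)h, ih]`, translated to `[0, h]`, with the atoms at the nodes `ih` distributed between the
adjacent intervals according to the attached controls, and `ζ r i` the evolution during the jump at
`r`, so that `ζ r i 1` is the state at time `r + (i-1)h`. -/
structure IsFolded (D : System n) (m : ℕ → Measure ℝ) (w : ℝ → ℕ → ℝ → ℝ)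
    (ζ : ℝ → ℕ → ℝ → EuclideanSpace ℝ (Fin n)) : Prop where
  finite : ∀ i, IsFiniteMeasure (m i)
  support : ∀ i, m i (Icc 0 D.h)ᶜ = 0
  measurable : ∀ r ∈ Icc 0 D.h, ∀ i ∈ Finset.Icc 1 D.N,
    AEMeasurable (w r i) (volume.restrict (Icc 0 1))
  nonneg : ∀ r ∈ Icc 0 D.h, ∀ i ∈ Finset.Icc 1 D.N, ∀ s ∈ Icc (0 : ℝ) 1, 0 ≤ w r i s
  sum_eq : ∀ r ∈ Icc 0 D.h, ∀ᵐ s ∂(volume.restrict (Icc (0 : ℝ) 1)),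
    ∑ i ∈ Finset.Icc 1 D.N, w r i s = ∑ i ∈ Finset.Icc 1 D.N, ∫ s' in (0 : ℝ)..1, w r i s'
  atom : ∀ r ∈ Icc 0 D.h, ∀ i ∈ Finset.Icc 1 D.N, ∫ s in (0 : ℝ)..1, w r i s = (m i).real {r}
  delay : ∀ r s, ζ r 0 s = D.ξ₀
  absCont : ∀ r ∈ Icc 0 D.h, ∀ i ∈ Finset.Icc 1 D.N, AbsolutelyContinuousOnInterval (ζ r i) 0 1
  ode : ∀ r ∈ Icc 0 D.h, ∀ i ∈ Finset.Icc 1 D.N, ∀ᵐ s ∂(volume.restrict (Icc (0 : ℝ) 1)),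
    HasDerivAt (ζ r i) (w r i s • D.g (ζ r i s, ζ r (i - 1) s)) s
  start : ζ 0 1 0 = D.x₀
  link : ∀ i ∈ Finset.Icc 2 D.N, ζ 0 i 0 = ζ D.h (i - 1) 1
  left : ∀ r ∈ Ioc 0 D.h, ∀ i ∈ Finset.Icc 1 D.N,
    Tendsto (fun ρ => ζ ρ i 1) (𝓝[<] r) (𝓝 (ζ r i 0))
  bv : ∀ i ∈ Finset.Icc 1 D.N, BoundedVariationOn (fun ρ => ζ ρ i 1) (Ioo 0 D.h)
  dyn : ∀ i ∈ Finset.Icc 1 D.N, ∀ τ ∈ Ioo 0 D.h,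
    Summable (fun r : Ioc 0 τ => ζ r i 1 - ζ r i 0) ∧
      ζ τ i 1 = ζ 0 i 1 + (∫ ρ in (0 : ℝ)..τ, D.f (ζ ρ i 1, ζ ρ (i - 1) 1))
        + (∫ ρ in Ioc 0 τ, D.g (ζ ρ i 1, ζ ρ (i - 1) 1) ∂(contPart (m i)))
        + ∑' r : Ioc 0 τ, (ζ r i 1 - ζ r i 0)

/-- The projection of the line onto `[0, 1]`. -/
def clamp (s : ℝ) : ℝ := max 0 (min s 1)

/-- A reparametrized process: on the parameter interval `[0, 1]` (the line being projected onto it),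
`A 0` is the time in `[0, h]`, `A i` the mass that the measure control of the `i`-th delay interval
has spent, and `y i` the state in the `i`-th delay interval. The differential equation
`dy i = f dA 0 + g dA i` is replaced by a second-order estimate of the increments, which is stable
under pointwise limits. -/
structure IsCurve (D : System n) (K B L : ℝ) (A : ℕ → ℝ → ℝ)
    (y : ℕ → ℝ → EuclideanSpace ℝ (Fin n)) : Prop where
  A_nonneg : ∀ i s, 0 ≤ A i s
  A_le : ∀ i s, A i s ≤ D.h + K
  y_le : ∀ i s, ‖y i s‖ ≤ B
  mono : ∀ i s t, s ≤ t → A i s ≤ A i t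
  sum_eq : ∀ s, ∑ i ∈ Finset.range (D.N + 1), A i s
    = clamp s * ∑ i ∈ Finset.range (D.N + 1), A i 1
  sum_le : ∑ i ∈ Finset.range (D.N + 1), A i 1 ≤ D.h + K
  clock : A 0 1 = D.h
  delay : ∀ s, y 0 s = D.ξ₀
  start : y 1 0 = D.x₀
  link : ∀ i ∈ Finset.Icc 2 D.N, y i 0 = y (i - 1) 1
  step : ∀ i ∈ Finset.Icc 1 D.N, ∀ s t, s ≤ t →
    ‖y i t - y i s - (A 0 t - A 0 s) • D.f (y i s, y (i - 1) s)
      - (A i t - A i s) • D.g (y i s, y (i - 1) s)‖ ≤ L * (clamp t - clamp s) ^ 2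

lemma isCompact_curves {D : System n} (hf : Continuous D.f) (hg : Continuous D.g) (K B L : ℝ) :
    IsCompact {p : (ℕ → ℝ → ℝ) × (ℕ → ℝ → EuclideanSpace ℝ (Fin n)) |
      IsCurve D K B L p.1 p.2} := by
  have hc : IsCompact ((univ.pi fun _ : ℕ => univ.pi fun _ : ℝ => Icc 0 (D.h + K)) ×ˢ
      (univ.pi fun _ : ℕ => univ.pi fun _ : ℝ =>
        Metric.closedBall (0 : EuclideanSpace ℝ (Fin n)) B)) :=
    (isCompact_univ_pi fun _ => isCompact_univ_pi fun _ => isCompact_Icc).prod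
      (isCompact_univ_pi fun _ => isCompact_univ_pi fun _ => isCompact_closedBall _ _)
  refine hc.of_isClosed_subset ?_ ?_
  · have heq : {p : (ℕ → ℝ → ℝ) × (ℕ → ℝ → EuclideanSpace ℝ (Fin n)) | IsCurve D K B L p.1 p.2} =
        {p | (∀ i s, 0 ≤ p.1 i s) ∧ (∀ i s, p.1 i s ≤ D.h + K) ∧ (∀ i s, ‖p.2 i s‖ ≤ B) ∧
          (∀ i s t, s ≤ t → p.1 i s ≤ p.1 i t) ∧
          (∀ s, ∑ i ∈ Finset.range (D.N + 1), p.1 i s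
            = clamp s * ∑ i ∈ Finset.range (D.N + 1), p.1 i 1) ∧
          (∑ i ∈ Finset.range (D.N + 1), p.1 i 1 ≤ D.h + K) ∧ p.1 0 1 = D.h ∧
          (∀ s, p.2 0 s = D.ξ₀) ∧ p.2 1 0 = D.x₀ ∧
          (∀ i, i ∈ Finset.Icc 2 D.N → p.2 i 0 = p.2 (i - 1) 1) ∧
          (∀ i, i ∈ Finset.Icc 1 D.N → ∀ s t, s ≤ t →
            ‖p.2 i t - p.2 i s - (p.1 0 t - p.1 0 s) • D.f (p.2 i s, p.2 (i - 1) s)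
              - (p.1 i t - p.1 i s) • D.g (p.2 i s, p.2 (i - 1) s)‖
              ≤ L * (clamp t - clamp s) ^ 2)} := by
      ext p
      exact ⟨fun h => ⟨h.1, h.2, h.3, h.4, h.5, h.6, h.7, h.8, h.9, h.10, h.11⟩,
        fun ⟨h1, h2, h3, h4, h5, h6, h7, h8, h9, h10, h11⟩ =>
          ⟨h1, h2, h3, h4, h5, h6, h7, h8, h9, h10, h11⟩⟩
    rw [heq]
    simp only [ofPred_and, ofPred_forall]
    have hA : ∀ i s, Continuous fun p : (ℕ → ℝ → ℝ) × (ℕ → ℝ → EuclideanSpace ℝ (Fin n)) =>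
        p.1 i s := fun i s => by fun_prop
    have hy : ∀ i s, Continuous fun p : (ℕ → ℝ → ℝ) × (ℕ → ℝ → EuclideanSpace ℝ (Fin n)) =>
        p.2 i s := fun i s => by fun_prop
    have hsum : ∀ s, Continuous fun p : (ℕ → ℝ → ℝ) × (ℕ → ℝ → EuclideanSpace ℝ (Fin n)) =>
        ∑ i ∈ Finset.range (D.N + 1), p.1 i s := fun s =>
      continuous_finsetSum _ fun i _ => hA i s
    refine IsClosed.inter ?_ <| IsClosed.inter ?_ <| IsClosed.inter ?_ <| IsClosed.inter ?_ <|
      IsClosed.inter ?_ <| IsClosed.inter ?_ <| IsClosed.inter ?_ <| IsClosed.inter ?_ <|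
      IsClosed.inter ?_ <| IsClosed.inter ?_ ?_
    · exact isClosed_iInter fun i => isClosed_iInter fun s => isClosed_le continuous_const (hA i s)
    · exact isClosed_iInter fun i => isClosed_iInter fun s => isClosed_le (hA i s) continuous_const
    · exact isClosed_iInter fun i => isClosed_iInter fun s =>
        isClosed_le (hy i s).norm continuous_const
    · exact isClosed_iInter fun i => isClosed_iInter fun s => isClosed_iInter fun t =>
        isClosed_iInter fun _ => isClosed_le (hA i s) (hA i t)
    · exact isClosed_iInter fun s => isClosed_eq (hsum s) (continuous_const.mul (hsum 1))
    · exact isClosed_le (hsum 1) continuous_const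
    · exact isClosed_eq (hA 0 1) continuous_const
    · exact isClosed_iInter fun s => isClosed_eq (hy 0 s) continuous_const
    · exact isClosed_eq (hy 1 0) continuous_const
    · exact isClosed_iInter fun i => isClosed_iInter fun _ => isClosed_eq (hy i 0) (hy (i - 1) 1)
    · refine isClosed_iInter fun i => isClosed_iInter fun _ => isClosed_iInter fun s =>
        isClosed_iInter fun t => isClosed_iInter fun _ => isClosed_le ?_ continuous_const
      exact ((((hy i t).sub (hy i s)).sub (((hA 0 t).sub (hA 0 s)).smul
        (hf.comp ((hy i s).prodMk (hy (i - 1) s))))).sub (((hA i t).sub (hA i s)).smul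
        (hg.comp ((hy i s).prodMk (hy (i - 1) s))))).norm
  · intro p hp
    refine ⟨fun i _ s _ => ⟨hp.A_nonneg i s, hp.A_le i s⟩, fun i _ s _ => ?_⟩
    simpa using hp.y_le i s

/-- The mass spent by the `i`-th control at the position `p = (r, s)`: `s ∈ [0, 1]` parametrizes the
jump at the time `r`. -/
noncomputable def mass (m : ℕ → Measure ℝ) (w : ℝ → ℕ → ℝ → ℝ) (i : ℕ) (p : ℝ × ℝ) : ℝ :=
  (m i).real (Iio p.1) + ∫ s in (0 : ℝ)..p.2, w p.1 i s

/-- The parameter at the position `p = (r, s)`: time plus total mass spent. -/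
noncomputable def total (N : ℕ) (m : ℕ → Measure ℝ) (w : ℝ → ℕ → ℝ → ℝ) (p : ℝ × ℝ) : ℝ :=
  p.1 + ∑ i ∈ Finset.Icc 1 N, mass m w i p

/-- The lexicographic order of positions. -/
def LexLE (p q : ℝ × ℝ) : Prop := p.1 < q.1 ∨ (p.1 = q.1 ∧ p.2 ≤ q.2)

lemma LexLE.refl (p : ℝ × ℝ) : LexLE p p := Or.inr ⟨rfl, le_rfl⟩

lemma LexLE.fst_le {p q : ℝ × ℝ} (h : LexLE p q) : p.1 ≤ q.1 := h.elim le_of_lt fun h => h.1.le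

lemma LexLE.of_not {p q : ℝ × ℝ} (h : ¬ LexLE p q) : LexLE q p := by
  unfold LexLE at *
  push Not at h
  rcases h.1.eq_or_lt with h1 | h1
  · exact Or.inr ⟨h1, (h.2 h1.symm).le⟩
  · exact Or.inl h1

section Folded

variable {D : System n} {m : ℕ → Measure ℝ} {w : ℝ → ℕ → ℝ → ℝ}
  {ζ : ℝ → ℕ → ℝ → EuclideanSpace ℝ (Fin n)}

lemma IsFolded.w_le (hF : IsFolded D m w ζ) {r : ℝ} (hr : r ∈ Icc 0 D.h) {i : ℕ}
    (hi : i ∈ Finset.Icc 1 D.N) : ∀ᵐ s ∂(volume.restrict (Icc (0 : ℝ) 1)),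
      w r i s ≤ ∑ j ∈ Finset.Icc 1 D.N, (m j).real {r} := by
  filter_upwards [hF.sum_eq r hr, ae_restrict_mem measurableSet_Icc] with s hs hs1
  rw [Finset.sum_congr rfl fun j hj => hF.atom r hr j hj] at hs
  rw [← hs]
  exact Finset.single_le_sum (fun j hj => hF.nonneg r hr j hj s hs1) hi

lemma IsFolded.integrableOn_w (hF : IsFolded D m w ζ) {r : ℝ} (hr : r ∈ Icc 0 D.h) {i : ℕ}
    (hi : i ∈ Finset.Icc 1 D.N) : IntegrableOn (w r i) (Icc 0 1) := by
  refine Integrable.of_bound (hF.measurable r hr i hi).aestronglyMeasurable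
    (∑ j ∈ Finset.Icc 1 D.N, (m j).real {r}) ?_
  filter_upwards [hF.w_le hr hi, ae_restrict_mem measurableSet_Icc] with s hs hs1
  rwa [Real.norm_of_nonneg (hF.nonneg r hr i hi s hs1)]

lemma IsFolded.intervalIntegrable_w (hF : IsFolded D m w ζ) {r : ℝ} (hr : r ∈ Icc 0 D.h) {i : ℕ}
    (hi : i ∈ Finset.Icc 1 D.N) {a b : ℝ} (ha : a ∈ Icc (0 : ℝ) 1) (hb : b ∈ Icc (0 : ℝ) 1) :
    IntervalIntegrable (w r i) volume a b :=
  ((hF.integrableOn_w hr hi).mono_set (uIcc_subset_Icc ha hb)).intervalIntegrable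

lemma IsFolded.integral_w_nonneg (hF : IsFolded D m w ζ) {r : ℝ} (hr : r ∈ Icc 0 D.h) {i : ℕ}
    (hi : i ∈ Finset.Icc 1 D.N) {a b : ℝ} (ha : 0 ≤ a) (hab : a ≤ b) (hb : b ≤ 1) :
    0 ≤ ∫ s in a..b, w r i s :=
  intervalIntegral.integral_nonneg hab fun s hs =>
    hF.nonneg r hr i hi s ⟨ha.trans hs.1, hs.2.trans hb⟩

lemma IsFolded.continuousOn (hF : IsFolded D m w ζ) {r : ℝ} (hr : r ∈ Icc 0 D.h) {i : ℕ}
    (hi : i ≤ D.N) : ContinuousOn (ζ r i) (Icc 0 1) := by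
  rcases Nat.eq_zero_or_pos i with rfl | hpos
  · rw [show ζ r 0 = fun _ => D.ξ₀ from funext (hF.delay r)]
    exact continuousOn_const
  · have := (hF.absCont r hr i (Finset.mem_Icc.2 ⟨hpos, hi⟩)).continuousOn
    rwa [uIcc_of_le zero_le_one] at this

lemma IsFolded.norm_jump_sub_le (hF : IsFolded D m w ζ) (hg : Continuous D.g) {M : ℝ}
    (hM : ∀ z, ‖D.g z‖ ≤ M) {r : ℝ} (hr : r ∈ Icc 0 D.h) {i : ℕ} (hi : i ∈ Finset.Icc 1 D.N)
    {a b : ℝ} (ha : 0 ≤ a) (hab : a ≤ b) (hb : b ≤ 1) {β : EuclideanSpace ℝ (Fin n)} {ε : ℝ}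
    (hβ : ∀ s ∈ Icc a b, ‖D.g (ζ r i s, ζ r (i - 1) s) - β‖ ≤ ε) :
    ‖ζ r i b - ζ r i a - (∫ s in a..b, w r i s) • β‖ ≤ ε * ∫ s in a..b, w r i s := by
  have ha' : a ∈ Icc (0 : ℝ) 1 := ⟨ha, hab.trans hb⟩
  have hb' : b ∈ Icc (0 : ℝ) 1 := ⟨ha.trans hab, hb⟩
  have hsub : uIcc a b ⊆ Icc 0 1 := uIcc_subset_Icc ha' hb'
  have hiN := (Finset.mem_Icc.1 hi).2
  have hw := hF.intervalIntegrable_w hr hi ha' hb'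
  have hgc : ContinuousOn (fun s => D.g (ζ r i s, ζ r (i - 1) s)) (uIcc a b) :=
    hg.comp_continuousOn (((hF.continuousOn hr hiN).prodMk
      (hF.continuousOn hr ((Nat.sub_le i 1).trans hiN))).mono hsub)
  have hint : IntervalIntegrable (fun s => w r i s • D.g (ζ r i s, ζ r (i - 1) s)) volume a b :=
    hw.smul_continuousOn hgc
  have hwle := (ae_restrict_iff' measurableSet_Icc).1 (hF.w_le hr hi)
  have hode := (ae_restrict_iff' measurableSet_Icc).1 (hF.ode r hr i hi)
  have hM0 : 0 ≤ M := (norm_nonneg _).trans (hM 0)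
  have hJ0 : 0 ≤ ∑ j ∈ Finset.Icc 1 D.N, (m j).real {r} :=
    Finset.sum_nonneg fun _ _ => measureReal_nonneg
  have hftc : ∫ s in a..b, w r i s • D.g (ζ r i s, ζ r (i - 1) s) = ζ r i b - ζ r i a := by
    refine integral_eq_sub_of_absolutelyContinuous
      (C := (∑ j ∈ Finset.Icc 1 D.N, (m j).real {r}) * M)
      ((hF.absCont r hr i hi).mono (by rwa [uIcc_of_le zero_le_one])) hint ?_ ?_
    · filter_upwards [hwle] with s hs hsab
      rw [norm_smul, Real.norm_of_nonneg (hF.nonneg r hr i hi s (hsub hsab))]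
      exact mul_le_mul (hs (hsub hsab)) (hM _) (norm_nonneg _) hJ0
    · filter_upwards [hode] with s hs hsab
      exact hs (hsub hsab)
  have hdiff : ζ r i b - ζ r i a - (∫ s in a..b, w r i s) • β
      = ∫ s in a..b, w r i s • (D.g (ζ r i s, ζ r (i - 1) s) - β) := by
    simp_rw [smul_sub]
    rw [intervalIntegral.integral_sub hint (hw.smul_continuousOn continuousOn_const), hftc,
      intervalIntegral.integral_smul_const]
  rw [hdiff, ← intervalIntegral.integral_const_mul]
  refine intervalIntegral.norm_integral_le_of_norm_le hab (Eventually.of_forall fun s hs => ?_)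
    (hw.const_mul ε)
  have hs' : s ∈ Icc a b := Ioc_subset_Icc_self hs
  have hw0 := hF.nonneg r hr i hi s ⟨ha.trans hs'.1, hs'.2.trans hb⟩
  rw [norm_smul, Real.norm_of_nonneg hw0, mul_comm]
  exact mul_le_mul_of_nonneg_right (hβ s hs') hw0

lemma aestronglyMeasurable_restrict_of_countable {E : Type*} [NormedAddCommGroup E] (φ : ℝ → E)
    (μ : Measure ℝ) {s : Set ℝ} (hs : s.Countable) :
    AEStronglyMeasurable φ (μ.restrict s) := by
  have := hs.to_subtype
  rw [← biUnion_of_singleton s, biUnion_eq_iUnion, aestronglyMeasurable_iUnion_iff]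
  intro t
  rw [Measure.restrict_singleton]
  exact aestronglyMeasurable_dirac.smul_measure _

/-- The increments of a folded process between the jumps, in integral form: the jumps are expressed
by a density with respect to the measure control. -/
lemma IsFolded.exists_density (hF : IsFolded D m w ζ) (hf : Continuous D.f) (hg : Continuous D.g)
    {M : ℝ} (hMf : ∀ z, ‖D.f z‖ ≤ M) (hM : ∀ z, ‖D.g z‖ ≤ M) {i : ℕ} (hi : i ∈ Finset.Icc 1 D.N) :
    ∃ Γ : ℝ → EuclideanSpace ℝ (Fin n), IntegrableOn Γ (Ioo 0 D.h) (m i) ∧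
      IntegrableOn (fun ρ => D.f (ζ ρ i 1, ζ ρ (i - 1) 1)) (Ioo 0 D.h) ∧
      (∀ ρ ∈ Ioo 0 D.h, ∀ β ε, (∀ s ∈ Icc (0 : ℝ) 1, ‖D.g (ζ ρ i s, ζ ρ (i - 1) s) - β‖ ≤ ε) →
        ‖Γ ρ - β‖ ≤ ε) ∧
      ∀ r τ, 0 ≤ r → r ≤ τ → τ < D.h → ζ τ i 1 - ζ r i 1
        = (∫ ρ in Ioc r τ, D.f (ζ ρ i 1, ζ ρ (i - 1) 1)) + ∫ ρ in Ioc r τ, Γ ρ ∂(m i) := by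
  have := hF.finite
  have h01 : (1 : ℝ) ∈ Icc (0 : ℝ) 1 := ⟨zero_le_one, le_rfl⟩
  set G : ℝ → EuclideanSpace ℝ (Fin n) := fun ρ => D.g (ζ ρ i 1, ζ ρ (i - 1) 1) with hG
  set S : Set ℝ := {ρ | m i {ρ} = 0} with hS
  have hSm : MeasurableSet S := measurableSet_null_singleton _
  classical
  set Γ : ℝ → EuclideanSpace ℝ (Fin n) :=
    S.piecewise G fun ρ => ((m i).real {ρ})⁻¹ • (ζ ρ i 1 - ζ ρ i 0) with hΓ
  have hstate : ∀ μ : Measure ℝ, ∀ j ≤ D.N,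
      AEStronglyMeasurable (fun ρ => ζ ρ j 1) (μ.restrict (Ioo 0 D.h)) := by
    intro μ j hj
    rcases Nat.eq_zero_or_pos j with rfl | hpos
    · simp only [hF.delay]; exact aestronglyMeasurable_const
    · exact aestronglyMeasurable_of_boundedVariationOn measurableSet_Ioo
        (hF.bv j (Finset.mem_Icc.2 ⟨hpos, hj⟩)) μ
  have hiN := (Finset.mem_Icc.1 hi).2
  have hpair : ∀ μ : Measure ℝ,
      AEStronglyMeasurable (fun ρ => (ζ ρ i 1, ζ ρ (i - 1) 1)) (μ.restrict (Ioo 0 D.h)) :=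
    fun μ => (hstate μ i hiN).prodMk (hstate μ (i - 1) ((Nat.sub_le i 1).trans hiN))
  have hΓb : ∀ ρ ∈ Ioo 0 D.h, ∀ β ε,
      (∀ s ∈ Icc (0 : ℝ) 1, ‖D.g (ζ ρ i s, ζ ρ (i - 1) s) - β‖ ≤ ε) → ‖Γ ρ - β‖ ≤ ε := by
    intro ρ hρ β ε hβ
    by_cases hρS : ρ ∈ S
    · rw [hΓ, piecewise_eq_of_mem _ _ _ hρS]
      exact hβ 1 h01
    · rw [hΓ, piecewise_eq_of_notMem _ _ _ hρS]
      have hpos : 0 < (m i).real {ρ} := by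
        rw [measureReal_def, ENNReal.toReal_pos_iff]
        exact ⟨pos_iff_ne_zero.2 hρS, measure_lt_top _ _⟩
      have h1 := hF.norm_jump_sub_le hg hM (Ioo_subset_Icc_self hρ) hi le_rfl zero_le_one le_rfl hβ
      rw [hF.atom ρ (Ioo_subset_Icc_self hρ) i hi] at h1
      have h2 : ((m i).real {ρ})⁻¹ • (ζ ρ i 1 - ζ ρ i 0) - β
          = ((m i).real {ρ})⁻¹ • (ζ ρ i 1 - ζ ρ i 0 - (m i).real {ρ} • β) := by
        rw [smul_sub _ (ζ ρ i 1 - ζ ρ i 0), smul_smul, inv_mul_cancel₀ hpos.ne', one_smul]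
      rw [h2, norm_smul, norm_inv, Real.norm_of_nonneg hpos.le, inv_mul_le_iff₀ hpos, mul_comm]
      exact h1
  have hΓm : AEStronglyMeasurable Γ ((m i).restrict (Ioo 0 D.h)) := by
    rw [← inter_union_compl (Ioo 0 D.h) S, aestronglyMeasurable_union_iff]
    constructor
    · refine AEStronglyMeasurable.congr (f := G) ?_ ?_
      · exact (hg.comp_aestronglyMeasurable (hpair (m i))).mono_measure
          (Measure.restrict_mono inter_subset_left le_rfl)
      · filter_upwards [ae_restrict_mem (measurableSet_Ioo.inter hSm)] with ρ hρ
        rw [hΓ, piecewise_eq_of_mem _ _ _ hρ.2]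
    · exact aestronglyMeasurable_restrict_of_countable _ _
        ((countable_atoms (m i)).mono inter_subset_right)
  have hΓi : IntegrableOn Γ (Ioo 0 D.h) (m i) := by
    refine Integrable.of_bound hΓm M ?_
    filter_upwards [ae_restrict_mem measurableSet_Ioo] with ρ hρ
    simpa using hΓb ρ hρ 0 M (fun s _ => by simpa using hM _)
  have hfi : IntegrableOn (fun ρ => D.f (ζ ρ i 1, ζ ρ (i - 1) 1)) (Ioo 0 D.h) :=
    Integrable.of_bound (hf.comp_aestronglyMeasurable (hpair volume)) M
      (Eventually.of_forall fun _ => hMf _)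
  have hjump : ∀ ρ ∈ Ioo 0 D.h, (m i).real {ρ} • Γ ρ = ζ ρ i 1 - ζ ρ i 0 := by
    intro ρ hρ
    by_cases hρS : ρ ∈ S
    · have h1 := hF.norm_jump_sub_le hg hM (Ioo_subset_Icc_self hρ) hi le_rfl zero_le_one le_rfl
        (β := 0) (ε := M) (fun s _ => by simpa using hM _)
      have h0 : (m i).real {ρ} = 0 := by rw [measureReal_def, hρS, ENNReal.toReal_zero]
      rw [hF.atom ρ (Ioo_subset_Icc_self hρ) i hi, h0, mul_zero, smul_zero, sub_zero] at h1
      rw [h0, zero_smul, norm_le_zero_iff.1 h1]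
    · have h0 : (m i).real {ρ} ≠ 0 := by
        rw [measureReal_def, Ne, ENNReal.toReal_eq_zero_iff, not_or]
        exact ⟨hρS, measure_ne_top _ _⟩
      rw [hΓ, piecewise_eq_of_notMem _ _ _ hρS, smul_smul, mul_inv_cancel₀ h0, one_smul]
  have hmain : ∀ τ, 0 ≤ τ → τ < D.h → ζ τ i 1 = ζ 0 i 1
      + (∫ ρ in Ioc 0 τ, D.f (ζ ρ i 1, ζ ρ (i - 1) 1)) + ∫ ρ in Ioc 0 τ, Γ ρ ∂(m i) := by
    intro τ h0 hτ
    rcases h0.eq_or_lt with rfl | hpos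
    · simp
    have hsub : Ioc 0 τ ⊆ Ioo 0 D.h := fun ρ hρ => ⟨hρ.1, hρ.2.trans_lt hτ⟩
    obtain ⟨-, h2⟩ := hF.dyn i hi τ ⟨hpos, hτ⟩
    obtain ⟨-, h3⟩ := setIntegral_preimage_eq_add_tsum (m i) measurable_id
      (measurableSet_Ioc (a := 0) (b := τ)) (φ := Γ) (hΓi.mono_set hsub)
    simp only [preimage_id, Measure.map_id] at h3
    have h4 : ∫ ρ in Ioc 0 τ ∩ S, Γ ρ ∂(m i) = ∫ ρ in Ioc 0 τ, G ρ ∂(contPart (m i)) := by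
      rw [contPart, Measure.restrict_restrict measurableSet_Ioc]
      refine setIntegral_congr_fun (measurableSet_Ioc.inter hSm) fun ρ hρ => ?_
      rw [hΓ, piecewise_eq_of_mem _ _ _ hρ.2]
    have h5 : ∑' r : Ioc 0 τ, ∫ s in {(r : ℝ)}, Γ s ∂(m i)
        = ∑' r : Ioc 0 τ, (ζ r i 1 - ζ r i 0) := by
      refine tsum_congr fun r => ?_
      rw [Measure.restrict_singleton, integral_smul_measure, integral_dirac]
      exact hjump r (hsub r.2)
    rw [h2, h3, h4, h5, intervalIntegral.integral_of_le hpos.le]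
    abel
  refine ⟨Γ, hΓi, hfi, hΓb, fun r τ h0 hrτ hτ => ?_⟩
  have hd : Disjoint (Ioc 0 r) (Ioc r τ) :=
    Set.disjoint_left.2 fun x hx hx' => absurd hx.2 (not_le.2 hx'.1)
  have hsub1 : Ioc 0 r ⊆ Ioo 0 D.h := fun ρ hρ => ⟨hρ.1, hρ.2.trans_lt (hrτ.trans_lt hτ)⟩
  have hsub2 : Ioc r τ ⊆ Ioo 0 D.h := fun ρ hρ => ⟨h0.trans_lt hρ.1, hρ.2.trans_lt hτ⟩
  rw [hmain τ (h0.trans hrτ) hτ, hmain r h0 (hrτ.trans_lt hτ), ← Ioc_union_Ioc_eq_Ioc h0 hrτ,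
    setIntegral_union hd measurableSet_Ioc (hfi.mono_set hsub1) (hfi.mono_set hsub2),
    setIntegral_union hd measurableSet_Ioc (hΓi.mono_set hsub1) (hΓi.mono_set hsub2)]
  abel

lemma norm_setIntegral_sub_le {μ : Measure ℝ} [IsLocallyFiniteMeasure μ]
    {φ : ℝ → EuclideanSpace ℝ (Fin n)} {a b ε : ℝ} {α : EuclideanSpace ℝ (Fin n)}
    (hφ : IntegrableOn φ (Ioc a b) μ) (h : ∀ ρ ∈ Ioc a b, ‖φ ρ - α‖ ≤ ε) :
    ‖∫ ρ in Ioc a b, φ ρ ∂μ - μ.real (Ioc a b) • α‖ ≤ ε * μ.real (Ioc a b) := by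
  have h1 : ∫ ρ in Ioc a b, φ ρ ∂μ - μ.real (Ioc a b) • α = ∫ ρ in Ioc a b, (φ ρ - α) ∂μ := by
    rw [integral_sub hφ (integrableOn_const measure_Ioc_lt_top.ne), setIntegral_const]
  rw [h1]
  exact norm_setIntegral_le_of_norm_le_const measure_Ioc_lt_top h

lemma IsFolded.norm_between_sub_le (hF : IsFolded D m w ζ) (hf : Continuous D.f)
    (hg : Continuous D.g) {M : ℝ} (hMf : ∀ z, ‖D.f z‖ ≤ M) (hM : ∀ z, ‖D.g z‖ ≤ M) {i : ℕ}
    (hi : i ∈ Finset.Icc 1 D.N) {r r' : ℝ} (hr : 0 ≤ r) (hrr : r < r') (hr' : r' ≤ D.h)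
    {α β : EuclideanSpace ℝ (Fin n)} {ε : ℝ}
    (hα : ∀ ρ ∈ Ioo r r', ‖D.f (ζ ρ i 1, ζ ρ (i - 1) 1) - α‖ ≤ ε)
    (hβ : ∀ ρ ∈ Ioo r r', ∀ s ∈ Icc (0 : ℝ) 1, ‖D.g (ζ ρ i s, ζ ρ (i - 1) s) - β‖ ≤ ε) :
    ‖ζ r' i 0 - ζ r i 1 - (r' - r) • α - ((m i).real (Iio r') - (m i).real (Iic r)) • β‖
      ≤ ε * ((r' - r) + ((m i).real (Iio r') - (m i).real (Iic r))) := by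
  have := hF.finite
  obtain ⟨Γ, hΓi, hfi, hΓb, hinc⟩ := hF.exists_density hf hg hMf hM hi
  have hid : Tendsto (fun t : ℝ => t) (𝓝[<] r') (𝓝 r') :=
    tendsto_nhdsWithin_of_tendsto_nhds tendsto_id
  have hm := (tendsto_real_Iic_left (m i) r').sub_const ((m i).real (Iic r))
  have ht := hid.sub_const r
  have hlim := ((((hF.left r' ⟨hr.trans_lt hrr, hr'⟩ i hi).sub_const (ζ r i 1)).sub
    (ht.smul_const α)).sub (hm.smul_const β)).norm
  refine le_of_tendsto_of_tendsto hlim ((ht.add hm).const_mul ε) ?_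
  filter_upwards [Ioo_mem_nhdsLT hrr] with τ hτ
  have hsub : Ioc r τ ⊆ Ioo r r' := fun ρ hρ => ⟨hρ.1, hρ.2.trans_lt hτ.2⟩
  have hsub' : Ioc r τ ⊆ Ioo 0 D.h := fun ρ hρ =>
    ⟨hr.trans_lt hρ.1, (hρ.2.trans_lt hτ.2).trans_le hr'⟩
  have e1 := norm_setIntegral_sub_le (hfi.mono_set hsub') fun ρ hρ => hα ρ (hsub hρ)
  have e2 := norm_setIntegral_sub_le (hΓi.mono_set hsub') fun ρ hρ =>
    hΓb ρ (hsub' hρ) β ε (hβ ρ (hsub hρ))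
  have hmI : (m i).real (Ioc r τ) = (m i).real (Iic τ) - (m i).real (Iic r) := by
    rw [← Iic_sdiff_Iic, measureReal_sdiff (Iic_subset_Iic.2 hτ.1.le) measurableSet_Iic]
  rw [Real.volume_real_Ioc_of_le hτ.1.le] at e1
  rw [hmI] at e2
  rw [hinc r τ hr hτ.1.le (hτ.2.trans_le hr'), mul_add]
  refine le_trans (le_of_eq ?_) ((norm_add_le _ _).trans (add_le_add e1 e2))
  congr 1
  abel

lemma IsFolded.mass_one (hF : IsFolded D m w ζ) {r : ℝ} (hr : r ∈ Icc 0 D.h) {i : ℕ}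
    (hi : i ∈ Finset.Icc 1 D.N) : mass m w i (r, 1) = (m i).real (Iic r) := by
  have := hF.finite
  rw [mass, hF.atom r hr i hi, ← Iio_union_right, measureReal_union (by simp)
    (measurableSet_singleton r)]

lemma IsFolded.mass_sub (hF : IsFolded D m w ζ) {r : ℝ} (hr : r ∈ Icc 0 D.h) {i : ℕ}
    (hi : i ∈ Finset.Icc 1 D.N) {a b : ℝ} (ha : a ∈ Icc (0 : ℝ) 1) (hb : b ∈ Icc (0 : ℝ) 1) :
    mass m w i (r, b) - mass m w i (r, a) = ∫ s in a..b, w r i s := by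
  have h0 : (0 : ℝ) ∈ Icc (0 : ℝ) 1 := ⟨le_rfl, zero_le_one⟩
  simp only [mass]
  rw [← intervalIntegral.integral_add_adjacent_intervals (hF.intervalIntegrable_w hr hi h0 ha)
    (hF.intervalIntegrable_w hr hi ha hb)]
  ring

lemma IsFolded.mass_mono (hF : IsFolded D m w ζ) {i : ℕ} (hi : i ∈ Finset.Icc 1 D.N) {p q : ℝ × ℝ}
    (hp : p ∈ Icc 0 D.h ×ˢ Icc (0 : ℝ) 1) (hq : q ∈ Icc 0 D.h ×ˢ Icc (0 : ℝ) 1)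
    (hpq : LexLE p q) : mass m w i p ≤ mass m w i q := by
  have := hF.finite
  obtain ⟨r, a⟩ := p
  obtain ⟨r', b⟩ := q
  obtain ⟨hr, ha⟩ := hp
  obtain ⟨hr', hb⟩ := hq
  have h1 : (1 : ℝ) ∈ Icc (0 : ℝ) 1 := ⟨zero_le_one, le_rfl⟩
  rcases hpq with hlt | ⟨heq, hle⟩
  · have e1 := hF.mass_sub hr hi ha h1
    have e2 := hF.integral_w_nonneg hr hi ha.1 ha.2 le_rfl
    have e3 := hF.integral_w_nonneg hr' hi le_rfl hb.1 hb.2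
    rw [hF.mass_one hr hi] at e1
    have e4 : (m i).real (Iic r) ≤ (m i).real (Iio r') :=
      measureReal_mono (Iic_subset_Iio.2 hlt)
    have e5 : mass m w i (r', b) = (m i).real (Iio r') + ∫ s in (0 : ℝ)..b, w r' i s := rfl
    linarith
  · simp only at heq hle
    subst heq
    have e1 := hF.mass_sub hr hi ha hb
    have e2 := hF.integral_w_nonneg hr hi ha.1 hle hb.2
    linarith

/-- The fundamental increment estimate for a folded process. -/
lemma IsFolded.norm_sub_le (hF : IsFolded D m w ζ) (hf : Continuous D.f)
    (hg : Continuous D.g) {M : ℝ} (hMf : ∀ z, ‖D.f z‖ ≤ M) (hM : ∀ z, ‖D.g z‖ ≤ M) {i : ℕ}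
    (hi : i ∈ Finset.Icc 1 D.N) {p q : ℝ × ℝ}
    (hp : p ∈ Icc 0 D.h ×ˢ Icc (0 : ℝ) 1) (hq : q ∈ Icc 0 D.h ×ˢ Icc (0 : ℝ) 1)
    (hpq : LexLE p q) {α β : EuclideanSpace ℝ (Fin n)} {ε : ℝ}
    (hαβ : ∀ z ∈ Icc 0 D.h ×ˢ Icc (0 : ℝ) 1, LexLE p z → LexLE z q →
      ‖D.f (ζ z.1 i z.2, ζ z.1 (i - 1) z.2) - α‖ ≤ ε ∧
      ‖D.g (ζ z.1 i z.2, ζ z.1 (i - 1) z.2) - β‖ ≤ ε) :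
    ‖ζ q.1 i q.2 - ζ p.1 i p.2 - (q.1 - p.1) • α - (mass m w i q - mass m w i p) • β‖
      ≤ ε * ((q.1 - p.1) + (mass m w i q - mass m w i p)) := by
  obtain ⟨r, a⟩ := p
  obtain ⟨r', b⟩ := q
  obtain ⟨hr, ha⟩ := hp
  obtain ⟨hr', hb⟩ := hq
  have h1 : (1 : ℝ) ∈ Icc (0 : ℝ) 1 := ⟨zero_le_one, le_rfl⟩
  have h0 : (0 : ℝ) ∈ Icc (0 : ℝ) 1 := ⟨le_rfl, zero_le_one⟩
  simp only at *
  rcases hpq with hlt | ⟨heq, hle⟩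
  · simp only at hlt
    have e1 := hF.norm_jump_sub_le hg hM hr hi ha.1 ha.2 le_rfl (β := β) (ε := ε) fun s hs =>
      (hαβ (r, s) ⟨hr, ha.1.trans hs.1, hs.2⟩ (Or.inr ⟨rfl, hs.1⟩) (Or.inl hlt)).2
    have e2 := hF.norm_between_sub_le hf hg hMf hM hi hr.1 hlt hr'.2 (α := α) (β := β) (ε := ε)
      (fun ρ hρ => (hαβ (ρ, 1) ⟨⟨hr.1.trans hρ.1.le, hρ.2.le.trans hr'.2⟩, h1⟩ (Or.inl hρ.1)
        (Or.inl hρ.2)).1)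
      (fun ρ hρ s hs => (hαβ (ρ, s) ⟨⟨hr.1.trans hρ.1.le, hρ.2.le.trans hr'.2⟩, hs⟩ (Or.inl hρ.1)
        (Or.inl hρ.2)).2)
    have e3 := hF.norm_jump_sub_le hg hM hr' hi le_rfl hb.1 hb.2 (β := β) (ε := ε) fun s hs =>
      (hαβ (r', s) ⟨hr', hs.1, hs.2.trans hb.2⟩ (Or.inl hlt) (Or.inr ⟨rfl, hs.2⟩)).2
    have f1 := hF.mass_sub hr hi ha h1
    rw [hF.mass_one hr hi] at f1
    have f3 : mass m w i (r', b) = (m i).real (Iio r') + ∫ s in (0 : ℝ)..b, w r' i s := rfl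
    have f4 : mass m w i (r', b) - mass m w i (r, a) = (∫ s in a..1, w r i s)
        + ((m i).real (Iio r') - (m i).real (Iic r)) + ∫ s in (0 : ℝ)..b, w r' i s := by
      linarith
    have f5 : ζ r' i b - ζ r i a - (r' - r) • α - (mass m w i (r', b) - mass m w i (r, a)) • β
        = (ζ r i 1 - ζ r i a - (∫ s in a..1, w r i s) • β)
        + (ζ r' i 0 - ζ r i 1 - (r' - r) • α - ((m i).real (Iio r') - (m i).real (Iic r)) • β)
        + (ζ r' i b - ζ r' i 0 - (∫ s in (0 : ℝ)..b, w r' i s) • β) := by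
      rw [f4, add_smul, add_smul]
      abel
    rw [f5, f4]
    refine (norm_add₃_le.trans (add_le_add (add_le_add e1 e2) e3)).trans (le_of_eq ?_)
    ring
  · simp only at heq hle
    subst heq
    have e1 := hF.norm_jump_sub_le hg hM hr hi ha.1 hle hb.2 (β := β) (ε := ε) fun s hs =>
      (hαβ (r, s) ⟨hr, ha.1.trans hs.1, hs.2.trans hb.2⟩ (Or.inr ⟨rfl, hs.1⟩)
        (Or.inr ⟨rfl, hs.2⟩)).2
    rw [hF.mass_sub hr hi ha hb]
    simpa using e1

end Folded

section Reparametrize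

variable {D : System n} {m : ℕ → Measure ℝ} {w : ℝ → ℕ → ℝ → ℝ}
  {ζ : ℝ → ℕ → ℝ → EuclideanSpace ℝ (Fin n)}

lemma IsFolded.total_eq (hF : IsFolded D m w ζ) {r s : ℝ} (hr : r ∈ Icc 0 D.h)
    (hs : s ∈ Icc (0 : ℝ) 1) : total D.N m w (r, s)
      = r + ∑ i ∈ Finset.Icc 1 D.N, (m i).real (Iio r)
        + s * ∑ i ∈ Finset.Icc 1 D.N, (m i).real {r} := by
  have h0 : (0 : ℝ) ∈ Icc (0 : ℝ) 1 := ⟨le_rfl, zero_le_one⟩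
  have h1 : ∑ i ∈ Finset.Icc 1 D.N, ∫ s' in (0 : ℝ)..s, w r i s'
      = s * ∑ i ∈ Finset.Icc 1 D.N, (m i).real {r} := by
    rw [← intervalIntegral.integral_finsetSum fun i hi => hF.intervalIntegrable_w hr hi h0 hs]
    have hae := (ae_restrict_iff' measurableSet_Icc).1 (hF.sum_eq r hr)
    rw [intervalIntegral.integral_congr_ae
      (g := fun _ => ∑ i ∈ Finset.Icc 1 D.N, (m i).real {r})]
    · simp
    · filter_upwards [hae] with s' hs' hmem
      rw [uIoc_of_le hs.1] at hmem
      rw [hs' ⟨hmem.1.le, hmem.2.trans hs.2⟩]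
      exact Finset.sum_congr rfl fun i hi => hF.atom r hr i hi
  simp only [total, mass]
  rw [Finset.sum_add_distrib, h1]
  ring

lemma IsFolded.increment_le (hF : IsFolded D m w ζ) {i : ℕ} (hi : i ∈ Finset.Icc 1 D.N)
    {p q : ℝ × ℝ} (hp : p ∈ Icc 0 D.h ×ˢ Icc (0 : ℝ) 1) (hq : q ∈ Icc 0 D.h ×ˢ Icc (0 : ℝ) 1)
    (hpq : LexLE p q) :
    (q.1 - p.1) + (mass m w i q - mass m w i p) ≤ total D.N m w q - total D.N m w p := by
  have h1 := Finset.single_le_sum (f := fun i => mass m w i q - mass m w i p)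
    (fun j hj => sub_nonneg.2 (hF.mass_mono hj hp hq hpq)) hi
  rw [Finset.sum_sub_distrib] at h1
  simp only [total]
  linarith

lemma IsFolded.fst_sub_le (hF : IsFolded D m w ζ)
    {p q : ℝ × ℝ} (hp : p ∈ Icc 0 D.h ×ˢ Icc (0 : ℝ) 1) (hq : q ∈ Icc 0 D.h ×ˢ Icc (0 : ℝ) 1)
    (hpq : LexLE p q) : q.1 - p.1 ≤ total D.N m w q - total D.N m w p := by
  have h1 : ∑ i ∈ Finset.Icc 1 D.N, mass m w i p ≤ ∑ i ∈ Finset.Icc 1 D.N, mass m w i q :=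
    Finset.sum_le_sum fun j hj => hF.mass_mono hj hp hq hpq
  simp only [total]
  linarith

lemma IsFolded.total_mono (hF : IsFolded D m w ζ)
    {p q : ℝ × ℝ} (hp : p ∈ Icc 0 D.h ×ˢ Icc (0 : ℝ) 1) (hq : q ∈ Icc 0 D.h ×ˢ Icc (0 : ℝ) 1)
    (hpq : LexLE p q) : total D.N m w p ≤ total D.N m w q := by
  have h1 := hF.fst_sub_le hp hq hpq
  have h2 := hpq.fst_le
  linarith

lemma IsFolded.real_Iio_zero (hF : IsFolded D m w ζ) (i : ℕ) : (m i).real (Iio 0) = 0 := by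
  rw [measureReal_def, measure_mono_null _ (hF.support i), ENNReal.toReal_zero]
  intro t ht ht'
  exact absurd ht'.1 (not_le.2 ht)

lemma IsFolded.real_Iic_end (hF : IsFolded D m w ζ) (i : ℕ) :
    (m i).real (Iic D.h) = (m i).real univ := by
  rw [measureReal_def, measureReal_def, measure_eq_measure_of_null_sdiff (subset_univ _)]
  refine measure_mono_null ?_ (hF.support i)
  intro t ht ht'
  exact ht.2 ht'.2

lemma IsFolded.mass_zero (hF : IsFolded D m w ζ) (i : ℕ) : mass m w i (0, 0) = 0 := by
  simp [mass, hF.real_Iio_zero i]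

lemma IsFolded.total_zero (hF : IsFolded D m w ζ) : total D.N m w (0, 0) = 0 := by
  simp [total, hF.mass_zero]

lemma IsFolded.total_end (hF : IsFolded D m w ζ) (hh : 0 ≤ D.h) :
    total D.N m w (D.h, 1) = D.h + ∑ i ∈ Finset.Icc 1 D.N, (m i).real univ := by
  rw [total]
  congr 1
  refine Finset.sum_congr rfl fun i hi => ?_
  rw [hF.mass_one ⟨hh, le_rfl⟩ hi, hF.real_Iic_end]

lemma IsFolded.exists_position (hF : IsFolded D m w ζ) (hh : 0 ≤ D.h) {u : ℝ}
    (hu : u ∈ Icc 0 (total D.N m w (D.h, 1))) :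
    ∃ p ∈ Icc 0 D.h ×ˢ Icc (0 : ℝ) 1, total D.N m w p = u := by
  have := hF.finite
  set ν : Measure ℝ := volume.restrict (Icc 0 D.h) + ∑ i ∈ Finset.Icc 1 D.N, m i with hν
  have hνr : ∀ B, ν.real B = (volume.restrict (Icc 0 D.h)).real B
      + ∑ i ∈ Finset.Icc 1 D.N, (m i).real B := by
    intro B
    rw [hν, measureReal_add_apply, measureReal_def (μ := ∑ i ∈ _, _), Measure.finsetSum_apply,
      ENNReal.toReal_sum fun i _ => measure_ne_top _ _]
    rfl
  have hsupp : ν (Icc 0 D.h)ᶜ = 0 := by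
    rw [hν, Measure.add_apply, Measure.finsetSum_apply,
      Finset.sum_eq_zero fun i _ => hF.support i, add_zero,
      Measure.restrict_apply measurableSet_Icc.compl, compl_inter_self, measure_empty]
  have hIio : ∀ r ∈ Icc 0 D.h, ν.real (Iio r) = r + ∑ i ∈ Finset.Icc 1 D.N, (m i).real (Iio r) := by
    intro r hr
    rw [hνr, measureReal_restrict_apply measurableSet_Iio]
    have : Iio r ∩ Icc 0 D.h = Ico 0 r := by
      ext t
      exact ⟨fun ht => ⟨ht.2.1, ht.1⟩, fun ht => ⟨ht.2, ht.1, ht.2.le.trans hr.2⟩⟩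
    rw [this, Real.volume_real_Ico_of_le hr.1, sub_zero]
  have huniv : ν.real univ = total D.N m w (D.h, 1) := by
    rw [hνr, hF.total_end hh, measureReal_restrict_apply MeasurableSet.univ, univ_inter,
      Real.volume_real_Icc_of_le hh, sub_zero]
  have hsing : ∀ r, ν.real {r} = ∑ i ∈ Finset.Icc 1 D.N, (m i).real {r} := by
    intro r
    rw [hνr, measureReal_restrict_apply (measurableSet_singleton r), measureReal_def,
      measure_mono_null inter_subset_left (measure_singleton r), ENNReal.toReal_zero, zero_add]
  rw [← huniv] at hu
  obtain ⟨r, hr, h1, h2⟩ := exists_quantile ν hh hsupp hu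
  rw [← Iio_union_right, measureReal_union (by simp) (measurableSet_singleton r), hsing] at h2
  rw [hIio r hr] at h1 h2
  rcases (Finset.sum_nonneg fun i _ => measureReal_nonneg :
    0 ≤ ∑ i ∈ Finset.Icc 1 D.N, (m i).real {r}).eq_or_lt with hJ | hJ
  · refine ⟨(r, 0), ⟨hr, le_rfl, zero_le_one⟩, ?_⟩
    rw [hF.total_eq hr ⟨le_rfl, zero_le_one⟩]
    linarith
  · refine ⟨(r, (u - (r + ∑ i ∈ Finset.Icc 1 D.N, (m i).real (Iio r)))
        / ∑ i ∈ Finset.Icc 1 D.N, (m i).real {r}), ⟨hr, ?_⟩, ?_⟩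
    · exact ⟨div_nonneg (sub_nonneg.2 h1) hJ.le, (div_le_one hJ).2 (by linarith)⟩
    · rw [hF.total_eq hr ⟨div_nonneg (sub_nonneg.2 h1) hJ.le, (div_le_one hJ).2 (by linarith)⟩,
        div_mul_cancel₀ _ hJ.ne']
      ring

lemma IsFolded.norm_sub_le_total (hF : IsFolded D m w ζ) (hf : Continuous D.f)
    (hg : Continuous D.g) {M : ℝ} (hMf : ∀ z, ‖D.f z‖ ≤ M) (hM : ∀ z, ‖D.g z‖ ≤ M) {i : ℕ}
    (hi : i ≤ D.N) {p q : ℝ × ℝ}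
    (hp : p ∈ Icc 0 D.h ×ˢ Icc (0 : ℝ) 1) (hq : q ∈ Icc 0 D.h ×ˢ Icc (0 : ℝ) 1)
    (hpq : LexLE p q) :
    ‖ζ q.1 i q.2 - ζ p.1 i p.2‖ ≤ M * (total D.N m w q - total D.N m w p) := by
  have hM0 : 0 ≤ M := (norm_nonneg _).trans (hM 0)
  rcases Nat.eq_zero_or_pos i with rfl | hpos
  · rw [hF.delay, hF.delay, sub_self, norm_zero]
    exact mul_nonneg hM0 (sub_nonneg.2 (hF.total_mono hp hq hpq))
  · have hi' := Finset.mem_Icc.2 ⟨hpos, hi⟩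
    have h1 := hF.norm_sub_le hf hg hMf hM hi' hp hq hpq (α := 0) (β := 0) (ε := M)
      fun z _ _ _ => ⟨by simpa using hMf _, by simpa using hM _⟩
    simp only [smul_zero, sub_zero] at h1
    exact h1.trans (mul_le_mul_of_nonneg_left (hF.increment_le hi' hp hq hpq) hM0)

lemma LexLE.of_zero {D : System n} {p : ℝ × ℝ} (hp : p ∈ Icc 0 D.h ×ˢ Icc (0 : ℝ) 1) :
    LexLE (0, 0) p :=
  hp.1.1.lt_or_eq.imp id fun h => ⟨h, hp.2.1⟩

lemma LexLE.of_end {D : System n} {p : ℝ × ℝ} (hp : p ∈ Icc 0 D.h ×ˢ Icc (0 : ℝ) 1) :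
    LexLE p (D.h, 1) :=
  hp.1.2.lt_or_eq.imp id fun h => ⟨h, hp.2.2⟩

lemma IsFolded.norm_state_le (hF : IsFolded D m w ζ) (hf : Continuous D.f)
    (hg : Continuous D.g) {M : ℝ} (hMf : ∀ z, ‖D.f z‖ ≤ M) (hM : ∀ z, ‖D.g z‖ ≤ M)
    (hh : 0 ≤ D.h) {i : ℕ} (hi : i ≤ D.N) {p : ℝ × ℝ}
    (hp : p ∈ Icc 0 D.h ×ˢ Icc (0 : ℝ) 1) :
    ‖ζ p.1 i p.2‖ ≤ ‖D.ξ₀‖ + ‖D.x₀‖ + i * (M * total D.N m w (D.h, 1)) := by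
  have hM0 : 0 ≤ M := (norm_nonneg _).trans (hM 0)
  have hpz : ((0 : ℝ), (0 : ℝ)) ∈ Icc 0 D.h ×ˢ Icc (0 : ℝ) 1 :=
    ⟨⟨le_rfl, hh⟩, le_rfl, zero_le_one⟩
  have hpe : (D.h, (1 : ℝ)) ∈ Icc 0 D.h ×ˢ Icc (0 : ℝ) 1 := ⟨⟨hh, le_rfl⟩, zero_le_one, le_rfl⟩
  have hT0 : 0 ≤ total D.N m w (D.h, 1) := by
    rw [← hF.total_zero]
    exact hF.total_mono hpz hpe (LexLE.of_zero hpe)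
  have key : ∀ j ≤ D.N, ∀ q ∈ Icc 0 D.h ×ˢ Icc (0 : ℝ) 1,
      ‖ζ q.1 j q.2‖ ≤ ‖ζ 0 j 0‖ + M * total D.N m w (D.h, 1) := by
    intro j hj q hq
    have h1 := hF.norm_sub_le_total hf hg hMf hM hj hpz hq (LexLE.of_zero hq)
    have h2 := hF.total_mono hq hpe (LexLE.of_end hq)
    have h3 := norm_le_norm_add_norm_sub' (ζ q.1 j q.2) (ζ 0 j 0)
    have h4 := mul_le_mul_of_nonneg_left h2 hM0
    rw [hF.total_zero, sub_zero] at h1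
    linarith
  induction i generalizing p with
  | zero =>
    rw [hF.delay]
    have := norm_nonneg D.x₀
    simp only [Nat.cast_zero, zero_mul]
    linarith
  | succ j ih =>
    refine (key _ hi p hp).trans ?_
    push_cast
    rcases Nat.eq_zero_or_pos j with rfl | hj
    · rw [hF.start]
      have := norm_nonneg D.ξ₀
      simp only [Nat.cast_zero]
      linarith
    · have h1 := hF.link (j + 1) (Finset.mem_Icc.2 ⟨by omega, hi⟩)
      rw [Nat.add_sub_cancel] at h1
      have h2 := ih (by omega) hpe
      simp only at h2
      rw [h1]
      linarith

lemma exists_lipschitz_bound {f : EuclideanSpace ℝ (Fin n) × EuclideanSpace ℝ (Fin n) →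
    EuclideanSpace ℝ (Fin n)} (hf : ContDiff ℝ 1 f) (B : ℝ) :
    ∃ Λ : ℝ, 0 ≤ Λ ∧ ∀ a b a' b' : EuclideanSpace ℝ (Fin n), ‖a‖ ≤ B → ‖b‖ ≤ B → ‖a'‖ ≤ B →
      ‖b'‖ ≤ B → ∀ δ, ‖a - a'‖ ≤ δ → ‖b - b'‖ ≤ δ → ‖f (a, b) - f (a', b')‖ ≤ Λ * δ := by
  obtain ⟨Λ, hΛ⟩ := (hf.contDiffOn (s := Metric.closedBall 0 B)).exists_lipschitzOnWith one_ne_zero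
    (convex_closedBall _ _) (isCompact_closedBall _ _)
  refine ⟨Λ, Λ.2, fun a b a' b' ha hb ha' hb' δ h1 h2 => ?_⟩
  have h := hΛ.dist_le_mul (a, b) (by simp [Prod.norm_def, ha, hb]) (a', b')
    (by simp [Prod.norm_def, ha', hb'])
  rw [dist_eq_norm, dist_eq_norm] at h
  refine h.trans (mul_le_mul_of_nonneg_left ?_ Λ.2)
  rw [Prod.mk_sub_mk, Prod.norm_def]
  exact max_le h1 h2

lemma clamp_mem (s : ℝ) : clamp s ∈ Icc (0 : ℝ) 1 :=
  ⟨le_max_left _ _, max_le zero_le_one (min_le_right _ _)⟩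

lemma clamp_mono {s t : ℝ} (h : s ≤ t) : clamp s ≤ clamp t :=
  max_le_max le_rfl (min_le_min h le_rfl)

lemma clamp_zero : clamp 0 = 0 := by simp [clamp]

lemma clamp_one : clamp 1 = 1 := by simp [clamp]

/-- The parameter `A i` in terms of positions. -/
noncomputable def clockAt (N : ℕ) (m : ℕ → Measure ℝ) (w : ℝ → ℕ → ℝ → ℝ) (i : ℕ)
    (p : ℝ × ℝ) : ℝ :=
  if i = 0 then p.1 else if i ≤ N then mass m w i p else 0

lemma clockAt_zero (N : ℕ) (m : ℕ → Measure ℝ) (w : ℝ → ℕ → ℝ → ℝ) (p : ℝ × ℝ) :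
    clockAt N m w 0 p = p.1 := if_pos rfl

lemma clockAt_of_mem {N : ℕ} {m : ℕ → Measure ℝ} {w : ℝ → ℕ → ℝ → ℝ} {i : ℕ}
    (hi : i ∈ Finset.Icc 1 N) (p : ℝ × ℝ) : clockAt N m w i p = mass m w i p := by
  rw [Finset.mem_Icc] at hi
  rw [clockAt, if_neg (by omega), if_pos hi.2]

lemma clockAt_of_lt {N : ℕ} {m : ℕ → Measure ℝ} {w : ℝ → ℕ → ℝ → ℝ} {i : ℕ}
    (hi : N < i) (p : ℝ × ℝ) : clockAt N m w i p = 0 := by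
  rw [clockAt, if_neg (by omega), if_neg (by omega)]

lemma sum_range_succ_eq_add_sum_Icc (N : ℕ) (F : ℕ → ℝ) :
    ∑ i ∈ Finset.range (N + 1), F i = F 0 + ∑ i ∈ Finset.Icc 1 N, F i := by
  rw [Finset.sum_range_succ', add_comm, Finset.range_eq_Ico, Finset.sum_Ico_add' F 0 N 1]
  rfl

lemma sum_clockAt (N : ℕ) (m : ℕ → Measure ℝ) (w : ℝ → ℕ → ℝ → ℝ) (p : ℝ × ℝ) :
    ∑ i ∈ Finset.range (N + 1), clockAt N m w i p = total N m w p := by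
  rw [sum_range_succ_eq_add_sum_Icc, clockAt_zero, total,
    Finset.sum_congr rfl fun i hi => clockAt_of_mem hi p]

lemma IsFolded.clockAt_mono (hF : IsFolded D m w ζ) (i : ℕ)
    {p q : ℝ × ℝ} (hp : p ∈ Icc 0 D.h ×ˢ Icc (0 : ℝ) 1) (hq : q ∈ Icc 0 D.h ×ˢ Icc (0 : ℝ) 1)
    (hpq : LexLE p q) : clockAt D.N m w i p ≤ clockAt D.N m w i q := by
  rcases Nat.eq_zero_or_pos i with rfl | hpos
  · simpa only [clockAt_zero] using hpq.fst_le
  rcases le_or_gt i D.N with hi | hi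
  · have hi' := Finset.mem_Icc.2 ⟨hpos, hi⟩
    rw [clockAt_of_mem hi', clockAt_of_mem hi']
    exact hF.mass_mono hi' hp hq hpq
  · rw [clockAt_of_lt hi, clockAt_of_lt hi]

/-- Every folded process can be reparametrized, with uniform constants. -/
lemma exists_isCurve_of_isFolded {D : System n} (hf : ContDiff ℝ 1 D.f) (hg : ContDiff ℝ 1 D.g)
    (hf_bdd : ∃ M : ℝ, ∀ z, ‖D.f z‖ ≤ M) (hg_bdd : ∃ M : ℝ, ∀ z, ‖D.g z‖ ≤ M)
    (hh : 0 < D.h) (hN : 0 < D.N) {K : ℝ} (hK : 0 < K) :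
    ∃ B L : ℝ, ∀ m w ζ, IsFolded D m w ζ → ∑ i ∈ Finset.Icc 1 D.N, (m i).real univ ≤ K →
      ∃ A y, IsCurve D K B L A y ∧ y D.N 1 = ζ D.h D.N 1 := by
  obtain ⟨M₁, hM₁⟩ := hf_bdd
  obtain ⟨M₂, hM₂⟩ := hg_bdd
  set M := max M₁ M₂
  have hMf : ∀ z, ‖D.f z‖ ≤ M := fun z => (hM₁ z).trans (le_max_left _ _)
  have hMg : ∀ z, ‖D.g z‖ ≤ M := fun z => (hM₂ z).trans (le_max_right _ _)
  have hM0 : 0 ≤ M := (norm_nonneg _).trans (hMf 0)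
  set B := ‖D.ξ₀‖ + ‖D.x₀‖ + D.N * (M * (D.h + K)) with hB
  obtain ⟨Λ₁, hΛ₁0, hΛ₁⟩ := exists_lipschitz_bound hf B
  obtain ⟨Λ₂, hΛ₂0, hΛ₂⟩ := exists_lipschitz_bound hg B
  refine ⟨B, (Λ₁ + Λ₂) * M * (D.h + K) ^ 2, fun m w ζ hF hmass => ?_⟩
  set c := total D.N m w (D.h, 1) with hc
  have hce : c = D.h + ∑ i ∈ Finset.Icc 1 D.N, (m i).real univ := hF.total_end hh.le
  have hcK : c ≤ D.h + K := by linarith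
  have hc0 : 0 < c := by
    have : 0 ≤ ∑ i ∈ Finset.Icc 1 D.N, (m i).real univ :=
      Finset.sum_nonneg fun _ _ => measureReal_nonneg
    linarith
  have hpz : ((0 : ℝ), (0 : ℝ)) ∈ Icc 0 D.h ×ˢ Icc (0 : ℝ) 1 :=
    ⟨⟨le_rfl, hh.le⟩, le_rfl, zero_le_one⟩
  have hpe : (D.h, (1 : ℝ)) ∈ Icc 0 D.h ×ˢ Icc (0 : ℝ) 1 := ⟨⟨hh.le, le_rfl⟩, zero_le_one, le_rfl⟩
  have hstate : ∀ i ≤ D.N, ∀ p ∈ Icc 0 D.h ×ˢ Icc (0 : ℝ) 1, ‖ζ p.1 i p.2‖ ≤ B := by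
    intro i hi p hp
    refine (hF.norm_state_le hf.continuous hg.continuous hMf hMg hh.le hi hp).trans ?_
    have : (i : ℝ) ≤ D.N := by exact_mod_cast hi
    rw [hB]
    gcongr
  have hB0 : 0 ≤ B := (norm_nonneg _).trans (hstate 0 (Nat.zero_le _) _ hpz)
  have hex : ∀ s : ℝ, ∃ p ∈ Icc 0 D.h ×ˢ Icc (0 : ℝ) 1, s ∈ Icc (0 : ℝ) 1 →
      total D.N m w p = s * c := by
    intro s
    by_cases hs : s ∈ Icc (0 : ℝ) 1
    · obtain ⟨p, hp, hp'⟩ := hF.exists_position hh.le (u := s * c)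
        ⟨mul_nonneg hs.1 hc0.le, mul_le_of_le_one_left hc0.le hs.2⟩
      exact ⟨p, hp, fun _ => hp'⟩
    · exact ⟨_, hpz, fun h => absurd h hs⟩
  choose P hP hPt using hex
  have hPc : ∀ s, total D.N m w (P (clamp s)) = clamp s * c := fun s => hPt _ (clamp_mem s)
  have hlex : ∀ s t, s ≤ t → LexLE (P (clamp s)) (P (clamp t)) := by
    intro s t hst
    rcases (clamp_mono hst).eq_or_lt with heq | hlt
    · rw [heq]; exact LexLE.refl _
    · by_contra hcon
      have h1 := hF.total_mono (hP _) (hP _) (LexLE.of_not hcon)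
      rw [hPc, hPc] at h1
      exact absurd h1 (not_le.2 (mul_lt_mul_of_pos_right hlt hc0))
  have hy0 : ∀ i ≤ D.N, ζ (P (clamp 0)).1 i (P (clamp 0)).2 = ζ 0 i 0 := by
    intro i hi
    have h1 := hF.norm_sub_le_total hf.continuous hg.continuous hMf hMg hi hpz (hP (clamp 0))
      (LexLE.of_zero (hP (clamp 0)))
    rw [hPc, hF.total_zero, clamp_zero, zero_mul, sub_zero, mul_zero, norm_le_zero_iff,
      sub_eq_zero] at h1
    rwa [clamp_zero]
  have hy1 : ∀ i ≤ D.N, ζ (P (clamp 1)).1 i (P (clamp 1)).2 = ζ D.h i 1 := by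
    intro i hi
    have h1 := hF.norm_sub_le_total hf.continuous hg.continuous hMf hMg hi (hP (clamp 1)) hpe
      (LexLE.of_end (hP (clamp 1)))
    rw [hPc, clamp_one, one_mul, ← hc, sub_self, mul_zero, norm_le_zero_iff, sub_eq_zero] at h1
    rw [clamp_one, h1]
  have hAle : ∀ i p, p ∈ Icc 0 D.h ×ˢ Icc (0 : ℝ) 1 →
      0 ≤ clockAt D.N m w i p ∧ clockAt D.N m w i p ≤ D.h + K := by
    intro i p hp
    have hnn : ∀ j, 0 ≤ clockAt D.N m w j p := by
      intro j
      refine le_trans (le_of_eq ?_) (hF.clockAt_mono j hpz hp (LexLE.of_zero hp))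
      rw [clockAt]
      split_ifs
      · rfl
      · exact (hF.mass_zero j).symm
      · rfl
    refine ⟨hnn i, ?_⟩
    rcases le_or_gt i D.N with hi | hi
    · have h1 := Finset.single_le_sum (f := fun j => clockAt D.N m w j p) (fun j _ => hnn j)
        (Finset.mem_range.2 (Nat.lt_succ_of_le hi))
      rw [sum_clockAt] at h1
      exact (h1.trans (hF.total_mono hp hpe (LexLE.of_end hp))).trans hcK
    · rw [clockAt_of_lt hi]
      linarith
  refine ⟨fun i s => clockAt D.N m w i (P (clamp s)),
    fun i s => if i ≤ D.N then ζ (P (clamp s)).1 i (P (clamp s)).2 else 0, ?_, ?_⟩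
  · constructor
    · exact fun i s => (hAle i _ (hP _)).1
    · exact fun i s => (hAle i _ (hP _)).2
    · intro i s
      split_ifs with hi
      · exact hstate i hi _ (hP _)
      · rwa [norm_zero]
    · exact fun i s t hst => hF.clockAt_mono i (hP _) (hP _) (hlex s t hst)
    · intro s
      rw [sum_clockAt, sum_clockAt, hPc, hPc, clamp_one, one_mul]
    · rw [sum_clockAt, hPc, clamp_one, one_mul]
      exact hcK
    · rw [clockAt_zero]
      have h1 := hF.fst_sub_le (hP (clamp 1)) hpe (LexLE.of_end (hP (clamp 1)))
      rw [hPc, clamp_one, one_mul, ← hc, sub_self] at h1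
      rw [clamp_one]
      exact le_antisymm (hP 1).1.2 (by linarith)
    · intro s
      simp only [Nat.zero_le, if_true, hF.delay]
    · rw [if_pos (show 1 ≤ D.N from hN), hy0 1 hN, hF.start]
    · intro i hi
      have hi' := Finset.mem_Icc.1 hi
      rw [if_pos hi'.2, if_pos ((Nat.sub_le i 1).trans hi'.2), hy0 i hi'.2,
        hy1 _ ((Nat.sub_le i 1).trans hi'.2), hF.link i hi]
    · intro i hi s t hst
      have hi' := Finset.mem_Icc.1 hi
      have hi1 : i - 1 ≤ D.N := (Nat.sub_le i 1).trans hi'.2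
      rw [if_pos hi'.2, if_pos hi'.2, if_pos hi1, clockAt_zero, clockAt_zero, clockAt_of_mem hi,
        clockAt_of_mem hi]
      set p := P (clamp s)
      set q := P (clamp t)
      have hp : p ∈ Icc 0 D.h ×ˢ Icc (0 : ℝ) 1 := hP _
      have hq : q ∈ Icc 0 D.h ×ˢ Icc (0 : ℝ) 1 := hP _
      set δ := M * (total D.N m w q - total D.N m w p) with hδ
      have hdist : ∀ z ∈ Icc 0 D.h ×ˢ Icc (0 : ℝ) 1, LexLE p z → LexLE z q → ∀ j ≤ D.N,
          ‖ζ z.1 j z.2 - ζ p.1 j p.2‖ ≤ δ := by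
        intro z hz hpz hzq j hj
        refine (hF.norm_sub_le_total hf.continuous hg.continuous hMf hMg hj hp hz hpz).trans ?_
        exact mul_le_mul_of_nonneg_left (sub_le_sub_right (hF.total_mono hz hq hzq) _) hM0
      have hinc0 : 0 ≤ total D.N m w q - total D.N m w p :=
        sub_nonneg.2 (hF.total_mono hp hq (hlex s t hst))
      have hδ0 : 0 ≤ δ := mul_nonneg hM0 hinc0
      have h1 := hF.norm_sub_le hf.continuous hg.continuous hMf hMg hi hp hq (hlex s t hst)
        (α := D.f (ζ p.1 i p.2, ζ p.1 (i - 1) p.2)) (β := D.g (ζ p.1 i p.2, ζ p.1 (i - 1) p.2))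
        (ε := (Λ₁ + Λ₂) * δ) ?_
      · refine h1.trans ?_
        have h2 := hF.increment_le hi hp hq (hlex s t hst)
        have h3 : total D.N m w q - total D.N m w p = (clamp t - clamp s) * c := by
          rw [hPc, hPc]; ring
        have h4 : 0 ≤ (Λ₁ + Λ₂) * M := mul_nonneg (add_nonneg hΛ₁0 hΛ₂0) hM0
        have h5 : c ^ 2 ≤ (D.h + K) ^ 2 := by gcongr
        calc (Λ₁ + Λ₂) * δ * (q.1 - p.1 + (mass m w i q - mass m w i p))
            ≤ (Λ₁ + Λ₂) * δ * (total D.N m w q - total D.N m w p) := by gcongr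
          _ = (Λ₁ + Λ₂) * M * (c ^ 2 * (clamp t - clamp s) ^ 2) := by rw [hδ, h3]; ring
          _ ≤ (Λ₁ + Λ₂) * M * ((D.h + K) ^ 2 * (clamp t - clamp s) ^ 2) := by gcongr
          _ = (Λ₁ + Λ₂) * M * (D.h + K) ^ 2 * (clamp t - clamp s) ^ 2 := by ring
      · intro z hz hpz hzq
        have d1 := hdist z hz hpz hzq i hi'.2
        have d2 := hdist z hz hpz hzq (i - 1) hi1
        have b1 := hstate i hi'.2 z hz
        have b2 := hstate (i - 1) hi1 z hz
        have b3 := hstate i hi'.2 p hp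
        have b4 := hstate (i - 1) hi1 p hp
        constructor
        · refine (hΛ₁ _ _ _ _ b1 b2 b3 b4 δ d1 d2).trans ?_
          gcongr; linarith
        · refine (hΛ₂ _ _ _ _ b1 b2 b3 b4 δ d1 d2).trans ?_
          gcongr; linarith
  · dsimp only
    rw [if_pos le_rfl, hy1 _ le_rfl]

end Reparametrize

section TimeChange

/-- The last parameter at which the time `θ` is at most `r`. -/
noncomputable def lastHit (θ : ℝ → ℝ) (r : ℝ) : ℝ := sSup {s | s ∈ Icc (0 : ℝ) 1 ∧ θ s ≤ r}

/-- The first parameter at which the time `θ` is at least `r`. -/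
noncomputable def firstHit (θ : ℝ → ℝ) (r : ℝ) : ℝ := sInf {s | s ∈ Icc (0 : ℝ) 1 ∧ r ≤ θ s}

lemma lastHit_mem (θ : ℝ → ℝ) (r : ℝ) : lastHit θ r ∈ Icc (0 : ℝ) 1 :=
  ⟨Real.sSup_nonneg fun _ hs => hs.1.1, Real.sSup_le (fun _ hs => hs.1.2) zero_le_one⟩

variable {θ : ℝ → ℝ} {h r s : ℝ}

lemma le_lastHit (hs : s ∈ Icc (0 : ℝ) 1) (hr : θ s ≤ r) : s ≤ lastHit θ r :=
  le_csSup ⟨1, fun _ ht => ht.1.2⟩ ⟨hs, hr⟩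

lemma firstHit_le (hs : s ∈ Icc (0 : ℝ) 1) (hr : r ≤ θ s) : firstHit θ r ≤ s :=
  csInf_le ⟨0, fun _ ht => ht.1.1⟩ ⟨hs, hr⟩

lemma firstHit_nonneg : 0 ≤ firstHit θ r := Real.sInf_nonneg fun _ hs => hs.1.1

lemma monotone_lastHit (θ : ℝ → ℝ) : Monotone (lastHit θ) := by
  intro r r' hr
  exact Real.sSup_le (fun s hs => le_lastHit hs.1 (hs.2.trans hr)) (lastHit_mem θ r').1

variable (hθ : Monotone θ) (hc : Continuous θ) (h0 : θ 0 = 0) (h1 : θ 1 = h)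

include hc h0 h1 in
lemma exists_hit (hr : r ∈ Icc 0 h) : ∃ s ∈ Icc (0 : ℝ) 1, θ s = r := by
  have := intermediate_value_Icc zero_le_one hc.continuousOn (f := θ)
  rw [h0, h1] at this
  exact this hr

include hθ hc h0 h1 in
lemma apply_lastHit (hr : r ∈ Icc 0 h) : θ (lastHit θ r) = r := by
  obtain ⟨s, hs, hsr⟩ := exists_hit hc h0 h1 hr
  refine le_antisymm ?_ ?_
  · have hcl : IsClosed {s | s ∈ Icc (0 : ℝ) 1 ∧ θ s ≤ r} :=
      isClosed_Icc.inter (isClosed_le hc continuous_const)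
    exact (hcl.csSup_mem ⟨s, hs, hsr.le⟩ ⟨1, fun _ ht => ht.1.2⟩).2
  · calc r = θ s := hsr.symm
      _ ≤ _ := hθ (le_lastHit hs hsr.le)

include hθ hc h0 h1 in
lemma apply_firstHit (hr : r ∈ Icc 0 h) : θ (firstHit θ r) = r := by
  obtain ⟨s, hs, hsr⟩ := exists_hit hc h0 h1 hr
  refine le_antisymm ?_ ?_
  · calc _ ≤ θ s := hθ (firstHit_le hs hsr.ge)
      _ = r := hsr
  · have hcl : IsClosed {s | s ∈ Icc (0 : ℝ) 1 ∧ r ≤ θ s} :=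
      isClosed_Icc.inter (isClosed_le continuous_const hc)
    exact (hcl.csInf_mem ⟨s, hs, hsr.ge⟩ ⟨0, fun _ ht => ht.1.1⟩).2

include hθ hc h0 h1 in
lemma apply_eq_iff (hr : r ∈ Icc 0 h) (hs : s ∈ Icc (0 : ℝ) 1) :
    θ s = r ↔ s ∈ Icc (firstHit θ r) (lastHit θ r) := by
  refine ⟨fun h => ⟨firstHit_le hs h.ge, le_lastHit hs h.le⟩, fun h => le_antisymm ?_ ?_⟩
  · exact (hθ h.2).trans (apply_lastHit hθ hc h0 h1 hr).le
  · exact (apply_firstHit hθ hc h0 h1 hr).ge.trans (hθ h.1)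

include hθ hc h0 h1 in
lemma apply_le_iff (hr : r ∈ Icc 0 h) (hs : s ∈ Icc (0 : ℝ) 1) : θ s ≤ r ↔ s ≤ lastHit θ r :=
  ⟨fun h => le_lastHit hs h, fun h => (hθ h).trans (apply_lastHit hθ hc h0 h1 hr).le⟩

include hc h0 h1 in
lemma firstHit_le_lastHit (hr : r ∈ Icc 0 h) : firstHit θ r ≤ lastHit θ r := by
  obtain ⟨s, hs, hsr⟩ := exists_hit hc h0 h1 hr
  exact (firstHit_le hs hsr.ge).trans (le_lastHit hs hsr.le)

include hc h0 h1 in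
lemma firstHit_mem (hr : r ∈ Icc 0 h) : firstHit θ r ∈ Icc (0 : ℝ) 1 :=
  ⟨firstHit_nonneg, (firstHit_le_lastHit hc h0 h1 hr).trans (lastHit_mem θ r).2⟩

include h0 in
lemma firstHit_zero : firstHit θ 0 = 0 :=
  le_antisymm (firstHit_le ⟨le_rfl, zero_le_one⟩ h0.ge) firstHit_nonneg

include h1 in
lemma lastHit_end : lastHit θ h = 1 :=
  le_antisymm (lastHit_mem θ h).2 (le_lastHit ⟨zero_le_one, le_rfl⟩ h1.le)

include hθ hc h0 h1 in
lemma tendsto_lastHit_left (hr : r ∈ Ioc 0 h) :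
    Tendsto (lastHit θ) (𝓝[<] r) (𝓝 (firstHit θ r)) := by
  have hr' : r ∈ Icc 0 h := Ioc_subset_Icc_self hr
  have hfr := apply_firstHit hθ hc h0 h1 hr'
  rw [tendsto_order]
  constructor
  · intro a ha
    set b := max 0 ((a + firstHit θ r) / 2) with hb
    have hpos : 0 < firstHit θ r := by
      refine firstHit_nonneg.lt_of_ne fun h => ?_
      rw [← h, h0] at hfr
      exact hr.1.ne hfr
    have hbl : b < firstHit θ r := max_lt hpos (by linarith)
    have hab : a < b := (show a < (a + firstHit θ r) / 2 by linarith).trans_le (le_max_right _ _)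
    have hbm : b ∈ Icc (0 : ℝ) 1 :=
      ⟨le_max_left _ _, hbl.le.trans (firstHit_mem hc h0 h1 hr').2⟩
    have hbr : θ b < r := by
      by_contra hcon
      exact absurd (firstHit_le hbm (not_lt.1 hcon)) (not_le.2 hbl)
    filter_upwards [Ioo_mem_nhdsLT hbr] with ρ hρ
    exact hab.trans_le (le_lastHit hbm hρ.1.le)
  · intro a ha
    filter_upwards [Ioo_mem_nhdsLT hr.1] with ρ hρ
    refine lt_of_le_of_lt ?_ ha
    have h2 := apply_lastHit hθ hc h0 h1 (r := ρ) ⟨hρ.1.le, hρ.2.le.trans hr.2⟩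
    by_contra hcon
    have h3 := hθ (not_le.1 hcon).le
    rw [h2, hfr] at h3
    exact absurd h3 (not_le.2 hρ.2)

lemma deriv_eq_zero_of_const_right {F : ℝ → ℝ} {s b : ℝ} (hsb : s < b)
    (hF : ∀ t ∈ Icc s b, F t = F s) : deriv F s = 0 := by
  by_cases hd : DifferentiableAt ℝ F s
  · have h1 := hd.hasDerivAt.hasDerivWithinAt (s := Ici s)
    have h2 : HasDerivWithinAt F 0 (Ici s) s := by
      refine (hasDerivWithinAt_const s (Ici s) (F s)).congr_of_eventuallyEq ?_ rfl
      filter_upwards [Icc_mem_nhdsGE hsb] with t ht using hF t ht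
    exact (uniqueDiffWithinAt_Ici s).eq_deriv _ h1 h2
  · exact deriv_zero_of_not_differentiableAt hd

/-- The measure on `[0, 1]` with density `F'`. -/
noncomputable def derivMeasure (F : ℝ → ℝ) : Measure ℝ :=
  (volume.restrict (Icc 0 1)).withDensity fun s => ENNReal.ofReal (deriv F s)

lemma integrableOn_deriv {F : ℝ → ℝ} (hF : Monotone F) : IntegrableOn (deriv F) (Icc 0 1) := by
  have := (hF.monotoneOn (uIcc 0 1)).intervalIntegrable_deriv
  rwa [intervalIntegrable_iff_integrableOn_Icc_of_le zero_le_one] at this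

lemma isFiniteMeasure_derivMeasure {F : ℝ → ℝ} (hF : Monotone F) :
    IsFiniteMeasure (derivMeasure F) :=
  isFiniteMeasure_withDensity_ofReal (integrableOn_deriv hF).2

lemma setIntegral_derivMeasure {E : Type*} [NormedAddCommGroup E] [NormedSpace ℝ E] {F : ℝ → ℝ}
    (hF : Monotone F) (φ : ℝ → E) {B : Set ℝ} (hB : MeasurableSet B) :
    ∫ s in B, φ s ∂(derivMeasure F) = ∫ s in B ∩ Icc 0 1, deriv F s • φ s := by
  rw [derivMeasure, setIntegral_withDensity_eq_setIntegral_toReal_smul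
    (measurable_deriv F).ennreal_ofReal (Eventually.of_forall fun _ => ENNReal.ofReal_lt_top) _ hB,
    Measure.restrict_restrict hB]
  simp_rw [ENNReal.toReal_ofReal hF.deriv_nonneg]

lemma derivMeasure_real_apply {F : ℝ → ℝ} (hF : Monotone F) {B : Set ℝ} (hB : MeasurableSet B) :
    (derivMeasure F).real B = ∫ s in B ∩ Icc 0 1, deriv F s := by
  have h2 := setIntegral_derivMeasure hF (fun _ => (1 : ℝ)) hB
  simpa using h2

lemma derivMeasure_compl (F : ℝ → ℝ) : derivMeasure F (Icc 0 1)ᶜ = 0 := by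
  rw [derivMeasure, withDensity_apply _ measurableSet_Icc.compl,
    Measure.restrict_restrict measurableSet_Icc.compl, compl_inter_self, Measure.restrict_empty,
    lintegral_zero_measure]

lemma integral_deriv_of_lipschitz {F : ℝ → ℝ} {C : NNReal} (hF : LipschitzWith C F) (a b : ℝ) :
    ∫ s in a..b, deriv F s = F b - F a :=
  hF.lipschitzOnWith.absolutelyContinuousOnInterval.integral_deriv_eq_sub

include hθ hc h0 h1 in
lemma derivMeasure_fibre {F : ℝ → ℝ} {C : NNReal} (hF : Monotone F) (hL : LipschitzWith C F)
    (hr : r ∈ Icc 0 h) :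
    ((derivMeasure F).map θ).real {r} = F (lastHit θ r) - F (firstHit θ r) := by
  have hpre : θ ⁻¹' {r} ∩ Icc 0 1 = Icc (firstHit θ r) (lastHit θ r) := by
    ext s
    refine ⟨fun hs => (apply_eq_iff hθ hc h0 h1 hr hs.2).1 hs.1, fun hs => ?_⟩
    have hs' : s ∈ Icc (0 : ℝ) 1 :=
      ⟨firstHit_nonneg.trans hs.1, hs.2.trans (lastHit_mem θ r).2⟩
    exact ⟨(apply_eq_iff hθ hc h0 h1 hr hs').2 hs, hs'⟩
  rw [map_measureReal_apply hθ.measurable (measurableSet_singleton r),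
    derivMeasure_real_apply hF (hθ.measurable (measurableSet_singleton r)), hpre,
    integral_Icc_eq_integral_Ioc,
    ← intervalIntegral.integral_of_le (firstHit_le_lastHit hc h0 h1 hr),
    integral_deriv_of_lipschitz hL]

include hθ hc h0 h1 in
lemma map_derivMeasure_self {C : NNReal} (hL : LipschitzWith C θ) :
    (derivMeasure θ).map θ = volume.restrict (Icc 0 h) := by
  have := isFiniteMeasure_derivMeasure hθ
  have hh : 0 ≤ h := h0 ▸ h1 ▸ hθ zero_le_one
  refine Measure.ext_of_Iic _ _ fun t => ?_
  rw [← ofReal_measureReal, ← ofReal_measureReal]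
  congr 1
  rw [map_measureReal_apply hθ.measurable measurableSet_Iic,
    derivMeasure_real_apply hθ (hθ.measurable measurableSet_Iic),
    measureReal_restrict_apply measurableSet_Iic]
  rcases lt_or_ge t 0 with ht | ht
  · have e1 : θ ⁻¹' Iic t ∩ Icc 0 1 = ∅ := by
      ext s
      simp only [mem_inter_iff, mem_preimage, mem_Iic, mem_empty_iff_false, iff_false, not_and]
      intro hs hs'
      have := hθ hs'.1
      rw [h0] at this
      linarith
    have e2 : Iic t ∩ Icc 0 h = ∅ := by
      ext s
      simp only [mem_inter_iff, mem_Iic, mem_empty_iff_false, iff_false, not_and]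
      intro hs hs'
      linarith [hs'.1]
    rw [e1, e2]
    simp
  · have e0 : min t h ∈ Icc 0 h := ⟨le_min ht hh, min_le_right _ _⟩
    have e1 : θ ⁻¹' Iic t ∩ Icc 0 1 = Icc 0 (lastHit θ (min t h)) := by
      ext s
      simp only [mem_inter_iff, mem_preimage, mem_Iic]
      constructor
      · rintro ⟨hs, hs'⟩
        refine ⟨hs'.1, le_lastHit hs' (le_min hs ?_)⟩
        rw [← h1]
        exact hθ hs'.2
      · intro hs
        have hs' : s ∈ Icc (0 : ℝ) 1 := ⟨hs.1, hs.2.trans (lastHit_mem θ _).2⟩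
        exact ⟨((apply_le_iff hθ hc h0 h1 e0 hs').2 hs.2).trans (min_le_left _ _), hs'⟩
    have e2 : Iic t ∩ Icc 0 h = Icc 0 (min t h) := by
      ext s
      simp only [mem_inter_iff, mem_Iic, mem_Icc, le_min_iff]
      tauto
    rw [e1, e2, Real.volume_real_Icc_of_le e0.1, integral_Icc_eq_integral_Ioc,
      ← intervalIntegral.integral_of_le (lastHit_mem θ _).1, integral_deriv_of_lipschitz hL,
      apply_lastHit hθ hc h0 h1 e0, h0]

end TimeChange

section Unfold

lemma clamp_of_mem {s : ℝ} (hs : s ∈ Icc (0 : ℝ) 1) : clamp s = s := by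
  rw [clamp, min_eq_left hs.2, max_eq_right hs.1]

lemma clamp_sub_le {s t : ℝ} (h : s ≤ t) : clamp t - clamp s ≤ t - s := by
  simp only [clamp]
  rcases max_cases 0 (min s 1) with h1 | h1 <;> rcases max_cases 0 (min t 1) with h2 | h2 <;>
    rcases min_cases s 1 with h3 | h3 <;> rcases min_cases t 1 with h4 | h4 <;> linarith

/-- The total parameter length of a curve. -/
def length (N : ℕ) (A : ℕ → ℝ → ℝ) : ℝ := ∑ i ∈ Finset.range (N + 1), A i 1

variable {D : System n} {K B L : ℝ} {A : ℕ → ℝ → ℝ} {y : ℕ → ℝ → EuclideanSpace ℝ (Fin n)}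

lemma IsCurve.length_nonneg (hc : IsCurve D K B L A y) : 0 ≤ length D.N A :=
  Finset.sum_nonneg fun i _ => hc.A_nonneg i 1

lemma IsCurve.A_zero (hc : IsCurve D K B L A y) {i : ℕ} (hi : i ≤ D.N) : A i 0 = 0 := by
  have h1 := hc.sum_eq 0
  rw [clamp_zero, zero_mul] at h1
  exact (Finset.sum_eq_zero_iff_of_nonneg fun j _ => hc.A_nonneg j 0).1 h1 i
    (Finset.mem_range.2 (Nat.lt_succ_of_le hi))

lemma IsCurve.A_sub_le (hc : IsCurve D K B L A y) {i : ℕ} (hi : i ≤ D.N) {s t : ℝ} (hst : s ≤ t) :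
    A i t - A i s ≤ length D.N A * (clamp t - clamp s) := by
  have h1 := Finset.single_le_sum (f := fun i => A i t - A i s)
    (fun j _ => sub_nonneg.2 (hc.mono j s t hst)) (Finset.mem_range.2 (Nat.lt_succ_of_le hi))
  rw [Finset.sum_sub_distrib, hc.sum_eq t, hc.sum_eq s] at h1
  rw [length]
  linarith

lemma lipschitzWith_of_sub_le {E : Type*} [NormedAddCommGroup E] {F : ℝ → E} {C : ℝ} (hC : 0 ≤ C)
    (hF : ∀ s t, s ≤ t → ‖F t - F s‖ ≤ C * (t - s)) : LipschitzWith C.toNNReal F := by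
  refine LipschitzWith.of_dist_le_mul fun s t => ?_
  rw [Real.coe_toNNReal C hC]
  rcases le_total s t with h | h
  · rw [dist_comm, dist_comm s, dist_eq_norm, Real.dist_eq, abs_of_nonneg (sub_nonneg.2 h)]
    exact hF s t h
  · rw [dist_eq_norm, Real.dist_eq, abs_of_nonneg (sub_nonneg.2 h)]
    exact hF t s h

lemma IsCurve.lipschitz_A (hc : IsCurve D K B L A y) {i : ℕ} (hi : i ≤ D.N) :
    LipschitzWith (length D.N A).toNNReal (A i) := by
  refine lipschitzWith_of_sub_le hc.length_nonneg fun s t hst => ?_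
  rw [Real.norm_of_nonneg (sub_nonneg.2 (hc.mono i s t hst))]
  exact (hc.A_sub_le hi hst).trans
    (mul_le_mul_of_nonneg_left (clamp_sub_le hst) hc.length_nonneg)

lemma IsCurve.monotone_A (hc : IsCurve D K B L A y) (i : ℕ) : Monotone (A i) :=
  fun s t hst => hc.mono i s t hst

lemma IsCurve.exists_lipschitz (hc : IsCurve D K B L A y) {M : ℝ} (hMf : ∀ z, ‖D.f z‖ ≤ M)
    (hMg : ∀ z, ‖D.g z‖ ≤ M) : ∃ C, ∀ i ≤ D.N, LipschitzWith C (y i) := by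
  have hM0 : 0 ≤ M := (norm_nonneg _).trans (hMf 0)
  have hl := hc.length_nonneg
  refine ⟨(2 * (length D.N A * M) + |L|).toNNReal, fun i hi => ?_⟩
  refine lipschitzWith_of_sub_le (by positivity) fun s t hst => ?_
  have hts : 0 ≤ t - s := sub_nonneg.2 hst
  rcases Nat.eq_zero_or_pos i with rfl | hpos
  · rw [hc.delay, hc.delay, sub_self, norm_zero]
    positivity
  have h1 := hc.step i (Finset.mem_Icc.2 ⟨hpos, hi⟩) s t hst
  have hA : ∀ j ≤ D.N, ∀ v : EuclideanSpace ℝ (Fin n), ‖v‖ ≤ M →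
      ‖(A j t - A j s) • v‖ ≤ length D.N A * M * (t - s) := by
    intro j hj v hv
    have h2 := (hc.A_sub_le hj hst).trans (mul_le_mul_of_nonneg_left (clamp_sub_le hst) hl)
    rw [norm_smul, Real.norm_of_nonneg (sub_nonneg.2 (hc.mono j s t hst))]
    calc (A j t - A j s) * ‖v‖ ≤ length D.N A * (t - s) * M :=
          mul_le_mul h2 hv (norm_nonneg _) (mul_nonneg hl hts)
      _ = _ := by ring
  have h2 := hA 0 (Nat.zero_le _) _ (hMf (y i s, y (i - 1) s))
  have h3 := hA i hi _ (hMg (y i s, y (i - 1) s))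
  have hcl0 : 0 ≤ clamp t - clamp s := sub_nonneg.2 (clamp_mono hst)
  have hcl1 : clamp t - clamp s ≤ 1 := by
    have := (clamp_mem t).2
    have := (clamp_mem s).1
    linarith
  have h4 : L * (clamp t - clamp s) ^ 2 ≤ |L| * (t - s) := by
    have h5 : (clamp t - clamp s) ^ 2 ≤ t - s := by
      rw [sq]
      calc _ ≤ 1 * (clamp t - clamp s) := mul_le_mul_of_nonneg_right hcl1 hcl0
        _ = clamp t - clamp s := one_mul _
        _ ≤ _ := clamp_sub_le hst
    exact mul_le_mul (le_abs_self L) h5 (sq_nonneg _) (abs_nonneg _)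
  have h6 : y i t - y i s = (y i t - y i s - (A 0 t - A 0 s) • D.f (y i s, y (i - 1) s)
      - (A i t - A i s) • D.g (y i s, y (i - 1) s))
      + (A 0 t - A 0 s) • D.f (y i s, y (i - 1) s)
      + (A i t - A i s) • D.g (y i s, y (i - 1) s) := by abel
  rw [h6]
  refine norm_add₃_le.trans ?_
  linarith

lemma IsCurve.hasDerivAt (hc : IsCurve D K B L A y) (hf : Continuous D.f) (hg : Continuous D.g)
    {M : ℝ} (hMf : ∀ z, ‖D.f z‖ ≤ M) (hMg : ∀ z, ‖D.g z‖ ≤ M) {i : ℕ} (hi : i ∈ Finset.Icc 1 D.N)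
    {s : ℝ} (h0 : DifferentiableAt ℝ (A 0) s) (h1 : DifferentiableAt ℝ (A i) s) :
    HasDerivAt (y i) (deriv (A 0) s • D.f (y i s, y (i - 1) s)
      + deriv (A i) s • D.g (y i s, y (i - 1) s)) s := by
  obtain ⟨C, hC⟩ := hc.exists_lipschitz hMf hMg
  have hi' := (Finset.mem_Icc.1 hi).2
  have hl := hc.length_nonneg
  have hypair : Continuous fun t => (y i t, y (i - 1) t) :=
    (hC i hi').continuous.prodMk (hC (i - 1) ((Nat.sub_le i 1).trans hi')).continuous
  set α := D.f (y i s, y (i - 1) s) with hα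
  set β := D.g (y i s, y (i - 1) s) with hβ
  set η : ℝ → ℝ := fun t => |L| * |t - s| + length D.N A * ‖D.f (y i t, y (i - 1) t) - α‖
    + length D.N A * ‖D.g (y i t, y (i - 1) t) - β‖ with hη
  have hηc : Continuous η := by
    have := hf.comp hypair
    have := hg.comp hypair
    fun_prop
  have hη0 : η s = 0 := by simp [hη, hα, hβ]
  set e : ℝ → EuclideanSpace ℝ (Fin n) := fun t =>
    y i t - y i s - (A 0 t - A 0 s) • α - (A i t - A i s) • β with he
  have hAabs : ∀ j ≤ D.N, ∀ t, |A j t - A j s| ≤ length D.N A * |t - s| := by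
    intro j hj t
    have := (hc.lipschitz_A hj).dist_le_mul t s
    rwa [Real.dist_eq, Real.dist_eq, Real.coe_toNNReal _ hl] at this
  have hsq : ∀ a b : ℝ, a ≤ b → L * (clamp b - clamp a) ^ 2 ≤ |L| * |b - a| * |b - a| := by
    intro a b hab
    have h2 : clamp b - clamp a ≤ |b - a| := (clamp_sub_le hab).trans (le_abs_self _)
    have h3 : 0 ≤ clamp b - clamp a := sub_nonneg.2 (clamp_mono hab)
    calc L * (clamp b - clamp a) ^ 2 ≤ |L| * |b - a| ^ 2 :=
          mul_le_mul (le_abs_self L) (pow_le_pow_left₀ h3 h2 2) (sq_nonneg _) (abs_nonneg _)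
      _ = _ := by ring
  have hele : ∀ t, ‖e t‖ ≤ η t * |t - s| := by
    intro t
    have hts := abs_nonneg (t - s)
    rcases le_total s t with hst | hst
    · have h2 := hc.step i hi s t hst
      refine (h2.trans (hsq s t hst)).trans ?_
      refine mul_le_mul_of_nonneg_right ?_ hts
      have := mul_nonneg hl (norm_nonneg (D.f (y i t, y (i - 1) t) - α))
      have := mul_nonneg hl (norm_nonneg (D.g (y i t, y (i - 1) t) - β))
      simp only [hη]
      linarith
    · have h2 := (hc.step i hi t s hst).trans (hsq t s hst)
      rw [abs_sub_comm s t] at h2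
      have h3 : e t = -(y i s - y i t - (A 0 s - A 0 t) • D.f (y i t, y (i - 1) t)
          - (A i s - A i t) • D.g (y i t, y (i - 1) t))
          + (A 0 t - A 0 s) • (D.f (y i t, y (i - 1) t) - α)
          + (A i t - A i s) • (D.g (y i t, y (i - 1) t) - β) := by
        simp only [he]
        module
      rw [h3]
      refine norm_add₃_le.trans ?_
      rw [norm_neg, norm_smul, norm_smul, Real.norm_eq_abs, Real.norm_eq_abs]
      have h4 := mul_le_mul_of_nonneg_right (hAabs 0 (Nat.zero_le _) t)
        (norm_nonneg (D.f (y i t, y (i - 1) t) - α))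
      have h5 := mul_le_mul_of_nonneg_right (hAabs i hi' t)
        (norm_nonneg (D.g (y i t, y (i - 1) t) - β))
      simp only [hη]
      linarith
  have hes : e s = 0 := by simp [he]
  have hde : HasDerivAt e 0 s := by
    rw [hasDerivAt_iff_isLittleO]
    refine Asymptotics.isLittleO_iff.2 fun ε hε => ?_
    have hev : ∀ᶠ t in 𝓝 s, η t < ε := hηc.continuousAt.eventually_lt continuousAt_const
      (by rwa [hη0])
    filter_upwards [hev] with t ht
    rw [hes, smul_zero, sub_zero, sub_zero, Real.norm_eq_abs]
    exact (hele t).trans (mul_le_mul_of_nonneg_right ht.le (abs_nonneg _))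
  have hfin := ((hde.fun_add ((h0.hasDerivAt.sub_const (A 0 s)).smul_const α)).fun_add
    ((h1.hasDerivAt.sub_const (A i s)).smul_const β)).add_const (y i s)
  rw [zero_add] at hfin
  refine hfin.congr_of_eventuallyEq (Eventually.of_forall fun t => ?_)
  simp only [he]
  abel

lemma IsCurve.ae_differentiableAt (hc : IsCurve D K B L A y) :
    ∀ᵐ s, ∀ i ≤ D.N, DifferentiableAt ℝ (A i) s := by
  rw [ae_all_iff]
  intro i
  by_cases hi : i ≤ D.N
  · filter_upwards [(hc.lipschitz_A hi).ae_differentiableAt_real] with s hs _ using hs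
  · exact Eventually.of_forall fun s h => absurd h hi

lemma IsCurve.abs_deriv_le (hc : IsCurve D K B L A y) {i : ℕ} (hi : i ≤ D.N) (s : ℝ) :
    ‖deriv (A i) s‖ ≤ length D.N A := by
  have := norm_deriv_le_of_lipschitz (x₀ := s) (hc.lipschitz_A hi)
  rwa [Real.coe_toNNReal _ hc.length_nonneg] at this

lemma IsCurve.intervalIntegrable_smul (hc : IsCurve D K B L A y) (i : ℕ)
    {φ : ℝ → EuclideanSpace ℝ (Fin n)} (hφ : Continuous φ) (a b : ℝ) :
    IntervalIntegrable (fun s => deriv (A i) s • φ s) volume a b := by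
  have h1 : IntervalIntegrable (deriv (A i)) volume a b :=
    ((hc.monotone_A i).monotoneOn _).intervalIntegrable_deriv
  exact h1.smul_continuousOn hφ.continuousOn

lemma IsCurve.integral_eq (hc : IsCurve D K B L A y) (hf : Continuous D.f) (hg : Continuous D.g)
    {M : ℝ} (hMf : ∀ z, ‖D.f z‖ ≤ M) (hMg : ∀ z, ‖D.g z‖ ≤ M) {i : ℕ} (hi : i ∈ Finset.Icc 1 D.N)
    (a b : ℝ) : (∫ s in a..b, deriv (A 0) s • D.f (y i s, y (i - 1) s))
      + (∫ s in a..b, deriv (A i) s • D.g (y i s, y (i - 1) s)) = y i b - y i a := by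
  obtain ⟨C, hC⟩ := hc.exists_lipschitz hMf hMg
  have hi' := (Finset.mem_Icc.1 hi).2
  have hypair : Continuous fun t => (y i t, y (i - 1) t) :=
    (hC i hi').continuous.prodMk (hC (i - 1) ((Nat.sub_le i 1).trans hi')).continuous
  have hif := hc.intervalIntegrable_smul 0 (hf.comp hypair) a b
  have hig := hc.intervalIntegrable_smul i (hg.comp hypair) a b
  have hl := hc.length_nonneg
  refine (intervalIntegral.integral_add hif hig).symm.trans ?_
  refine integral_eq_sub_of_absolutelyContinuous (C := length D.N A * M + length D.N A * M)
    (hC i hi').lipschitzOnWith.absolutelyContinuousOnInterval (hif.add hig)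
    (Eventually.of_forall fun s _ => ?_) ?_
  · refine (norm_add_le _ _).trans (add_le_add ?_ ?_)
    · rw [norm_smul]
      exact mul_le_mul (hc.abs_deriv_le (Nat.zero_le _) s) (hMf _) (norm_nonneg _) hl
    · rw [norm_smul]
      exact mul_le_mul (hc.abs_deriv_le hi' s) (hMg _) (norm_nonneg _) hl
  · filter_upwards [hc.ae_differentiableAt] with s hs _
    exact hc.hasDerivAt hf hg hMf hMg hi (hs 0 (Nat.zero_le _)) (hs i hi')

lemma IsCurve.sum_deriv (hc : IsCurve D K B L A y) {s : ℝ} (hs : s ∈ Ioo (0 : ℝ) 1)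
    (hd : ∀ i ≤ D.N, DifferentiableAt ℝ (A i) s) :
    ∑ i ∈ Finset.range (D.N + 1), deriv (A i) s = length D.N A := by
  have h1 : HasDerivAt (fun t => ∑ i ∈ Finset.range (D.N + 1), A i t)
      (∑ i ∈ Finset.range (D.N + 1), deriv (A i) s) s :=
    HasDerivAt.fun_sum fun i hi => (hd i (Nat.lt_succ_iff.1 (Finset.mem_range.1 hi))).hasDerivAt
  have h2 : HasDerivAt (fun t => ∑ i ∈ Finset.range (D.N + 1), A i t) (length D.N A) s := by
    have h3 : HasDerivAt (fun t : ℝ => t * length D.N A) (length D.N A) s := by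
      simpa using (hasDerivAt_id s).mul_const (length D.N A)
    refine h3.congr_of_eventuallyEq ?_
    filter_upwards [Ioo_mem_nhds hs.1 hs.2] with t ht
    rw [hc.sum_eq t, clamp_of_mem (Ioo_subset_Icc_self ht), length]
  exact h1.unique h2

end Unfold

section Unfold

variable {D : System n} {K B L : ℝ} {A : ℕ → ℝ → ℝ} {y : ℕ → ℝ → EuclideanSpace ℝ (Fin n)}

/-- The parameter in the fibre of the time `r` that corresponds to `s ∈ [0, 1]`. -/
noncomputable def fibreParam (θ : ℝ → ℝ) (r s : ℝ) : ℝ :=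
  firstHit θ r + (lastHit θ r - firstHit θ r) * s

lemma fibreParam_zero (θ : ℝ → ℝ) (r : ℝ) : fibreParam θ r 0 = firstHit θ r := by
  simp [fibreParam]

lemma fibreParam_one (θ : ℝ → ℝ) (r : ℝ) : fibreParam θ r 1 = lastHit θ r := by
  simp [fibreParam]

lemma fibreParam_eq_of_eq {θ : ℝ → ℝ} {r : ℝ} (h : firstHit θ r = lastHit θ r) (s : ℝ) :
    fibreParam θ r s = firstHit θ r := by
  simp [fibreParam, h]

lemma fibreParam_mem_Ioo {θ : ℝ → ℝ} {r s : ℝ} (h : firstHit θ r < lastHit θ r)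
    (hs : s ∈ Ioo (0 : ℝ) 1) : fibreParam θ r s ∈ Ioo (firstHit θ r) (lastHit θ r) := by
  have := sub_pos.2 h
  have h1 := mul_pos this hs.1
  have h2 := mul_lt_mul_of_pos_left hs.2 this
  constructor <;> rw [fibreParam] <;> linarith

lemma ae_fibreParam {θ : ℝ → ℝ} {r : ℝ} (h : firstHit θ r < lastHit θ r) {p : ℝ → Prop}
    (hp : ∀ᵐ s, p s) : ∀ᵐ s, p (fibreParam θ r s) := by
  have h1 := (measurePreserving_add_left (volume : Measure ℝ) (firstHit θ r)
    ).quasiMeasurePreserving.comp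
    (Measure.quasiMeasurePreserving_smul (volume : Measure ℝ) (sub_pos.2 h).ne')
  exact h1.ae hp

lemma ae_mem_Ioo : ∀ᵐ s ∂(volume.restrict (Icc (0 : ℝ) 1)), s ∈ Ioo (0 : ℝ) 1 := by
  rw [← Measure.restrict_congr_set Ioo_ae_eq_Icc]
  exact ae_restrict_mem measurableSet_Ioo

lemma IsCurve.deriv_clock_eq_zero (hc : IsCurve D K B L A y) {r s : ℝ} (hr : r ∈ Icc 0 D.h)
    (hs : s ∈ Ico (firstHit (A 0) r) (lastHit (A 0) r)) : deriv (A 0) s = 0 := by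
  have hθc := (hc.lipschitz_A (Nat.zero_le _)).continuous
  have h00 := hc.A_zero (Nat.zero_le _)
  have hiff := fun t ht =>
    (apply_eq_iff (hc.monotone_A 0) hθc h00 hc.clock hr (s := t) ht)
  have hfm := firstHit_mem hθc h00 hc.clock hr
  have hlm := lastHit_mem (A 0) r
  refine deriv_eq_zero_of_const_right hs.2 fun t ht => ?_
  rw [(hiff t ⟨hfm.1.trans (hs.1.trans ht.1), ht.2.trans hlm.2⟩).2 ⟨hs.1.trans ht.1, ht.2⟩,
    (hiff s ⟨hfm.1.trans hs.1, hs.2.le.trans hlm.2⟩).2 ⟨hs.1, hs.2.le⟩]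

lemma setIntegral_congr_ae_deriv {F : ℝ → ℝ} {φ ψ : ℝ → EuclideanSpace ℝ (Fin n)} {S : Set ℝ}
    (hS : MeasurableSet S) (h : ∀ s ∈ S, deriv F s = 0 ∨ φ s = ψ s) :
    ∫ s in S, deriv F s • φ s = ∫ s in S, deriv F s • ψ s := by
  refine setIntegral_congr_fun hS fun s hs => ?_
  rcases h s hs with h | h <;> simp only [h, zero_smul]

lemma IsCurve.dyn (hc : IsCurve D K B L A y) (hf : Continuous D.f) (hg : Continuous D.g)
    {M : ℝ} (hMf : ∀ z, ‖D.f z‖ ≤ M) (hMg : ∀ z, ‖D.g z‖ ≤ M) (hh : 0 ≤ D.h) {i : ℕ}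
    (hi : i ∈ Finset.Icc 1 D.N) {τ : ℝ} (hτ : τ ∈ Ioo 0 D.h) :
    Summable (fun r : Ioc 0 τ => y i (lastHit (A 0) r) - y i (firstHit (A 0) r)) ∧
      y i (lastHit (A 0) τ) = y i (lastHit (A 0) 0)
        + (∫ ρ in (0 : ℝ)..τ, D.f (y i (lastHit (A 0) ρ), y (i - 1) (lastHit (A 0) ρ)))
        + (∫ ρ in Ioc 0 τ, D.g (y i (lastHit (A 0) ρ), y (i - 1) (lastHit (A 0) ρ))
            ∂(contPart ((derivMeasure (A i)).map (A 0))))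
        + ∑' r : Ioc 0 τ, (y i (lastHit (A 0) r) - y i (firstHit (A 0) r)) := by
  obtain ⟨C, hC⟩ := hc.exists_lipschitz hMf hMg
  have hi' := (Finset.mem_Icc.1 hi).2
  have hypair : Continuous fun t => (y i t, y (i - 1) t) :=
    (hC i hi').continuous.prodMk (hC (i - 1) ((Nat.sub_le i 1).trans hi')).continuous
  set θ := A 0 with hθ
  have hθm : Monotone θ := hc.monotone_A 0
  have hθL := hc.lipschitz_A (Nat.zero_le _)
  have hθc : Continuous θ := hθL.continuous
  have hθ0 : θ 0 = 0 := hc.A_zero (Nat.zero_le _)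
  have hθ1 : θ 1 = D.h := hc.clock
  have hAm := hc.monotone_A i
  have := isFiniteMeasure_derivMeasure hθm
  have := isFiniteMeasure_derivMeasure hAm
  have hsubI : Ioc 0 τ ⊆ Icc 0 D.h := fun r hr => ⟨hr.1.le, hr.2.trans hτ.2.le⟩
  set φ := fun s => D.f (y i s, y (i - 1) s) with hφ
  set γ := fun s => D.g (y i s, y (i - 1) s) with hγ
  have hφc : Continuous φ := hf.comp hypair
  have hγc : Continuous γ := hg.comp hypair
  have hlm : Measurable (lastHit θ) := (monotone_lastHit θ).measurable
  set a := lastHit θ 0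
  set b := lastHit θ τ
  have hab : a ≤ b := monotone_lastHit θ hτ.1.le
  have hpre : θ ⁻¹' Ioc 0 τ ∩ Icc 0 1 = Ioc a b := by
    ext s
    constructor
    · rintro ⟨hs, hs'⟩
      refine ⟨not_le.1 fun hcon => ?_, le_lastHit hs' hs.2⟩
      exact absurd ((apply_le_iff hθm hθc hθ0 hθ1 ⟨le_rfl, hh⟩ hs').2 hcon) (not_le.2 hs.1)
    · intro hs
      have hs' : s ∈ Icc (0 : ℝ) 1 :=
        ⟨(lastHit_mem θ 0).1.trans hs.1.le, hs.2.trans (lastHit_mem θ τ).2⟩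
      refine ⟨⟨not_le.1 fun hcon => ?_,
        (apply_le_iff hθm hθc hθ0 hθ1 (Ioo_subset_Icc_self hτ) hs').2 hs.2⟩, hs'⟩
      exact absurd (le_lastHit hs' hcon) (not_le.2 hs.1)
  have hpm : MeasurableSet (θ ⁻¹' Ioc 0 τ) := hθm.measurable measurableSet_Ioc
  have hlast : ∀ s ∈ θ ⁻¹' Ioc 0 τ ∩ Icc 0 1,
      s ∈ Ico (firstHit θ (θ s)) (lastHit θ (θ s)) ∨ s = lastHit θ (θ s) := by
    intro s hs
    have h1 := (apply_eq_iff hθm hθc hθ0 hθ1 (hsubI hs.1) hs.2).1 rfl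
    exact h1.2.lt_or_eq.imp (fun h => ⟨h1.1, h⟩) id
  -- the drift
  have hdrift : ∫ s in Ioc a b, deriv θ s • φ s = ∫ ρ in (0 : ℝ)..τ, φ (lastHit θ ρ) := by
    have e1 : ∫ s in θ ⁻¹' Ioc 0 τ ∩ Icc 0 1, deriv θ s • φ s
        = ∫ s in θ ⁻¹' Ioc 0 τ ∩ Icc 0 1, deriv θ s • φ (lastHit θ (θ s)) :=
      setIntegral_congr_ae_deriv (hpm.inter measurableSet_Icc) fun s hs =>
        (hlast s hs).imp (fun h => hc.deriv_clock_eq_zero (hsubI hs.1) h) (fun h => by rw [← h])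
    rw [← hpre, e1, ← setIntegral_derivMeasure hθm (fun s => φ (lastHit θ (θ s))) hpm,
      ← setIntegral_map (f := fun ρ => φ (lastHit θ ρ)) measurableSet_Ioc
        ((hφc.measurable.comp hlm).aestronglyMeasurable) hθm.measurable.aemeasurable,
      map_derivMeasure_self hθm hθc hθ0 hθ1 hθL, Measure.restrict_restrict measurableSet_Ioc,
      inter_eq_left.2 hsubI, intervalIntegral.integral_of_le hτ.1.le]
  -- the jumps and the continuous part
  have hγi : IntegrableOn γ (θ ⁻¹' Ioc 0 τ) (derivMeasure (A i)) :=
    Integrable.of_bound hγc.aestronglyMeasurable M (Eventually.of_forall fun s => hMg _)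
  obtain ⟨hsum, hsplit⟩ := setIntegral_preimage_eq_add_tsum (derivMeasure (A i)) hθm.measurable
    measurableSet_Ioc hγi
  have hjump : ∀ r ∈ Ioc 0 τ, ∫ s in θ ⁻¹' {r}, γ s ∂(derivMeasure (A i))
      = y i (lastHit θ r) - y i (firstHit θ r) := by
    intro r hr
    have hle := firstHit_le_lastHit hθc hθ0 hθ1 (hsubI hr)
    have hpre' : θ ⁻¹' {r} ∩ Icc 0 1 = Icc (firstHit θ r) (lastHit θ r) := by
      ext s
      refine ⟨fun hs => (apply_eq_iff hθm hθc hθ0 hθ1 (hsubI hr) hs.2).1 hs.1, fun hs => ?_⟩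
      have hs' : s ∈ Icc (0 : ℝ) 1 :=
        ⟨firstHit_nonneg.trans hs.1, hs.2.trans (lastHit_mem θ r).2⟩
      exact ⟨(apply_eq_iff hθm hθc hθ0 hθ1 (hsubI hr) hs').2 hs, hs'⟩
    have h0 : ∫ s in firstHit θ r..lastHit θ r, deriv θ s • φ s = 0 := by
      refine intervalIntegral.integral_zero_ae ?_
      filter_upwards [Measure.ae_ne volume (lastHit θ r)] with s hs hs'
      rw [uIoc_of_le hle] at hs'
      rw [hc.deriv_clock_eq_zero (hsubI hr) ⟨hs'.1.le, hs'.2.lt_of_ne hs⟩, zero_smul]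
    rw [setIntegral_derivMeasure hAm _ (hθm.measurable (measurableSet_singleton r)), hpre',
      integral_Icc_eq_integral_Ioc, ← intervalIntegral.integral_of_le hle,
      ← hc.integral_eq hf hg hMf hMg hi, h0, zero_add]
  have hcont : ∫ s in θ ⁻¹' (Ioc 0 τ ∩ {r | (derivMeasure (A i)).map θ {r} = 0}), γ s
        ∂(derivMeasure (A i))
      = ∫ ρ in Ioc 0 τ, γ (lastHit θ ρ) ∂(contPart ((derivMeasure (A i)).map θ)) := by
    have hSm := measurableSet_null_singleton ((derivMeasure (A i)).map θ)
    have hm1 : MeasurableSet (Ioc 0 τ ∩ {r | (derivMeasure (A i)).map θ {r} = 0}) :=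
      measurableSet_Ioc.inter hSm
    have hm2 := hθm.measurable hm1
    rw [contPart, Measure.restrict_restrict measurableSet_Ioc,
      setIntegral_map (f := fun ρ => γ (lastHit θ ρ)) hm1
        ((hγc.measurable.comp hlm).aestronglyMeasurable)
        hθm.measurable.aemeasurable,
      setIntegral_derivMeasure hAm _ hm2, setIntegral_derivMeasure hAm _ hm2]
    refine setIntegral_congr_ae_deriv (hm2.inter measurableSet_Icc) fun s hs => ?_
    rcases hlast s ⟨hs.1.1, hs.2⟩ with h | h
    · left
      have hr : θ s ∈ Icc 0 D.h := hsubI hs.1.1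
      have e1 := derivMeasure_fibre hθm hθc hθ0 hθ1 hAm (hc.lipschitz_A hi') hr
      have e2 : (derivMeasure (A i)).map θ {θ s} = 0 := hs.1.2
      rw [measureReal_def, e2, ENNReal.toReal_zero] at e1
      refine deriv_eq_zero_of_const_right h.2 fun t ht => ?_
      have e3 := hAm h.1
      have e4 := hAm ht.1
      have e5 := hAm ht.2
      linarith
    · right
      rw [← h]
  have hsum' : ∑' r : Ioc 0 τ, ∫ s in θ ⁻¹' {(r : ℝ)}, γ s ∂(derivMeasure (A i))
      = ∑' r : Ioc 0 τ, (y i (lastHit θ r) - y i (firstHit θ r)) :=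
    tsum_congr fun r => hjump r r.2
  refine ⟨hsum.congr fun r => hjump r r.2, ?_⟩
  have hmain := hc.integral_eq hf hg hMf hMg hi a b
  rw [intervalIntegral.integral_of_le hab, intervalIntegral.integral_of_le hab] at hmain
  rw [hdrift, ← hpre, ← setIntegral_derivMeasure hAm γ hpm, hsplit, hcont, hsum'] at hmain
  refine (sub_eq_iff_eq_add'.1 hmain.symm).trans ?_
  simp only [hφ, hγ, add_assoc]

/-- Every curve unfolds to a folded process. -/
lemma exists_isFolded_of_isCurve {D : System n} (hf : Continuous D.f) (hg : Continuous D.g)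
    (hf_bdd : ∃ M : ℝ, ∀ z, ‖D.f z‖ ≤ M) (hg_bdd : ∃ M : ℝ, ∀ z, ‖D.g z‖ ≤ M)
    (hh : 0 ≤ D.h) {K B L : ℝ} {A : ℕ → ℝ → ℝ} {y : ℕ → ℝ → EuclideanSpace ℝ (Fin n)}
    (hc : IsCurve D K B L A y) :
    ∃ m w ζ, IsFolded D m w ζ ∧ ζ D.h D.N 1 = y D.N 1 ∧
      ∑ i ∈ Finset.Icc 1 D.N, (m i).real univ ≤ K := by
  obtain ⟨M₁, hM₁⟩ := hf_bdd
  obtain ⟨M₂, hM₂⟩ := hg_bdd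
  have hMf : ∀ z, ‖D.f z‖ ≤ max M₁ M₂ := fun z => (hM₁ z).trans (le_max_left _ _)
  have hMg : ∀ z, ‖D.g z‖ ≤ max M₁ M₂ := fun z => (hM₂ z).trans (le_max_right _ _)
  obtain ⟨C, hC⟩ := hc.exists_lipschitz hMf hMg
  set θ := A 0 with hθ
  have hθm : Monotone θ := hc.monotone_A 0
  have hθL := hc.lipschitz_A (Nat.zero_le _)
  have hθc : Continuous θ := hθL.continuous
  have hθ0 : θ 0 = 0 := hc.A_zero (Nat.zero_le _)
  have hθ1 : θ 1 = D.h := hc.clock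
  have hfin := fun i => isFiniteMeasure_derivMeasure (hc.monotone_A i)
  have hint : ∀ r i, i ≤ D.N → ∫ s in (0 : ℝ)..1,
      (lastHit θ r - firstHit θ r) * deriv (A i) (fibreParam θ r s)
      = A i (lastHit θ r) - A i (firstHit θ r) := by
    intro r i hi
    rw [intervalIntegral.integral_const_mul]
    have := intervalIntegral.mul_integral_comp_add_mul (f := deriv (A i)) (a := 0) (b := 1)
      (lastHit θ r - firstHit θ r) (firstHit θ r)
    simp only [fibreParam]
    rw [this, integral_deriv_of_lipschitz (hc.lipschitz_A hi)]
    congr 2 <;> ring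
  have hae : ∀ r ∈ Icc 0 D.h, firstHit θ r < lastHit θ r →
      ∀ᵐ s ∂(volume.restrict (Icc (0 : ℝ) 1)), s ∈ Ioo (0 : ℝ) 1 ∧
        (∀ i ≤ D.N, DifferentiableAt ℝ (A i) (fibreParam θ r s)) ∧
        deriv θ (fibreParam θ r s) = 0 := by
    intro r hr hlt
    filter_upwards [ae_mem_Ioo, ae_restrict_of_ae (ae_fibreParam hlt hc.ae_differentiableAt)]
      with s hs hd
    have := fibreParam_mem_Ioo hlt hs
    exact ⟨hs, hd, hc.deriv_clock_eq_zero hr ⟨this.1.le, this.2⟩⟩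
  refine ⟨fun i => (derivMeasure (A i)).map θ,
    fun r i s => (lastHit θ r - firstHit θ r) * deriv (A i) (fibreParam θ r s),
    fun r i s => y i (fibreParam θ r s), ⟨?_, ?_, ?_, ?_, ?_, ?_, ?_, ?_, ?_, ?_, ?_, ?_, ?_, ?_⟩,
    ?_, ?_⟩
  · intro i; infer_instance
  · intro i
    rw [Measure.map_apply hθm.measurable measurableSet_Icc.compl]
    refine measure_mono_null ?_ (derivMeasure_compl (A i))
    intro s hs hs'
    refine hs ⟨?_, ?_⟩
    · rw [← hθ0]; exact hθm hs'.1
    · rw [← hθ1]; exact hθm hs'.2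
  · intro r _ i _
    refine Measurable.aemeasurable ?_
    have : Measurable (fibreParam θ r) := by unfold fibreParam; fun_prop
    exact ((measurable_deriv (A i)).comp this).const_mul _
  · intro r hr i _ s _
    exact mul_nonneg (sub_nonneg.2 (firstHit_le_lastHit hθc hθ0 hθ1 hr))
      (hc.monotone_A i).deriv_nonneg
  · intro r hr
    have e1 : ∑ i ∈ Finset.Icc 1 D.N, ∫ s in (0 : ℝ)..1,
        (lastHit θ r - firstHit θ r) * deriv (A i) (fibreParam θ r s)
        = (lastHit θ r - firstHit θ r) * length D.N A := by
      rw [Finset.sum_congr rfl fun i hi => hint r i (Finset.mem_Icc.1 hi).2,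
        Finset.sum_sub_distrib]
      have e2 := hc.sum_eq (lastHit θ r)
      have e3 := hc.sum_eq (firstHit θ r)
      rw [clamp_of_mem (lastHit_mem θ r), sum_range_succ_eq_add_sum_Icc] at e2
      rw [clamp_of_mem (firstHit_mem hθc hθ0 hθ1 hr), sum_range_succ_eq_add_sum_Icc] at e3
      have e4 := apply_lastHit hθm hθc hθ0 hθ1 hr
      have e5 := apply_firstHit hθm hθc hθ0 hθ1 hr
      rw [← hθ, e4] at e2
      rw [← hθ, e5] at e3
      rw [length]
      linarith
    rw [e1]
    rcases (firstHit_le_lastHit hθc hθ0 hθ1 hr).eq_or_lt with heq | hlt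
    · refine Eventually.of_forall fun s => ?_
      simp [heq]
    · filter_upwards [hae r hr hlt] with s hs
      have hm := fibreParam_mem_Ioo hlt hs.1
      have e2 := hc.sum_deriv (s := fibreParam θ r s)
        ⟨firstHit_nonneg.trans_lt hm.1, hm.2.trans_le (lastHit_mem θ r).2⟩ hs.2.1
      rw [sum_range_succ_eq_add_sum_Icc, ← hθ, hs.2.2, zero_add] at e2
      rw [← Finset.mul_sum, e2]
  · intro r hr i hi
    rw [hint r i (Finset.mem_Icc.1 hi).2, derivMeasure_fibre hθm hθc hθ0 hθ1 (hc.monotone_A i)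
      (hc.lipschitz_A (Finset.mem_Icc.1 hi).2) hr]
  · exact fun r s => hc.delay _
  · intro r hr i hi
    have h1 : LipschitzWith (‖lastHit θ r - firstHit θ r‖₊) (fibreParam θ r) := by
      refine LipschitzWith.of_dist_le_mul fun s t => ?_
      simp only [fibreParam, Real.dist_eq, coe_nnnorm, Real.norm_eq_abs, ← abs_mul]
      refine le_of_eq (congrArg abs ?_)
      ring
    exact ((hC i (Finset.mem_Icc.1 hi).2).comp h1).lipschitzOnWith.absolutelyContinuousOnInterval
  · intro r hr i hi
    rcases (firstHit_le_lastHit hθc hθ0 hθ1 hr).eq_or_lt with heq | hlt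
    · refine Eventually.of_forall fun s => ?_
      simp only [fibreParam_eq_of_eq heq, heq, sub_self, zero_mul, zero_smul]
      exact hasDerivAt_const _ _
    · filter_upwards [hae r hr hlt] with s hs
      have h1 := hc.hasDerivAt hf hg hMf hMg hi (hs.2.1 0 (Nat.zero_le _))
        (hs.2.1 i (Finset.mem_Icc.1 hi).2)
      rw [← hθ, hs.2.2, zero_smul, zero_add] at h1
      have h2 : HasDerivAt (fibreParam θ r) (lastHit θ r - firstHit θ r) s := by
        have := ((hasDerivAt_id s).const_mul (lastHit θ r - firstHit θ r)).const_add
          (firstHit θ r)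
        rwa [mul_one] at this
      have h3 := h1.scomp s h2
      rwa [smul_smul] at h3
  · rw [fibreParam_zero, firstHit_zero hθ0, hc.start]
  · intro i hi
    rw [fibreParam_zero, firstHit_zero hθ0, fibreParam_one, lastHit_end hθ1, hc.link i hi]
  · intro r hr i hi
    simp only [fibreParam_zero, fibreParam_one]
    exact (hC i (Finset.mem_Icc.1 hi).2).continuous.continuousAt.tendsto.comp
      (tendsto_lastHit_left hθm hθc hθ0 hθ1 hr)
  · intro i hi
    simp only [fibreParam_one]
    refine (hC i (Finset.mem_Icc.1 hi).2).comp_boundedVariationOn (g := lastHit θ) ?_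
    refine boundedVariationOn_of_dominated (V := lastHit θ) (C := 1)
      ((monotone_lastHit θ).monotoneOn _) (fun t _ => ?_) fun t _ t' _ htt => ?_
    · rw [abs_of_nonneg (lastHit_mem θ t).1]; exact (lastHit_mem θ t).2
    · rw [Real.norm_of_nonneg (sub_nonneg.2 (monotone_lastHit θ htt))]
  · intro i hi τ hτ
    simp only [fibreParam_zero, fibreParam_one]
    exact hc.dyn hf hg hMf hMg hh hi hτ
  · simp only [fibreParam_one, lastHit_end hθ1]
  · have h1 : ∀ i ∈ Finset.Icc 1 D.N, ((derivMeasure (A i)).map θ).real univ = A i 1 := by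
      intro i hi
      rw [map_measureReal_apply hθm.measurable MeasurableSet.univ, preimage_univ,
        derivMeasure_real_apply (hc.monotone_A i) MeasurableSet.univ, univ_inter,
        integral_Icc_eq_integral_Ioc, ← intervalIntegral.integral_of_le zero_le_one,
        integral_deriv_of_lipschitz (hc.lipschitz_A (Finset.mem_Icc.1 hi).2),
        hc.A_zero (Finset.mem_Icc.1 hi).2, sub_zero]
    rw [Finset.sum_congr rfl h1]
    have h2 := hc.sum_le
    rw [sum_range_succ_eq_add_sum_Icc, hc.clock] at h2
    linarith

end Unfold

section Transfer

lemma contPart_restrict_eq_map {μ m : Measure ℝ} [IsFiniteMeasure μ] [IsFiniteMeasure m]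
    {a h τ : ℝ} (hτ : τ < h)
    (H : ∀ B, MeasurableSet B → B ⊆ Ioo a (a + h) → μ B = m ((· + a) ⁻¹' B)) :
    (contPart μ).restrict (Ioc a (a + τ))
      = ((contPart m).restrict (Ioc 0 τ)).map (· + a) := by
  have hadd : Measurable (· + a : ℝ → ℝ) := measurable_add_const a
  have hS := measurableSet_null_singleton μ
  have hS' := measurableSet_null_singleton m
  have hsing : ∀ ρ ∈ Ioc 0 τ, μ {ρ + a} = m {ρ} := by
    intro ρ hρ
    rw [H _ (measurableSet_singleton _)]
    · congr 1
      ext s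
      simp
    · rintro _ rfl
      exact ⟨by linarith [hρ.1], by linarith [hρ.2]⟩
  ext B hB
  rw [contPart, contPart, Measure.restrict_restrict measurableSet_Ioc,
    Measure.restrict_restrict measurableSet_Ioc, Measure.restrict_apply hB,
    Measure.map_apply hadd hB, Measure.restrict_apply (hadd hB),
    H _ (hB.inter (measurableSet_Ioc.inter hS))]
  · congr 1
    ext ρ
    have hI : ρ + a ∈ Ioc a (a + τ) ↔ ρ ∈ Ioc 0 τ := by
      simp only [mem_Ioc]
      constructor <;> rintro ⟨h1, h2⟩ <;> constructor <;> linarith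
    simp only [mem_preimage, mem_inter_iff, hI]
    refine and_congr_right fun _ => and_congr_right fun hρ => ?_
    rw [mem_ofPred_eq, mem_ofPred_eq, hsing ρ hρ]
  · rintro s ⟨-, hs, -⟩
    exact ⟨hs.1, hs.2.trans_lt (by linarith)⟩

variable {E F : Type*} [NormedAddCommGroup E] [NormedAddCommGroup F] [NormedSpace ℝ F]

lemma setIntegral_contPart_eq {μ m : Measure ℝ} [IsFiniteMeasure μ] [IsFiniteMeasure m]
    {a h τ : ℝ} (hτ : τ < h)
    (H : ∀ B, MeasurableSet B → B ⊆ Ioo a (a + h) → μ B = m ((· + a) ⁻¹' B))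
    {φ ψ : ℝ → F} (hφ : ∀ ρ ∈ Ioo 0 h, φ (ρ + a) = ψ ρ) :
    ∫ t in Icc a (a + τ), φ t ∂(contPart μ) = ∫ ρ in Ioc 0 τ, ψ ρ ∂(contPart m) := by
  rw [integral_Icc_eq_integral_Ioc' (contPart_singleton μ a), contPart_restrict_eq_map hτ H,
    (measurableEmbedding_addRight a).integral_map]
  exact setIntegral_congr_fun measurableSet_Ioc fun ρ hρ => hφ ρ ⟨hρ.1, hρ.2.trans_lt hτ⟩

lemma intervalIntegral_shift_eq {a h τ : ℝ} (hτ0 : 0 ≤ τ) (hτ : τ < h) {φ ψ : ℝ → F}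
    (hφ : ∀ ρ ∈ Ioo 0 h, φ (ρ + a) = ψ ρ) :
    ∫ t in a..(a + τ), φ t = ∫ ρ in (0 : ℝ)..τ, ψ ρ := by
  have h1 := intervalIntegral.integral_comp_add_right (a := 0) (b := τ) φ a
  rw [zero_add, add_comm τ a] at h1
  rw [← h1]
  refine intervalIntegral.integral_congr_ae (Eventually.of_forall fun ρ hρ => ?_)
  rw [uIoc_of_le hτ0] at hρ
  exact hφ ρ ⟨hρ.1, hρ.2.trans_lt hτ⟩

lemma tendsto_setIntegral_Icc_left {ν : Measure ℝ} {a b : ℝ} (hb : ν {b} = 0) {φ : ℝ → F}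
    (hφ : IntegrableOn φ (Icc a b) ν) :
    Tendsto (fun t => ∫ s in Icc a t, φ s ∂ν) (𝓝[<] b) (𝓝 (∫ s in Icc a b, φ s ∂ν)) := by
  simp_rw [← integral_indicator measurableSet_Icc]
  have hne : ∀ᵐ s ∂ν, s ≠ b := by
    rw [ae_iff]
    simpa using hb
  refine tendsto_integral_filter_of_dominated_convergence
    (fun s => ‖(Icc a b).indicator φ s‖) ?_ ?_ ?_ ?_
  · filter_upwards [self_mem_nhdsWithin] with t ht
    exact ((hφ.mono_set (Icc_subset_Icc_right (le_of_lt ht))).integrable_indicator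
      measurableSet_Icc).aestronglyMeasurable
  · filter_upwards [self_mem_nhdsWithin] with t ht
    refine Eventually.of_forall fun s => ?_
    exact norm_indicator_le_of_subset (Icc_subset_Icc_right (le_of_lt ht)) _ _
  · exact (hφ.integrable_indicator measurableSet_Icc).norm
  · filter_upwards [hne] with s hs
    refine tendsto_const_nhds.congr' ?_
    rcases lt_or_gt_of_ne hs with hlt | hgt
    · filter_upwards [Ioo_mem_nhdsLT hlt] with t ht
      simp only [indicator, mem_Icc, hlt.le, ht.1.le, and_true]
    · filter_upwards [self_mem_nhdsWithin] with t ht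
      have ht' : t < b := ht
      rw [indicator_of_notMem (fun h => absurd h.2 (not_le.2 hgt)),
        indicator_of_notMem (fun h => absurd h.2 (not_le.2 (ht'.trans hgt)))]

lemma tendsto_tsum_Ioc_left [FiniteDimensional ℝ F] {r : ℝ} (hr : 0 < r) {j : ℝ → F}
    (hj : Summable fun s : Ioc 0 r => j s) :
    Tendsto (fun τ => ∑' s : Ioc 0 τ, j s) (𝓝[<] r) (𝓝 (∑' s : Ioc 0 r, j s - j r)) := by
  have : CompleteSpace F := FiniteDimensional.complete ℝ F
  have hind : Summable ((Ioc 0 r).indicator j) := summable_subtype_iff_indicator.1 hj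
  have hsing : Summable (({r} : Set ℝ).indicator j) :=
    summable_of_hasFiniteSupport ((finite_singleton r).subset support_indicator_subset)
  have h1 : ∑' s : Ioc 0 r, j s - j r = ∑' s, (Ioo 0 r).indicator j s := by
    have h2 : ∑' s, ({r} : Set ℝ).indicator j s = j r := by
      rw [tsum_eq_single r fun s hs => indicator_of_notMem (by simpa using hs) _]
      simp
    rw [tsum_subtype (Ioc 0 r) j, ← h2, ← hind.tsum_sub hsing]
    refine tsum_congr fun s => ?_
    by_cases hs : s = r
    · subst hs
      simp [hr]
    · have h3 : s ∈ Ioc 0 r ↔ s ∈ Ioo 0 r :=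
        ⟨fun h => ⟨h.1, h.2.lt_of_ne hs⟩, fun h => Ioo_subset_Ioc_self h⟩
      rw [indicator_of_notMem (show s ∉ ({r} : Set ℝ) from hs), sub_zero]
      by_cases h4 : s ∈ Ioo 0 r
      · rw [indicator_of_mem h4, indicator_of_mem (h3.2 h4)]
      · rw [indicator_of_notMem h4, indicator_of_notMem (fun h => h4 (h3.1 h))]
  rw [h1]
  simp_rw [tsum_subtype]
  refine tendsto_tsum_of_dominated_convergence (bound := fun s => ‖(Ioc 0 r).indicator j s‖)
    hind.norm ?_ ?_
  · intro s
    refine tendsto_const_nhds.congr' ?_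
    rcases lt_or_ge s r with hlt | hge
    · filter_upwards [Ioo_mem_nhdsLT hlt] with t ht
      simp only [indicator, mem_Ioo, mem_Ioc, hlt, ht.1.le, and_true]
    · filter_upwards [self_mem_nhdsWithin] with t ht
      have ht' : t < r := ht
      rw [indicator_of_notMem (fun h => absurd h.2 (not_lt.2 hge)),
        indicator_of_notMem (fun h => absurd h.2 (not_le.2 (ht'.trans_le hge)))]
  · filter_upwards [self_mem_nhdsWithin] with t ht s
    exact norm_indicator_le_of_subset (Ioc_subset_Ioc_right (le_of_lt ht)) _ _

lemma tendsto_leftLim_of_boundedVariationOn [CompleteSpace E] {x : ℝ → E} {a b t : ℝ}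
    (hx : BoundedVariationOn x (Icc a b)) (ht : t ∈ Ioc a b) :
    Tendsto x (𝓝[<] t) (𝓝 (Function.leftLim x t)) := by
  obtain ⟨l, hl⟩ := hx.exists_tendsto_left t
  have h1 : 𝓝[Icc a b ∩ Iio t] t = 𝓝[<] t := by
    refine nhdsWithin_eq_nhdsWithin' (s := Ioi a) (Ioi_mem_nhds ht.1) ?_
    ext s
    simp only [mem_inter_iff, mem_Icc, mem_Iio, mem_Ioi]
    exact ⟨fun h => ⟨h.1.2, h.2⟩, fun h => ⟨⟨⟨h.2.le, h.1.le.trans ht.2⟩, h.1⟩, h.2⟩⟩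
  rw [h1] at hl
  exact tendsto_leftLim_of_tendsto ⟨l, hl⟩

lemma tendsto_add_left (a r : ℝ) : Tendsto (· + a) (𝓝[<] r) (𝓝[<] (r + a)) := by
  refine tendsto_nhdsWithin_iff.2 ⟨?_, ?_⟩
  · exact tendsto_nhdsWithin_of_tendsto_nhds (tendsto_id.add_const a)
  · filter_upwards [self_mem_nhdsWithin] with t ht
    have : t < r := ht
    simpa using this

end Transfer

section Fold

variable {D : System n} {p : Triple n}

/-- The measure control of the `i`-th delay interval translated to `[0, h]`, with the atoms at the
nodes as prescribed by the attached controls. -/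
noncomputable def foldMeasure (h : ℝ) (μ : Measure ℝ) (w : ℝ → ℕ → ℝ → ℝ) (i : ℕ) : Measure ℝ :=
  ENNReal.ofReal (∫ s in (0 : ℝ)..1, w 0 i s) • Measure.dirac 0
    + (μ.restrict (Ioo (((i : ℝ) - 1) * h) (((i : ℝ) - 1) * h + h))).map (· - ((i : ℝ) - 1) * h)
    + ENNReal.ofReal (∫ s in (0 : ℝ)..1, w h i s) • Measure.dirac h

instance {h : ℝ} {μ : Measure ℝ} [IsFiniteMeasure μ] {w : ℝ → ℕ → ℝ → ℝ} {i : ℕ} :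
    IsFiniteMeasure (foldMeasure h μ w i) := by
  have h1 : ∀ (c a : ℝ), IsFiniteMeasure (ENNReal.ofReal c • Measure.dirac a) := fun c a =>
    Measure.smul_finite _ ENNReal.ofReal_ne_top
  unfold foldMeasure
  have := h1 (∫ s in (0 : ℝ)..1, w 0 i s) 0
  have := h1 (∫ s in (0 : ℝ)..1, w h i s) h
  infer_instance

lemma foldMeasure_apply {h : ℝ} {μ : Measure ℝ} {w : ℝ → ℕ → ℝ → ℝ} {i : ℕ} {B : Set ℝ}
    (hB : MeasurableSet B) : foldMeasure h μ w i B
      = ENNReal.ofReal (∫ s in (0 : ℝ)..1, w 0 i s) * B.indicator 1 0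
        + μ ((· - ((i : ℝ) - 1) * h) ⁻¹' B
            ∩ Ioo (((i : ℝ) - 1) * h) (((i : ℝ) - 1) * h + h))
        + ENNReal.ofReal (∫ s in (0 : ℝ)..1, w h i s) * B.indicator 1 h := by
  have hm : Measurable (· - ((i : ℝ) - 1) * h : ℝ → ℝ) := measurable_sub_const _
  simp only [foldMeasure, Measure.add_apply, Measure.smul_apply, smul_eq_mul,
    Measure.dirac_apply' _ hB, Measure.map_apply hm hB, Measure.restrict_apply (hm hB)]

lemma foldMeasure_shift {h : ℝ} {μ : Measure ℝ} {w : ℝ → ℕ → ℝ → ℝ} {i : ℕ} {B : Set ℝ}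
    (hB : MeasurableSet B) (hsub : B ⊆ Ioo (((i : ℝ) - 1) * h) (((i : ℝ) - 1) * h + h)) :
    μ B = foldMeasure h μ w i ((· + ((i : ℝ) - 1) * h) ⁻¹' B) := by
  rw [foldMeasure_apply (measurable_add_const _ hB), indicator_of_notMem, indicator_of_notMem,
    mul_zero, mul_zero, zero_add, add_zero]
  · congr 1
    ext s
    simp only [mem_inter_iff, mem_preimage, sub_add_cancel]
    exact ⟨fun hs => ⟨hs, hsub hs⟩, fun hs => hs.1⟩
  · intro hs
    have h1 := (hsub hs).2
    linarith
  · intro hs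
    have h1 := (hsub hs).1
    linarith

lemma foldMeasure_real_singleton {h : ℝ} (hh : 0 < h) {μ : Measure ℝ} {w : ℝ → ℕ → ℝ → ℝ}
    (hw : IsImpulsiveControl h D.N μ w) {i : ℕ} (hi : i ∈ Finset.Icc 1 D.N) {r : ℝ}
    (hr : r ∈ Icc 0 h) : (foldMeasure h μ w i).real {r} = ∫ s in (0 : ℝ)..1, w r i s := by
  have hnn : ∀ r ∈ Icc 0 h, 0 ≤ ∫ s in (0 : ℝ)..1, w r i s := fun r hr =>
    intervalIntegral.integral_nonneg zero_le_one fun s hs => hw.nonneg r hr i hi s hs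
  rw [measureReal_def, foldMeasure_apply (measurableSet_singleton r)]
  rcases hr.1.eq_or_lt with rfl | h0
  · have e1 : (· - ((i : ℝ) - 1) * h) ⁻¹' {0}
        ∩ Ioo (((i : ℝ) - 1) * h) (((i : ℝ) - 1) * h + h) = ∅ := by
      ext s
      simp only [mem_inter_iff, mem_preimage, mem_singleton_iff, mem_Ioo, mem_empty_iff_false,
        iff_false, not_and]
      intro hs hs'
      linarith
    rw [e1, measure_empty, indicator_of_mem (mem_singleton 0),
      indicator_of_notMem (by simpa using hh.ne'), Pi.one_apply, mul_one, mul_zero, add_zero,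
      add_zero, ENNReal.toReal_ofReal (hnn 0 hr)]
  rcases hr.2.eq_or_lt with rfl | h1
  · have e1 : (· - ((i : ℝ) - 1) * r) ⁻¹' {r}
        ∩ Ioo (((i : ℝ) - 1) * r) (((i : ℝ) - 1) * r + r) = ∅ := by
      ext s
      simp only [mem_inter_iff, mem_preimage, mem_singleton_iff, mem_Ioo, mem_empty_iff_false,
        iff_false, not_and]
      intro hs _
      linarith
    rw [e1, measure_empty, indicator_of_mem (mem_singleton r),
      indicator_of_notMem (by simpa using hh.ne), Pi.one_apply, mul_one, mul_zero, add_zero,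
      zero_add, ENNReal.toReal_ofReal (hnn r hr)]
  · have e1 : (· - ((i : ℝ) - 1) * h) ⁻¹' {r}
        ∩ Ioo (((i : ℝ) - 1) * h) (((i : ℝ) - 1) * h + h) = {r + ((i : ℝ) - 1) * h} := by
      ext s
      simp only [mem_inter_iff, mem_preimage, mem_singleton_iff, mem_Ioo]
      constructor
      · rintro ⟨hs, -⟩
        linarith
      · rintro rfl
        refine ⟨by ring, by linarith, by linarith⟩
    rw [e1, indicator_of_notMem (by simpa using h0.ne), indicator_of_notMem (by simpa using h1.ne'),
      mul_zero, mul_zero, add_zero, zero_add, hw.atom_interior r ⟨h0, h1⟩ i hi, measureReal_def]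

lemma IsImpulsiveControl.intervalIntegrable {h : ℝ} {N : ℕ} {μ : Measure ℝ} {w : ℝ → ℕ → ℝ → ℝ}
    (hw : IsImpulsiveControl h N μ w) {r : ℝ} (hr : r ∈ Icc 0 h) {i : ℕ}
    (hi : i ∈ Finset.Icc 1 N) : IntervalIntegrable (w r i) volume 0 1 := by
  rw [intervalIntegrable_iff_integrableOn_Icc_of_le zero_le_one]
  refine Integrable.of_bound (hw.measurable r hr i hi).aestronglyMeasurable
    (∑ i ∈ Finset.Icc 1 N, ∫ s' in (0 : ℝ)..1, w r i s') ?_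
  filter_upwards [hw.sum_eq r hr, ae_restrict_mem measurableSet_Icc] with s hs hs1
  rw [Real.norm_of_nonneg (hw.nonneg r hr i hi s hs1), ← hs]
  exact Finset.single_le_sum (f := fun i => w r i s) (fun j hj => hw.nonneg r hr j hj s hs1) hi

lemma foldMeasure_real_univ {h : ℝ} {N : ℕ} (hh : 0 ≤ h) {μ : Measure ℝ} {w : ℝ → ℕ → ℝ → ℝ}
    (hw : IsImpulsiveControl h N μ w) {i : ℕ} (hi : i ∈ Finset.Icc 1 N) :
    (foldMeasure h μ w i).real univ = (∫ s in (0 : ℝ)..1, w 0 i s)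
      + μ.real (Ioo (((i : ℝ) - 1) * h) (((i : ℝ) - 1) * h + h))
      + ∫ s in (0 : ℝ)..1, w h i s := by
  have := hw.finite
  have hnn : ∀ r ∈ Icc 0 h, 0 ≤ ∫ s in (0 : ℝ)..1, w r i s := fun r hr =>
    intervalIntegral.integral_nonneg zero_le_one fun s hs => hw.nonneg r hr i hi s hs
  rw [measureReal_def, foldMeasure_apply MeasurableSet.univ]
  simp only [preimage_univ, univ_inter, indicator_univ, Pi.one_apply, mul_one]
  rw [ENNReal.toReal_add (by finiteness) (by finiteness),
    ENNReal.toReal_add (by finiteness) (by finiteness),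
    ENNReal.toReal_ofReal (hnn 0 ⟨le_rfl, hh⟩), ENNReal.toReal_ofReal (hnn h ⟨hh, le_rfl⟩)]
  rfl

lemma sum_foldMeasure_le {h : ℝ} {N : ℕ} (hh : 0 < h) (hN : 0 < N) {μ : Measure ℝ}
    {w : ℝ → ℕ → ℝ → ℝ} (hw : IsImpulsiveControl h N μ w) :
    ∑ i ∈ Finset.Icc 1 N, (foldMeasure h μ w i).real univ ≤ μ.real univ := by
  have := hw.finite
  have hz : (0 : ℝ) ∈ Icc 0 h := ⟨le_rfl, hh.le⟩
  have he : h ∈ Icc 0 h := ⟨hh.le, le_rfl⟩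
  have key : ∀ k ≤ N, ∑ i ∈ Finset.Icc 1 k, (foldMeasure h μ w i).real univ
      + (if k = N then 0 else ∫ s in (0 : ℝ)..1, w 0 (k + 1) s) = μ.real (Icc 0 (k * h)) := by
    intro k
    induction k with
    | zero =>
      intro _
      have h1 := hw.atom_node 0 (Finset.mem_Icc.2 ⟨le_rfl, Nat.zero_le _⟩)
      rw [if_neg hN.ne]
      simp only [if_true, if_neg hN.ne, zero_add] at h1
      simp only [Nat.cast_zero, zero_mul, Icc_self] at h1 ⊢
      rw [zero_add, h1]
      simp
    | succ k ih =>
      intro hk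
      have ih' := ih (by omega)
      have hk1 : k + 1 ∈ Finset.Icc 1 N := Finset.mem_Icc.2 ⟨by omega, hk⟩
      rw [if_neg (by omega)] at ih'
      rw [Finset.sum_Icc_succ_top (by omega), foldMeasure_real_univ hh.le hw hk1]
      have h1 := hw.atom_node (k + 1) (Finset.mem_Icc.2 ⟨by omega, hk⟩)
      have h2 : ∫ s in (0 : ℝ)..1, ((if k + 1 = 0 then 0 else w h (k + 1) s)
          + (if k + 1 = N then 0 else w 0 (k + 1 + 1) s)) = (∫ s in (0 : ℝ)..1, w h (k + 1) s)
          + (if k + 1 = N then 0 else ∫ s in (0 : ℝ)..1, w 0 (k + 1 + 1) s) := by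
        simp only [if_neg (Nat.succ_ne_zero k)]
        split_ifs with hkN
        · simp
        · exact intervalIntegral.integral_add (hw.intervalIntegrable he hk1)
            (hw.intervalIntegrable hz (Finset.mem_Icc.2 ⟨by omega, by omega⟩))
      rw [h2] at h1
      have hle : (k : ℝ) * h < ((k + 1 : ℕ) : ℝ) * h := by push_cast; nlinarith
      have h3 : Icc 0 (((k + 1 : ℕ) : ℝ) * h) = Icc 0 ((k : ℝ) * h)
          ∪ (Ioo ((k : ℝ) * h) (((k + 1 : ℕ) : ℝ) * h) ∪ {((k + 1 : ℕ) : ℝ) * h}) := by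
        rw [Ioo_union_right hle, Icc_union_Ioc_eq_Icc (by positivity) hle.le]
      have h4 : (((k + 1 : ℕ) : ℝ) - 1) * h = (k : ℝ) * h := by push_cast; ring
      have h5 : (k : ℝ) * h + h = ((k + 1 : ℕ) : ℝ) * h := by push_cast; ring
      rw [h3, measureReal_union, measureReal_union, ← ih', ← h1, h4, h5]
      · ring
      · simp
      · exact measurableSet_singleton _
      · rw [Ioo_union_right hle]
        exact Set.disjoint_left.2 fun s hs hs' => absurd hs.2 (not_le.2 hs'.1)
      · exact measurableSet_Ioo.union (measurableSet_singleton _)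
  have h1 := key N le_rfl
  rw [if_pos rfl, add_zero] at h1
  rw [h1]
  exact measureReal_mono (subset_univ _)

/-- Every extended process folds to a process on `[0, h]`. -/
lemma exists_isFolded_of_isExtendedProcess (hf : Continuous D.f) (hg : Continuous D.g)
    (hf_bdd : ∃ M : ℝ, ∀ z, ‖D.f z‖ ≤ M) (hg_bdd : ∃ M : ℝ, ∀ z, ‖D.g z‖ ≤ M)
    (hh : 0 < D.h) (hN : 0 < D.N) (hp : IsExtendedProcess D p) :
    ∃ m w ζ, IsFolded D m w ζ ∧ ζ D.h D.N 1 = p.x D.T ∧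
      ∑ i ∈ Finset.Icc 1 D.N, (m i).real univ ≤ p.μ.real univ := by
  obtain ⟨M₁, hM₁⟩ := hf_bdd
  obtain ⟨M₂, hM₂⟩ := hg_bdd
  obtain ⟨hw, hbv, hneg, hx0, ζ, hζ, hnode, hdyn, hend⟩ := hp
  have := hw.finite
  have hi0 : ∀ i ∈ Finset.Icc 1 D.N, (0 : ℝ) ≤ ((i : ℝ) - 1) * D.h := by
    intro i hi
    have : (1 : ℝ) ≤ i := by exact_mod_cast (Finset.mem_Icc.1 hi).1
    exact mul_nonneg (by linarith) hh.le
  have hiT : ∀ i ∈ Finset.Icc 1 D.N, ((i : ℝ) - 1) * D.h + D.h ≤ D.T := by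
    intro i hi
    have : (i : ℝ) ≤ D.N := by exact_mod_cast (Finset.mem_Icc.1 hi).2
    rw [System.T]
    nlinarith
  have hleft : ∀ i ∈ Finset.Icc 1 D.N, ∀ r ∈ Ioc 0 D.h,
      Tendsto (fun ρ => p.x (ρ + ((i : ℝ) - 1) * D.h)) (𝓝[<] r) (𝓝 (ζ r i 0)) := by
    intro i hi r hr
    rw [hζ.init_pos r hr i hi]
    have h1 := hi0 i hi
    have h2 := hiT i hi
    exact (tendsto_leftLim_of_boundedVariationOn hbv
      ⟨by linarith [hr.1], by linarith [hr.2]⟩).comp (tendsto_add_left _ r)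
  have hdyn' : ∀ i ∈ Finset.Icc 1 D.N, ∀ τ ∈ Ioo 0 D.h,
      Summable (fun r : Ioc 0 τ => ζ r i 1 - ζ r i 0) ∧
      p.x (((i : ℝ) - 1) * D.h + τ) = ζ 0 i 1
        + (∫ t' in (((i : ℝ) - 1) * D.h)..(((i : ℝ) - 1) * D.h + τ),
            D.f (p.x t', p.x (t' - D.h)))
        + (∫ t' in Icc (((i : ℝ) - 1) * D.h) (((i : ℝ) - 1) * D.h + τ),
            D.g (p.x t', p.x (t' - D.h)) ∂(contPart p.μ))
        + ∑' r : Ioc 0 τ, (ζ r i 1 - ζ r i 0) := by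
    intro i hi τ hτ
    have h1 := hdyn i hi (((i : ℝ) - 1) * D.h + τ) ⟨by linarith [hτ.1], by linarith [hτ.2]⟩
    rw [add_sub_cancel_left] at h1
    have h2 : (fun r : Ioc 0 τ => ζ r i 1 - ζ r i 0)
        = fun r : Ioc 0 τ => ζ r i 1 - Function.leftLim p.x (r + ((i : ℝ) - 1) * D.h) :=
      funext fun r => by rw [hζ.init_pos r ⟨r.2.1, r.2.2.trans hτ.2.le⟩ i hi]
    rw [h2]
    exact h1
  have hxm : ∀ ν : Measure ℝ, AEStronglyMeasurable (fun t => (p.x t, p.x (t - D.h)))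
      (ν.restrict (Icc 0 D.T)) := by
    intro ν
    have h1 : BoundedVariationOn p.x (Icc 0 D.T) := hbv.mono (Icc_subset_Icc_left (by linarith))
    have h2 : BoundedVariationOn (fun t => p.x (t - D.h)) (Icc 0 D.T) := by
      refine ne_top_of_le_ne_top hbv (eVariationOn.comp_le_of_monotoneOn p.x (fun t => t - D.h)
        (fun a _ b _ hab => sub_le_sub_right hab _) fun t ht => ?_)
      exact ⟨by linarith [ht.1], by linarith [ht.2]⟩
    exact (aestronglyMeasurable_of_boundedVariationOn measurableSet_Icc h1 ν).prodMk
      (aestronglyMeasurable_of_boundedVariationOn measurableSet_Icc h2 ν)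
  have hintegrable : ∀ (F : EuclideanSpace ℝ (Fin n) × EuclideanSpace ℝ (Fin n) →
      EuclideanSpace ℝ (Fin n)) (M : ℝ), Continuous F → (∀ z, ‖F z‖ ≤ M) →
      ∀ (ν : Measure ℝ) [IsLocallyFiniteMeasure ν] (a b : ℝ), 0 ≤ a → b ≤ D.T →
      IntegrableOn (fun t => F (p.x t, p.x (t - D.h))) (Icc a b) ν := by
    intro F M hF hM ν _ a b ha hb
    have : IsFiniteMeasure (ν.restrict (Icc a b)) := ⟨by simpa using measure_Icc_lt_top⟩
    refine Integrable.of_bound ?_ M (Eventually.of_forall fun _ => hM _)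
    exact (hF.comp_aestronglyMeasurable (hxm ν)).mono_measure
      (Measure.restrict_mono (Icc_subset_Icc ha hb) le_rfl)
  have hstate : ∀ i ∈ Finset.Icc 1 D.N, ∀ r ∈ Ioo 0 D.h,
      p.x (r + ((i : ℝ) - 1) * D.h) = ζ r i 1 := by
    intro i hi r hr
    set a := ((i : ℝ) - 1) * D.h with ha
    have ha0 : 0 ≤ a := hi0 i hi
    have harT : a + r ≤ D.T := by linarith [hiT i hi, hr.2]
    have hshift : Tendsto (fun τ => a + τ) (𝓝[<] r) (𝓝[<] (a + r)) := by
      simpa only [add_comm] using tendsto_add_left a r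
    have t1 : Tendsto (fun τ => ∫ t' in a..(a + τ), D.f (p.x t', p.x (t' - D.h))) (𝓝[<] r)
        (𝓝 (∫ t' in a..(a + r), D.f (p.x t', p.x (t' - D.h)))) := by
      have h1 := (tendsto_setIntegral_Icc_left (ν := volume) (a := a) (b := a + r)
        Real.volume_singleton (hintegrable D.f M₁ hf hM₁ volume a (a + r) ha0 harT)).comp hshift
      rw [intervalIntegral.integral_of_le (by linarith [hr.1]), ← integral_Icc_eq_integral_Ioc]
      refine h1.congr' ?_
      filter_upwards [Ioo_mem_nhdsLT hr.1] with τ hτ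
      rw [intervalIntegral.integral_of_le (by linarith [hτ.1]), ← integral_Icc_eq_integral_Ioc]
      rfl
    have t2 : Tendsto (fun τ => ∫ t' in Icc a (a + τ), D.g (p.x t', p.x (t' - D.h))
        ∂(contPart p.μ)) (𝓝[<] r)
        (𝓝 (∫ t' in Icc a (a + r), D.g (p.x t', p.x (t' - D.h)) ∂(contPart p.μ))) :=
      (tendsto_setIntegral_Icc_left (contPart_singleton p.μ _)
        (hintegrable D.g M₂ hg hM₂ (contPart p.μ) a (a + r) ha0 harT)).comp hshift
    have t3 := tendsto_tsum_Ioc_left hr.1 (j := fun s => ζ s i 1 - ζ s i 0) (hdyn' i hi r hr).1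
    have t4 := ((tendsto_const_nhds (x := ζ 0 i 1)).add t1).add t2 |>.add t3
    have t5 := hleft i hi r (Ioo_subset_Ioc_self hr)
    have t6 := t4.congr' (f₂ := fun ρ => p.x (ρ + a)) (by
      filter_upwards [Ioo_mem_nhdsLT hr.1] with τ hτ
      rw [add_comm τ a, (hdyn' i hi τ ⟨hτ.1, hτ.2.trans hr.2⟩).2])
    have h7 := tendsto_nhds_unique t5 t6
    have h8 := (hdyn' i hi r hr).2
    rw [← add_sub_assoc, ← h8] at h7
    rw [add_comm r a, eq_comm, ← sub_eq_zero, ← sub_eq_zero.2 h7]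
    abel
  set ζ' : ℝ → ℕ → ℝ → EuclideanSpace ℝ (Fin n) := fun r i s => if i = 0 then D.ξ₀ else ζ r i s
    with hζ'
  have hζ'pos : ∀ i ∈ Finset.Icc 1 D.N, ∀ r s, ζ' r i s = ζ r i s := fun i hi r s =>
    if_neg (by have := (Finset.mem_Icc.1 hi).1; omega)
  have hprev : ∀ i ∈ Finset.Icc 1 D.N, ∀ ρ ∈ Ioo 0 D.h,
      p.x (ρ + ((i : ℝ) - 1) * D.h - D.h) = ζ' ρ (i - 1) 1 := by
    intro i hi ρ hρ
    have hi' := Finset.mem_Icc.1 hi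
    rcases hi'.1.eq_or_lt with rfl | hlt
    · have e : ζ' ρ (1 - 1) 1 = D.ξ₀ := if_pos rfl
      rw [e]
      exact hneg _ ⟨by simp [hρ.1.le], by simp [hρ.2]⟩
    · have h1 : i - 1 ∈ Finset.Icc 1 D.N := Finset.mem_Icc.2 ⟨by omega, by omega⟩
      rw [hζ'pos _ h1, ← hstate (i - 1) h1 ρ hρ]
      congr 1
      rw [Nat.cast_sub hi'.1, Nat.cast_one]
      ring
  refine ⟨foldMeasure D.h p.μ p.w, p.w, ζ', ⟨fun i => inferInstance, ?_, hw.measurable, hw.nonneg,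
    hw.sum_eq, ?_, fun r s => if_pos rfl, ?_, ?_, ?_, ?_, ?_, ?_, ?_⟩, ?_,
    sum_foldMeasure_le hh hN hw⟩
  · intro i
    rw [foldMeasure_apply measurableSet_Icc.compl,
      indicator_of_notMem (show (0 : ℝ) ∉ (Icc 0 D.h)ᶜ from fun h => h ⟨le_rfl, hh.le⟩),
      indicator_of_notMem (show D.h ∉ (Icc 0 D.h)ᶜ from fun h => h ⟨hh.le, le_rfl⟩), mul_zero,
      mul_zero, zero_add, add_zero, ← measure_empty (μ := p.μ)]
    congr 1
    ext s
    simp only [mem_inter_iff, mem_preimage, mem_compl_iff, mem_Icc, mem_Ioo, mem_empty_iff_false,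
      iff_false, not_and]
    intro h1 h2 h3
    exact h1 (by linarith) (by linarith)
  · exact fun r hr i hi => (foldMeasure_real_singleton hh hw hi hr).symm
  · intro r hr i hi
    rw [show ζ' r i = ζ r i from funext fun s => hζ'pos i hi r s]
    exact hζ.absCont r hr i hi
  · intro r hr i hi
    filter_upwards [hζ.ode r hr i hi, ae_mem_Ioo] with s hs hs1
    rw [show ζ' r i = ζ r i from funext fun s => hζ'pos i hi r s]
    have : ζ' r (i - 1) s = ζ r (i - 1) s := by
      rcases Nat.eq_zero_or_pos (i - 1) with h0 | h0
      · rw [h0, hζ', hζ.zero_eq r hr s (Ioo_subset_Icc_self hs1) (Or.inl hs1.2)]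
        exact if_pos rfl
      · exact if_neg h0.ne'
    rw [this]
    exact hs
  · have h1 : 1 ∈ Finset.Icc 1 D.N := Finset.mem_Icc.2 ⟨le_rfl, hN⟩
    rw [hζ'pos 1 h1, hζ.init_zero 1 h1, Nat.sub_self, hζ.zero_end]
  · intro i hi
    have hi' := Finset.mem_Icc.1 hi
    have h1 : i ∈ Finset.Icc 1 D.N := Finset.mem_Icc.2 ⟨by omega, hi'.2⟩
    rw [hζ'pos i h1, hζ'pos (i - 1) (Finset.mem_Icc.2 ⟨by omega, by omega⟩), hζ.init_zero i h1]
  · intro r hr i hi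
    simp only [hζ'pos i hi]
    refine (hleft i hi r hr).congr' ?_
    filter_upwards [Ioo_mem_nhdsLT hr.1] with ρ hρ
    exact hstate i hi ρ ⟨hρ.1, hρ.2.trans_le hr.2⟩
  · intro i hi
    have h1 : EqOn (fun ρ => ζ' ρ i 1) (p.x ∘ fun ρ => ρ + ((i : ℝ) - 1) * D.h) (Ioo 0 D.h) :=
      fun ρ hρ => by
        simp only [hζ'pos i hi, Function.comp]
        exact (hstate i hi ρ hρ).symm
    rw [BoundedVariationOn, eVariationOn.congr h1]
    refine ne_top_of_le_ne_top hbv (eVariationOn.comp_le_of_monotoneOn p.x _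
      (fun a _ b _ hab => add_le_add_left hab _) fun t ht => ?_)
    have h2 := hi0 i hi
    have h3 := hiT i hi
    exact ⟨by linarith [ht.1], by linarith [ht.2]⟩
  · intro i hi τ hτ
    have h1 := hdyn' i hi τ hτ
    have h2 : ∀ F : EuclideanSpace ℝ (Fin n) × EuclideanSpace ℝ (Fin n) →
        EuclideanSpace ℝ (Fin n), ∀ ρ ∈ Ioo 0 D.h,
        F (p.x (ρ + ((i : ℝ) - 1) * D.h), p.x (ρ + ((i : ℝ) - 1) * D.h - D.h))
          = F (ζ' ρ i 1, ζ' ρ (i - 1) 1) := fun F ρ hρ => by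
      rw [hprev i hi ρ hρ, hζ'pos i hi, hstate i hi ρ hρ]
    rw [intervalIntegral_shift_eq (φ := fun t => D.f (p.x t, p.x (t - D.h))) hτ.1.le hτ.2
      (h2 D.f), setIntegral_contPart_eq (φ := fun t => D.g (p.x t, p.x (t - D.h))) hτ.2
      (fun B hB hsub => foldMeasure_shift (w := p.w) hB hsub) (h2 D.g), add_comm _ τ,
      hstate i hi τ hτ] at h1
    simp only [hζ'pos i hi] at h1 ⊢
    exact h1
  · rw [hζ'pos D.N (Finset.mem_Icc.2 ⟨hN, le_rfl⟩), hend]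

end Fold

section Unfold

lemma BoundedVariationOn.Icc_of_Ioo {E : Type*} [NormedAddCommGroup E] {f : ℝ → E} {a b : ℝ}
    (hf : BoundedVariationOn f (Ioo a b)) : BoundedVariationOn f (Icc a b) := by
  rcases le_or_gt b a with hab | hab
  · have h1 : (Icc a b).Subsingleton := fun s hs t ht =>
      le_antisymm (by linarith [hs.2, ht.1]) (by linarith [hs.1, ht.2])
    rw [BoundedVariationOn, eVariationOn.subsingleton f h1]
    exact ENNReal.zero_ne_top
  obtain ⟨c, hc⟩ := exists_between hab
  have hc' : c ∈ Ioo a b := hc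
  set S := Ioo a b with hS
  have hloc := hf.locallyBoundedVariationOn
  set C := (eVariationOn f S).toReal with hC
  have hC0 : 0 ≤ C := ENNReal.toReal_nonneg
  set U := variationOnFromTo f S c with hU
  have hle : ∀ s t, (eVariationOn f (S ∩ Icc s t)).toReal ≤ C := fun s t =>
    ENNReal.toReal_mono hf (eVariationOn.mono f inter_subset_left)
  have hUC : ∀ t, |U t| ≤ C := by
    intro t
    rw [hU, variationOnFromTo]
    split_ifs
    · rw [abs_of_nonneg ENNReal.toReal_nonneg]
      exact hle _ _
    · rw [abs_neg, abs_of_nonneg ENNReal.toReal_nonneg]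
      exact hle _ _
  have hUf : ∀ s ∈ S, ∀ t ∈ S, s ≤ t → ‖f t - f s‖ ≤ U t - U s := by
    intro s hs t ht hst
    have h1 := variationOnFromTo.add hloc hc' hs ht
    have h2 := variationOnFromTo.eq_of_le f S hst
    have h3 : U t - U s = (eVariationOn f (S ∩ Icc s t)).toReal := by
      rw [← h2, hU, ← h1]
      ring
    rw [h3, ← dist_eq_norm, dist_edist]
    exact ENNReal.toReal_mono (hloc s t hs ht)
      (eVariationOn.edist_le f ⟨ht, hst, le_rfl⟩ ⟨hs, le_rfl, hst⟩)
  set R := ‖f c‖ + C + ‖f a‖ + ‖f b‖ with hR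
  have hRc : ∀ t ∈ Icc a b, ‖f t‖ ≤ R := by
    intro t ht
    have n1 := norm_nonneg (f a)
    have n2 := norm_nonneg (f b)
    have n3 := norm_nonneg (f c)
    rcases ht.1.eq_or_lt with rfl | h1
    · linarith
    rcases ht.2.eq_or_lt with rfl | h2
    · linarith
    have h3 : dist (f t) (f c) ≤ C := by
      rw [dist_edist]
      exact ENNReal.toReal_mono hf (eVariationOn.edist_le f ⟨h1, h2⟩ hc')
    rw [dist_eq_norm] at h3
    have h4 := norm_le_norm_add_norm_sub (f c) (f t)
    rw [norm_sub_rev] at h4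
    linarith
  have hR0 : 0 ≤ R := (norm_nonneg _).trans (hRc a ⟨le_rfl, hab.le⟩)
  set V : ℝ → ℝ := fun t => if t ≤ a then -(C + 2 * R) else if b ≤ t then C + 2 * R else U t
    with hV
  have hVa : ∀ t, t ≤ a → V t = -(C + 2 * R) := fun t ht => if_pos ht
  have hVb : ∀ t, b ≤ t → V t = C + 2 * R := fun t ht => by
    rw [hV]
    simp only
    rw [if_neg (by linarith), if_pos ht]
  have hVU : ∀ t ∈ Ioo a b, V t = U t := fun t ht => by
    rw [hV]
    simp only
    rw [if_neg (not_le.2 ht.1), if_neg (not_le.2 ht.2)]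
  have hVC : ∀ t, |V t| ≤ C + 2 * R := by
    intro t
    rcases le_or_gt t a with h1 | h1
    · rw [hVa t h1, abs_neg, abs_of_nonneg (by linarith)]
    rcases le_or_gt b t with h2 | h2
    · rw [hVb t h2, abs_of_nonneg (by linarith)]
    · rw [hVU t ⟨h1, h2⟩]
      linarith [hUC t]
  have hinc : ∀ t ∈ Icc a b, ∀ t' ∈ Icc a b, t ≤ t' → ‖f t' - f t‖ ≤ V t' - V t := by
    intro t ht t' ht' htt
    rcases htt.eq_or_lt with rfl | hlt
    · simp
    have h1 : ‖f t' - f t‖ ≤ 2 * R := by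
      linarith [norm_sub_le (f t') (f t), hRc t ht, hRc t' ht']
    rcases ht.1.eq_or_lt with rfl | h2
    · rw [hVa a le_rfl]
      rcases ht'.2.eq_or_lt with rfl | h3
      · rw [hVb _ le_rfl]
        linarith
      · rw [hVU t' ⟨hlt, h3⟩]
        linarith [neg_le_of_abs_le (hUC t')]
    · rw [hVU t ⟨h2, hlt.trans_le ht'.2⟩]
      rcases ht'.2.eq_or_lt with rfl | h3
      · rw [hVb _ le_rfl]
        linarith [le_of_abs_le (hUC t)]
      · rw [hVU t' ⟨h2.trans hlt, h3⟩]
        exact hUf t ⟨h2, hlt.trans h3⟩ t' ⟨h2.trans hlt, h3⟩ htt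
  exact boundedVariationOn_of_dominated
    (fun t ht t' ht' htt => sub_nonneg.1 ((norm_nonneg _).trans (hinc t ht t' ht' htt)))
    (fun t _ => hVC t) hinc

lemma boundedVariationOn_Icc_of_nodes {E : Type*} [NormedAddCommGroup E] {x : ℝ → E} {h : ℝ}
    (hh : 0 ≤ h) (a : ℝ) (N : ℕ)
    (H : ∀ k < N, BoundedVariationOn x (Ioo (a + k * h) (a + k * h + h))) :
    BoundedVariationOn x (Icc a (a + N * h)) := by
  induction N with
  | zero =>
    rw [Nat.cast_zero, zero_mul, add_zero, Icc_self, BoundedVariationOn,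
      eVariationOn.subsingleton x subsingleton_singleton]
    exact ENNReal.zero_ne_top
  | succ N ih =>
    have h1 := ih fun k hk => H k (hk.trans (Nat.lt_succ_self N))
    have h2 := BoundedVariationOn.Icc_of_Ioo (H N (Nat.lt_succ_self N))
    have h3 : a + ((N + 1 : ℕ) : ℝ) * h = a + N * h + h := by push_cast; ring
    have h4 : a ≤ a + N * h := le_add_of_nonneg_right (by positivity)
    have h5 := eVariationOn.Icc_add_Icc x (s := univ) h4 (le_add_of_nonneg_right hh)
      (mem_univ (a + N * h))
    simp only [univ_inter] at h5
    rw [BoundedVariationOn, h3, ← h5]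
    exact ENNReal.add_ne_top.2 ⟨h1, h2⟩

variable {D : System n} {m : ℕ → Measure ℝ} {w : ℝ → ℕ → ℝ → ℝ}
  {ζ : ℝ → ℕ → ℝ → EuclideanSpace ℝ (Fin n)}

/-- The measure on `[0, N h]` whose parts on the delay intervals are the translates of the `m i`. -/
noncomputable def unfoldMeasure (h : ℝ) (N : ℕ) (m : ℕ → Measure ℝ) : Measure ℝ :=
  ∑ i ∈ Finset.Icc 1 N, (m i).map (· + ((i : ℝ) - 1) * h)

lemma unfoldMeasure_apply {h : ℝ} {N : ℕ} {B : Set ℝ} (hB : MeasurableSet B) :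
    unfoldMeasure h N m B = ∑ i ∈ Finset.Icc 1 N, m i ((· + ((i : ℝ) - 1) * h) ⁻¹' B) := by
  rw [unfoldMeasure, Measure.finsetSum_apply]
  exact Finset.sum_congr rfl fun i _ => Measure.map_apply (measurable_add_const _) hB

lemma add_node_notMem_Ioo {h s : ℝ} (hs : s ∈ Icc 0 h) {i j : ℕ} (hij : j ≠ i) :
    s + ((j : ℝ) - 1) * h ∉ Ioo (((i : ℝ) - 1) * h) (((i : ℝ) - 1) * h + h) := by
  rintro ⟨h1, h2⟩
  have hh : 0 ≤ h := hs.1.trans hs.2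
  rcases lt_or_gt_of_ne hij with hlt | hgt
  · have h3 : (j : ℝ) + 1 ≤ i := by exact_mod_cast hlt
    nlinarith [hs.2]
  · have h3 : (i : ℝ) + 1 ≤ j := by exact_mod_cast hgt
    nlinarith [hs.1]

lemma unfoldMeasure_shift {h : ℝ} {N : ℕ} (hm : ∀ i, m i (Icc 0 h)ᶜ = 0) {i : ℕ}
    (hi : i ∈ Finset.Icc 1 N) {B : Set ℝ} (hB : MeasurableSet B)
    (hsub : B ⊆ Ioo (((i : ℝ) - 1) * h) (((i : ℝ) - 1) * h + h)) :
    unfoldMeasure h N m B = m i ((· + ((i : ℝ) - 1) * h) ⁻¹' B) := by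
  rw [unfoldMeasure_apply hB]
  refine Finset.sum_eq_single_of_mem i hi fun j _ hj => measure_mono_null ?_ (hm j)
  exact fun s hs hs' => add_node_notMem_Ioo hs' hj (hsub hs)

lemma unfoldMeasure_real_node {h : ℝ} (hh : 0 < h) {N : ℕ} [∀ i, IsFiniteMeasure (m i)]
    (hm : ∀ i, m i (Icc 0 h)ᶜ = 0) {i : ℕ} (hi : i ≤ N) :
    (unfoldMeasure h N m).real {(i : ℝ) * h}
      = (if i = 0 then 0 else (m i).real {h}) + (if i = N then 0 else (m (i + 1)).real {0}) := by
  have key : ∀ j ∈ Finset.Icc 1 N, (m j ((· + ((j : ℝ) - 1) * h) ⁻¹' {(i : ℝ) * h})).toReal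
      = (if j = i then (m j).real {h} else 0) + (if j = i + 1 then (m j).real {0} else 0) := by
    intro j _
    have e : (· + ((j : ℝ) - 1) * h) ⁻¹' {(i : ℝ) * h} = {((i : ℝ) - j + 1) * h} := by
      ext s
      simp only [mem_preimage, mem_singleton_iff]
      constructor <;> intro hs <;> linarith
    rw [e]
    rcases eq_or_ne j i with rfl | h1
    · simp [measureReal_def]
    rcases eq_or_ne j (i + 1) with rfl | h2
    · simp [measureReal_def]
    rw [if_neg h1, if_neg h2, add_zero, measure_mono_null _ (hm j), ENNReal.toReal_zero]
    rintro s rfl ⟨h3, h4⟩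
    rcases lt_or_gt_of_ne h1 with hlt | hgt
    · have h5 : (j : ℝ) + 1 ≤ i := by exact_mod_cast hlt
      nlinarith
    · have h5 : (i : ℝ) + 1 + 1 ≤ j := by exact_mod_cast (show i + 1 + 1 ≤ j by omega)
      nlinarith
  rw [measureReal_def, unfoldMeasure_apply (measurableSet_singleton _),
    ENNReal.toReal_sum fun j _ => measure_ne_top _ _, Finset.sum_congr rfl key,
    Finset.sum_add_distrib, Finset.sum_ite_eq', Finset.sum_ite_eq']
  congr 1
  · by_cases h0 : i = 0
    · rw [if_pos h0, if_neg (by simp [h0])]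
    · rw [if_neg h0, if_pos (Finset.mem_Icc.2 ⟨by omega, hi⟩)]
  · by_cases h0 : i = N
    · rw [if_pos h0, if_neg (by simp [h0])]
    · rw [if_neg h0, if_pos (Finset.mem_Icc.2 ⟨by omega, by omega⟩)]

/-- The trajectory on `[-h, N h]` of a folded process. -/
noncomputable def unfoldState (D : System n) (ζ : ℝ → ℕ → ℝ → EuclideanSpace ℝ (Fin n)) (t : ℝ) :
    EuclideanSpace ℝ (Fin n) :=
  if t < 0 then D.ξ₀ else if t = 0 then D.x₀ else if D.T ≤ t then ζ D.h D.N 1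
    else ζ (t - ⌊t / D.h⌋₊ * D.h) (⌊t / D.h⌋₊ + 1) 1

lemma unfoldState_end (hh : 0 < D.h) (hN : 0 < D.N) : unfoldState D ζ D.T = ζ D.h D.N 1 := by
  have hT : 0 < D.T := mul_pos (by exact_mod_cast hN) hh
  rw [unfoldState, if_neg hT.le.not_gt, if_neg hT.ne', if_pos le_rfl]

lemma unfoldState_add_node (hh : 0 < D.h) {i : ℕ} (hi : i ∈ Finset.Icc 1 D.N) {r : ℝ}
    (hr : r ∈ Ico 0 D.h) (h0 : i ≠ 1 ∨ 0 < r) :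
    unfoldState D ζ (r + ((i : ℝ) - 1) * D.h) = ζ r i 1 := by
  obtain ⟨hi1, hiN⟩ := Finset.mem_Icc.1 hi
  obtain ⟨k, rfl⟩ : ∃ k, i = k + 1 := ⟨i - 1, by omega⟩
  have hk : (((k + 1 : ℕ) : ℝ) - 1) = k := by push_cast; ring
  rw [hk]
  have hpos : 0 < r + k * D.h := by
    rcases h0 with h0 | h0
    · have : (0 : ℝ) < k := by exact_mod_cast (show 0 < k by omega)
      exact add_pos_of_nonneg_of_pos hr.1 (mul_pos this hh)
    · exact add_pos_of_pos_of_nonneg h0 (by positivity)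
  have hT : r + k * D.h < D.T := by
    have : (k : ℝ) + 1 ≤ D.N := by exact_mod_cast hiN
    rw [System.T]
    nlinarith [hr.2]
  have hfl : ⌊(r + k * D.h) / D.h⌋₊ = k := by
    rw [Nat.floor_eq_iff (by positivity), le_div_iff₀ hh, div_lt_iff₀ hh]
    constructor <;> nlinarith [hr.1, hr.2]
  rw [unfoldState, if_neg hpos.le.not_gt, if_neg hpos.ne', if_neg hT.not_ge, hfl,
    add_sub_cancel_right]

lemma unfoldState_delay (hh : 0 < D.h) (hζ : ∀ r s, ζ r 0 s = D.ξ₀) {i : ℕ}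
    (hi : i ∈ Finset.Icc 1 D.N) {ρ : ℝ} (hρ : ρ ∈ Ioo 0 D.h) :
    unfoldState D ζ (ρ + ((i : ℝ) - 1) * D.h - D.h) = ζ ρ (i - 1) 1 := by
  obtain ⟨hi1, hiN⟩ := Finset.mem_Icc.1 hi
  rcases hi1.eq_or_lt with rfl | hlt
  · rw [Nat.sub_self, hζ, unfoldState, if_pos]
    simpa using hρ.2
  · rw [← unfoldState_add_node (ζ := ζ) hh (i := i - 1) (Finset.mem_Icc.2 ⟨by omega, by omega⟩)
      (Ioo_subset_Ico_self hρ) (Or.inr hρ.1), Nat.cast_sub hi1, Nat.cast_one]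
    congr 1
    ring

lemma leftLim_unfoldState (hh : 0 < D.h) (hF : IsFolded D m w ζ) {i : ℕ}
    (hi : i ∈ Finset.Icc 1 D.N) {r : ℝ} (hr : r ∈ Ioc 0 D.h) :
    Function.leftLim (unfoldState D ζ) (r + ((i : ℝ) - 1) * D.h) = ζ r i 0 := by
  set a := ((i : ℝ) - 1) * D.h with ha
  have h1 := tendsto_add_left (-a) (r + a)
  rw [add_neg_cancel_right] at h1
  refine leftLim_eq_of_tendsto (((hF.left r hr i hi).comp h1).congr' ?_)
  filter_upwards [Ioo_mem_nhdsLT (show a < r + a by linarith [hr.1])] with t ht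
  have h2 := unfoldState_add_node (ζ := ζ) hh hi (r := t + -a)
    ⟨by linarith [ht.1], by linarith [ht.2, hr.2]⟩ (Or.inr (by linarith [ht.1]))
  rw [← ha, neg_add_cancel_right] at h2
  exact h2.symm

lemma boundedVariationOn_unfoldState (hh : 0 < D.h) (hF : IsFolded D m w ζ) :
    BoundedVariationOn (unfoldState D ζ) (Icc (-D.h) D.T) := by
  have h1 : D.T = -D.h + ((D.N + 1 : ℕ) : ℝ) * D.h := by rw [System.T]; push_cast; ring
  rw [h1]
  refine boundedVariationOn_Icc_of_nodes hh.le _ _ fun k hk => ?_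
  rcases Nat.eq_zero_or_pos k with rfl | hk0
  · have h2 : EqOn (unfoldState D ζ) (fun _ => D.ξ₀)
        (Ioo (-D.h + ((0 : ℕ) : ℝ) * D.h) (-D.h + ((0 : ℕ) : ℝ) * D.h + D.h)) := fun t ht =>
      if_pos (by simpa using ht.2)
    rw [BoundedVariationOn, eVariationOn.congr h2,
      eVariationOn.constant_on (subsingleton_singleton.anti (image_subset_iff.2 fun _ _ => rfl))]
    exact ENNReal.zero_ne_top
  · have hi : k ∈ Finset.Icc 1 D.N := Finset.mem_Icc.2 ⟨hk0, by omega⟩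
    have e : -D.h + (k : ℝ) * D.h = ((k : ℝ) - 1) * D.h := by ring
    rw [e]
    set a := ((k : ℝ) - 1) * D.h with ha
    have h2 : EqOn (unfoldState D ζ) ((fun ρ => ζ ρ k 1) ∘ (· - a)) (Ioo a (a + D.h)) := by
      intro t ht
      have h3 := unfoldState_add_node (ζ := ζ) hh hi (r := t - a)
        ⟨by linarith [ht.1], by linarith [ht.2]⟩ (Or.inr (by linarith [ht.1]))
      rwa [← ha, sub_add_cancel] at h3
    rw [BoundedVariationOn, eVariationOn.congr h2]
    exact ne_top_of_le_ne_top (hF.bv k hi) (eVariationOn.comp_le_of_monotoneOn _ _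
      (fun s _ t _ hst => sub_le_sub_right hst _)
      fun t ht => ⟨by linarith [ht.1], by linarith [ht.2]⟩)

lemma isImpulsiveControl_unfoldMeasure (hh : 0 < D.h) (hF : IsFolded D m w ζ) :
    IsImpulsiveControl D.h D.N (unfoldMeasure D.h D.N m) w := by
  have := hF.finite
  have hint : ∀ r ∈ Icc 0 D.h, ∀ i ∈ Finset.Icc 1 D.N, IntervalIntegrable (w r i) volume 0 1 :=
    fun r hr i hi => hF.intervalIntegrable_w hr hi (by simp) (by simp)
  have hz : (0 : ℝ) ∈ Icc 0 D.h := ⟨le_rfl, hh.le⟩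
  have he : D.h ∈ Icc 0 D.h := ⟨hh.le, le_rfl⟩
  refine ⟨?_, ?_, hF.measurable, hF.nonneg, hF.sum_eq, ?_, ?_⟩
  · rw [unfoldMeasure]
    infer_instance
  · rw [unfoldMeasure_apply measurableSet_Icc.compl]
    refine Finset.sum_eq_zero fun i hi => measure_mono_null ?_ (hF.support i)
    intro s hs hs'
    refine hs ?_
    obtain ⟨hi1, hiN⟩ := Finset.mem_Icc.1 hi
    have h1 : (1 : ℝ) ≤ i := by exact_mod_cast hi1
    have h2 : (i : ℝ) ≤ D.N := by exact_mod_cast hiN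
    constructor
    · nlinarith [hs'.1]
    · nlinarith [hs'.2]
  · intro r hr i hi
    rw [hF.atom r (Ioo_subset_Icc_self hr) i hi, measureReal_def, measureReal_def,
      unfoldMeasure_shift hF.support hi (measurableSet_singleton _)]
    · congr 2
      ext s
      simp
    · rintro _ rfl
      exact ⟨by linarith [hr.1], by linarith [hr.2]⟩
  · intro i hi
    have hi' := (Finset.mem_Icc.1 hi).2
    rw [unfoldMeasure_real_node hh hF.support hi']
    rw [intervalIntegral.integral_add]
    · congr 1
      · split_ifs with h0
        · simp
        · exact hF.atom _ he i (Finset.mem_Icc.2 ⟨by omega, hi'⟩)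
      · split_ifs with h0
        · simp
        · exact hF.atom _ hz (i + 1) (Finset.mem_Icc.2 ⟨by omega, by omega⟩)
    · split_ifs with h0
      · simp
      · exact hint _ he i (Finset.mem_Icc.2 ⟨by omega, hi'⟩)
    · split_ifs with h0
      · simp
      · exact hint _ hz (i + 1) (Finset.mem_Icc.2 ⟨by omega, by omega⟩)

/-- Every folded process comes from an extended process. -/
lemma exists_isExtendedProcess_of_isFolded (hh : 0 < D.h) (hN : 0 < D.N)
    (hF : IsFolded D m w ζ) : ∃ p : Triple n, IsExtendedProcess D p ∧ p.x D.T = ζ D.h D.N 1 ∧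
      p.μ univ = ∑ i ∈ Finset.Icc 1 D.N, m i univ := by
  have := hF.finite
  have hw := isImpulsiveControl_unfoldMeasure hh hF
  have := hw.finite
  set ζ' : ℝ → ℕ → ℝ → EuclideanSpace ℝ (Fin n) := fun r i s =>
    if i = 0 then (if r = D.h ∧ s = 1 then D.x₀ else D.ξ₀) else ζ r i s with hζ'
  have hζ'pos : ∀ i ∈ Finset.Icc 1 D.N, ∀ r, ζ' r i = ζ r i := fun i hi r => funext fun s =>
    if_neg (by have := (Finset.mem_Icc.1 hi).1; omega)
  refine ⟨⟨unfoldState D ζ, unfoldMeasure D.h D.N m, w⟩, ⟨hw, boundedVariationOn_unfoldState hh hF,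
    fun t ht => if_pos ht.2, ?_, ζ', ⟨?_, ?_, ?_, ?_, ?_, ?_⟩, ?_, ?_, ?_⟩,
    unfoldState_end hh hN, ?_⟩
  · simp [unfoldState]
  · intro r _ s _ h
    have h1 : ζ' r 0 s = if r = D.h ∧ s = 1 then D.x₀ else D.ξ₀ := if_pos rfl
    rw [h1, if_neg]
    rintro ⟨rfl, rfl⟩
    simp at h
  · have h1 : ζ' D.h 0 1 = if D.h = D.h ∧ (1 : ℝ) = 1 then D.x₀ else D.ξ₀ := if_pos rfl
    rw [h1, if_pos ⟨rfl, rfl⟩]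
  · intro r hr i hi
    rw [hζ'pos i hi]
    exact hF.absCont r hr i hi
  · intro r hr i hi
    filter_upwards [hF.ode r hr i hi, ae_mem_Ioo] with s hs hs1
    have h1 : ζ' r (i - 1) s = ζ r (i - 1) s := by
      by_cases h0 : i - 1 = 0
      · have h2 : ζ' r 0 s = if r = D.h ∧ s = 1 then D.x₀ else D.ξ₀ := if_pos rfl
        rw [h0, hF.delay, h2, if_neg fun h => hs1.2.ne h.2]
      · exact if_neg h0
    rw [h1, hζ'pos i hi]
    exact hs
  · intro r hr i hi
    rw [hζ'pos i hi]
    exact (leftLim_unfoldState hh hF hi hr).symm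
  · intro i hi
    obtain ⟨hi1, hiN⟩ := Finset.mem_Icc.1 hi
    rw [hζ'pos i hi]
    rcases hi1.eq_or_lt with rfl | hlt
    · have h1 : ζ' D.h 0 1 = if D.h = D.h ∧ (1 : ℝ) = 1 then D.x₀ else D.ξ₀ := if_pos rfl
      rw [hF.start, Nat.sub_self, h1, if_pos ⟨rfl, rfl⟩]
    · rw [hζ'pos (i - 1) (Finset.mem_Icc.2 ⟨by omega, by omega⟩),
        hF.link i (Finset.mem_Icc.2 ⟨by omega, hiN⟩)]
  · intro i hi
    obtain ⟨hi1, hiN⟩ := Finset.mem_Icc.1 hi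
    have hi' : i ∈ Finset.Icc 1 D.N := Finset.mem_Icc.2 ⟨by omega, hiN⟩
    have h1 := unfoldState_add_node (ζ := ζ) hh hi' ⟨le_rfl, hh⟩ (Or.inl (by omega))
    rw [zero_add] at h1
    rw [hζ'pos i hi']
    exact h1
  · intro i hi t ht
    obtain ⟨τ, rfl⟩ : ∃ τ, t = ((i : ℝ) - 1) * D.h + τ := ⟨t - ((i : ℝ) - 1) * D.h, by ring⟩
    have hτ : τ ∈ Ioo 0 D.h := ⟨by linarith [ht.1], by linarith [ht.2]⟩
    rw [add_sub_cancel_left]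
    have h1 := hF.dyn i hi τ hτ
    have h2 : ∀ F : EuclideanSpace ℝ (Fin n) × EuclideanSpace ℝ (Fin n) →
        EuclideanSpace ℝ (Fin n), ∀ ρ ∈ Ioo 0 D.h,
        F (unfoldState D ζ (ρ + ((i : ℝ) - 1) * D.h),
            unfoldState D ζ (ρ + ((i : ℝ) - 1) * D.h - D.h))
          = F (ζ ρ i 1, ζ ρ (i - 1) 1) := fun F ρ hρ => by
      rw [unfoldState_delay hh hF.delay hi hρ,
        unfoldState_add_node hh hi (Ioo_subset_Ico_self hρ) (Or.inr hρ.1)]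
    have h3 : (fun r : Ioc 0 τ => ζ' r i 1
        - Function.leftLim (unfoldState D ζ) (r + ((i : ℝ) - 1) * D.h))
        = fun r : Ioc 0 τ => ζ r i 1 - ζ r i 0 := funext fun r => by
      rw [hζ'pos i hi, leftLim_unfoldState hh hF hi ⟨r.2.1, r.2.2.trans hτ.2.le⟩]
    have h4 := unfoldState_add_node (ζ := ζ) hh hi (Ioo_subset_Ico_self hτ) (Or.inr hτ.1)
    rw [add_comm] at h4
    simp only
    rw [h3, h4, hζ'pos i hi, intervalIntegral_shift_eq
        (φ := fun t => D.f (unfoldState D ζ t, unfoldState D ζ (t - D.h))) hτ.1.le hτ.2 (h2 D.f),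
      setIntegral_contPart_eq
        (φ := fun t => D.g (unfoldState D ζ t, unfoldState D ζ (t - D.h))) hτ.2
        (fun B hB hsub => unfoldMeasure_shift hF.support hi hB hsub) (h2 D.g)]
    exact h1
  · rw [hζ'pos D.N (Finset.mem_Icc.2 ⟨hN, le_rfl⟩)]
    exact unfoldState_end hh hN
  · simp only [unfoldMeasure_apply MeasurableSet.univ, preimage_univ]

end Unfold

lemma exists_isOptimal (D : System n)
    (hf : ContDiff ℝ 1 D.f) (hg : ContDiff ℝ 1 D.g)
    (hf_bdd : ∃ M : ℝ, ∀ z, ‖D.f z‖ ≤ M) (hg_bdd : ∃ M : ℝ, ∀ z, ‖D.g z‖ ≤ M)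
    (hh : 0 < D.h) (hN : 0 < D.N) {K : ℝ} (hK : 0 < K)
    {𝒯 : Set (EuclideanSpace ℝ (Fin n))} (h𝒯 : IsClosed 𝒯)
    {Ψ : EuclideanSpace ℝ (Fin n) → ℝ} (hΨ : LowerSemicontinuous Ψ)
    (hadm : ∃ p : Triple n, IsAdmissible D K 𝒯 p) : ∃ p : Triple n, IsOptimal D K 𝒯 Ψ p := by
  obtain ⟨B, L, hBL⟩ := exists_isCurve_of_isFolded hf hg hf_bdd hg_bdd hh hN hK
  have hcurve : ∀ p : Triple n, IsAdmissible D K 𝒯 p →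
      ∃ A y, IsCurve D K B L A y ∧ y D.N 1 = p.x D.T := by
    rintro p ⟨hp, hmass, -⟩
    obtain ⟨m, w, ζ, hF, hend, hsum⟩ := exists_isFolded_of_isExtendedProcess hf.continuous
      hg.continuous hf_bdd hg_bdd hh hN hp
    obtain ⟨A, y, hc, hy⟩ := hBL m w ζ hF
      (hsum.trans (ENNReal.toReal_le_of_le_ofReal hK.le hmass))
    exact ⟨A, y, hc, hy.trans hend⟩
  have hcont : Continuous fun q : (ℕ → ℝ → ℝ) × (ℕ → ℝ → EuclideanSpace ℝ (Fin n)) =>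
      q.2 D.N 1 := by fun_prop
  have hcpt : IsCompact ({q : (ℕ → ℝ → ℝ) × (ℕ → ℝ → EuclideanSpace ℝ (Fin n)) |
      IsCurve D K B L q.1 q.2} ∩ (fun q => q.2 D.N 1) ⁻¹' 𝒯) :=
    (isCompact_curves hf.continuous hg.continuous K B L).inter_right (h𝒯.preimage hcont)
  have hmem : ∀ p : Triple n, IsAdmissible D K 𝒯 p →
      ∃ q ∈ {q : (ℕ → ℝ → ℝ) × (ℕ → ℝ → EuclideanSpace ℝ (Fin n)) |
        IsCurve D K B L q.1 q.2} ∩ (fun q => q.2 D.N 1) ⁻¹' 𝒯, q.2 D.N 1 = p.x D.T := by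
    intro p hp
    obtain ⟨A, y, hc, hy⟩ := hcurve p hp
    refine ⟨(A, y), ⟨hc, ?_⟩, hy⟩
    change y D.N 1 ∈ 𝒯
    rw [hy]
    exact hp.2.2
  obtain ⟨p₀, hp₀⟩ := hadm
  obtain ⟨q₀, hq₀, -⟩ := hmem p₀ hp₀
  obtain ⟨⟨A, y⟩, ⟨hc, hyT⟩, hmin⟩ := LowerSemicontinuousOn.exists_isMinOn ⟨q₀, hq₀⟩ hcpt
    ((hΨ.comp hcont).lowerSemicontinuousOn _)
  obtain ⟨m, w, ζ, hF, hend, hsum⟩ := exists_isFolded_of_isCurve hf.continuous hg.continuous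
    hf_bdd hg_bdd hh.le hc
  obtain ⟨p, hp, hpT, hpμ⟩ := exists_isExtendedProcess_of_isFolded hh hN hF
  have := hF.finite
  refine ⟨p, ⟨hp, ?_, ?_⟩, fun q hq => ?_⟩
  · have h1 : ∑ i ∈ Finset.Icc 1 D.N, m i univ
        = ENNReal.ofReal (∑ i ∈ Finset.Icc 1 D.N, (m i).real univ) := by
      rw [ENNReal.ofReal_sum_of_nonneg fun i _ => measureReal_nonneg]
      exact Finset.sum_congr rfl fun i _ => (ofReal_measureReal (by finiteness)).symm
    rw [hpμ, h1]
    exact ENNReal.ofReal_le_ofReal hsum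
  · rw [hpT, hend]
    exact hyT
  · obtain ⟨q', hq', hqT⟩ := hmem q hq
    have h1 := isMinOn_iff.1 hmin _ hq'
    simp only [Function.comp] at h1
    rwa [hpT, hend, ← hqT]

end DelayImpulsive

theorem theorem5p1 {n : ℕ} (D : DelayImpulsive.System n)
    (hf : ContDiff ℝ 1 D.f) (hg : ContDiff ℝ 1 D.g)
    (hf_bdd : ∃ M : ℝ, ∀ z, ‖D.f z‖ ≤ M) (hg_bdd : ∃ M : ℝ, ∀ z, ‖D.g z‖ ≤ M)
    (hh : 0 < D.h) (hN : 0 < D.N)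
    (K : ℝ) (hK : 0 < K)
    (𝒯 : Set (EuclideanSpace ℝ (Fin n))) (h𝒯 : IsClosed 𝒯)
    (Ψ : EuclideanSpace ℝ (Fin n) → ℝ) (hΨ : LowerSemicontinuous Ψ)
    (hadm : ∃ p : DelayImpulsive.Triple n, DelayImpulsive.IsAdmissible D K 𝒯 p) :
    ∃ p : DelayImpulsive.Triple n, DelayImpulsive.IsOptimal D K 𝒯 Ψ p :=
  DelayImpulsive.exists_isOptimal D hf hg hf_bdd hg_bdd hh hN hK h𝒯 hΨ hadm
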